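/- For a graph $G$ on $[n]=\{1,\dots,n\}$ and $i\in[n]$, let $N_{G,1}(i)$ denote the $1$-neighborhood of $i$, i.e. the subgraph of $G$ induced by the vertices at distance at most $1$ from $i$. Two labeled graphs that both have $i$ as a vertex are called isomorphic with fixed point $i$ if there is a graph isomorphism between them that maps $i$ to $i$. There are universal constants $C,c>0$ with the following property. Let the positive sequence $(p_n)_{n\ge 1}$, $0<p_n\le 1$, satisfy $n^{-1/2}\log^{C} n\le p_n\le c$ for all large $n$, and for each $n$ let $\Gamma_n$ be the labeled Erdős–Rényi $G(n,p_n)$ graph on $[n]$ (each pair of distinct vertices is an edge with probability $p_n$, independently). Then there is a sequence $\omega_n\ge 0$ with $\omega_n\to\infty$ such that, with probability at least $1-n^{-\omega_n}$, the following holds: for every labeled graph $\tilde\Gamma_n$ on $[n]$ such that $N_{\Gamma_n,1}(i)$ and $N_{\tilde\Gamma_n,1}(i)$ are isomorphic with fixed point $i$ for all $i\in[n]$, we have $\Gamma_n=\tilde\Gamma_n$ (the two graphs have the same edge set). -/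

import Mathlib

namespace ShotgunAssembly

/-- The vertices of `G` at (extended) distance at most `r` from `v`. Vertices that are not
connected to `v` are at distance `⊤`, hence not included. -/
def nbhdVerts {V : Type*} (G : SimpleGraph V) (r : ℕ) (v : V) : Set V :=
  {w | G.edist v w ≤ (r : ℕ∞)}

/-- The `r`-neighborhood of `v` in `G`: the subgraph of `G` induced by the vertices at distance
at most `r` from `v`, as a labeled graph on that set of vertices. -/
def nbhd {V : Type*} (G : SimpleGraph V) (r : ℕ) (v : V) : SimpleGraph (nbhdVerts G r v) :=
  G.induce (nbhdVerts G r v)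

/-- Two labeled graphs, with vertex sets `S` and `T` in a common set of labels, are isomorphic with
fixed point `i`: `i` is a vertex of both, and some graph isomorphism between them sends `i`
to `i`. -/
def IsoWithFixedPoint {V : Type*} {S T : Set V} (G : SimpleGraph S) (H : SimpleGraph T)
    (i : V) : Prop :=
  ∃ (hS : i ∈ S) (hT : i ∈ T) (f : G ≃g H), f ⟨i, hS⟩ = ⟨i, hT⟩

/-- `G` is determined, as a labeled graph, by the isomorphism types of its `1`-neighborhoods
with fixed centers: every labeled graph on the same vertex set whose `1`-neighborhood at each
vertex `i` is isomorphic to that of `G` with fixed point `i` is equal to `G`. -/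
def DeterminedByNbhds {V : Type*} (G : SimpleGraph V) : Prop :=
  ∀ G' : SimpleGraph V,
    (∀ i : V, IsoWithFixedPoint (nbhd G 1 i) (nbhd G' 1 i) i) → G = G'

end ShotgunAssembly

/-!
Write `X` for the random graph, `D = n * p` and `d = n * p ^ 2` for its typical degrees and
codegrees, and `L = log n`. A graph `Y` with the same `1`-neighbourhoods comes with isomorphisms
`σ i`, from the neighbourhood of `i` in `X` to that in `Y`, fixing `i` (`Matches`). It has to be
shown that no `σ i` moves a neighbour of `i`. There are too many possible `Y` for a direct union
bound, so the argument moves in three stages from no information to almost all `σ i` being almost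
the identity and then to equality. All exceptional events have probability at most
`exp (-(2 * L ^ 2))`, which is where `n ^ (-ω n)` with `ω n = log n` comes from.

*Consistency.* An edge of `Y` is seen by each of its common neighbours `w` as the image under `σ w`
of an edge of `X`. If for many edges these preimages differ (`Contested`), then the maps `σ i` for a
random set of about `n * L / d` vertices `i` already reveal a positive proportion of edges of `X`
that must be present or absent together with other possible edges (`Matches.exists_twins`).
Recording these maps costs a factor `exp (O (n * D * L ^ 2 / d))`, while such coincidences have
probability `p ^ Ω(n * D)` (`real_twins_le`), so `d ≥ L ^ 4` suffices to exclude this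
(`prob_contested_le`).

*Most neighbours are fixed.* Hence the preimages agree for most edges. Inside the neighbourhood of a
vertex `v`, expansion of `X` and a combinatorial lemma on labels (`exists_dominant_label`) show that
most neighbours `w` of `v` agree on the preimage `τ v` of `v` (`exists_dominant_preimage`). Then
most neighbours of `v` are adjacent to `τ v` in `X`, and since codegrees are much smaller than
degrees, `τ v = v` (`dominant_preimage_eq_self`).

*Bootstrapping.* Each moved neighbour of `i` creates about `d` edges of `Y` in the neighbourhood of
`i` that are not edges of `X`, counted twice if few neighbours are moved; but each new edge of `Y`
lies in only about `d` neighbourhoods, and `i` has at most as many new neighbours as moved ones.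
Comparing the two counts leaves no moved neighbour (`Matches.eq_of_few_moved`).
-/

open Finset

namespace ShotgunAssembly

/-! ### Random subsets of a finite set -/

/-- The probability that the random subset of `E` containing every point independently with
probability `p` is equal to `A`, for `A ⊆ E`. -/
noncomputable def wt {ι : Type*} [DecidableEq ι] (p : ℝ) (E A : Finset ι) : ℝ :=
  p ^ #A * (1 - p) ^ #(E \ A)

section weights

variable {ι : Type*} [DecidableEq ι] {p : ℝ} {E : Finset ι}

lemma wt_nonneg (h0 : 0 ≤ p) (h1 : p ≤ 1) (A : Finset ι) : 0 ≤ wt p E A := by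
  have : 0 ≤ 1 - p := by linarith
  unfold wt; positivity

lemma sum_wt (p : ℝ) (E : Finset ι) : ∑ A ∈ E.powerset, wt p E A = 1 := by
  have := Finset.prod_add (fun _ : ι => p) (fun _ => 1 - p) E
  simp only [prod_const] at this
  simp only [wt, ← this]
  simp

lemma sum_wt_subset {B : Finset ι} (hB : B ⊆ E) :
    ∑ A ∈ E.powerset with B ⊆ A, wt p E A = p ^ #B := by
  have h := Finset.prod_add (fun _ : ι => p) (fun e => if e ∈ B then 0 else 1 - p) E
  have h1 : ∏ e ∈ E, (p + if e ∈ B then 0 else 1 - p) = p ^ #B := by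
    rw [← Finset.prod_subset hB]
    · rw [← prod_const]
      exact prod_congr rfl fun e he => by simp [he]
    · intro e _ he
      simp [he]
  rw [← h1, h, sum_filter]
  refine sum_congr rfl fun A hA => ?_
  split_ifs with hBA
  · unfold wt
    rw [prod_const]
    congr 1
    rw [← prod_const]
    refine prod_congr rfl fun e he => ?_
    have : e ∉ B := fun hb => (mem_sdiff.1 he).2 (hBA hb)
    simp [this]
  · obtain ⟨e, heB, heA⟩ := not_subset.1 hBA
    symm
    refine mul_eq_zero_of_right _ (prod_eq_zero (mem_sdiff.2 ⟨hB heB, heA⟩) (by simp [heB]))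

/-- The exponential moment of the number of sets `s l` contained in the random set, for pairwise
disjoint sets of equal size `h`. Expanding `∏ l, (1 + (eᵗ - 1) 1_{s l ⊆ A})` reduces it to the
probabilities of containing a fixed set, so no independence has to be formalized. -/
lemma sum_wt_exp_le {κ : Type*} (h0 : 0 ≤ p) (h1 : p ≤ 1)
    (Λ : Finset κ) (s : κ → Finset ι) (h : ℕ) (hs : ∀ l ∈ Λ, s l ⊆ E) (hc : ∀ l ∈ Λ, #(s l) = h)
    (hd : (Λ : Set κ).PairwiseDisjoint s) {t : ℝ} (ht : |t| ≤ 1) :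
    ∑ A ∈ E.powerset, wt p E A * Real.exp (t * #{l ∈ Λ | s l ⊆ A}) ≤
      Real.exp (#Λ * p ^ h * (t + t ^ 2)) := by
  classical
  have e1 : ∀ A : Finset ι, Real.exp (t * #{l ∈ Λ | s l ⊆ A}) =
      ∑ M ∈ Λ.powerset, (Real.exp t - 1) ^ #M * if M.biUnion s ⊆ A then 1 else 0 := by
    intro A
    have : Real.exp (t * #{l ∈ Λ | s l ⊆ A}) =
        ∏ l ∈ Λ, ((Real.exp t - 1) * (if s l ⊆ A then 1 else 0) + 1) := by
      rw [mul_comm, Real.exp_nat_mul, ← prod_const, prod_filter]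
      refine prod_congr rfl fun l _ => ?_
      split_ifs <;> ring
    rw [this, prod_add]
    refine sum_congr rfl fun M _ => ?_
    rw [prod_mul_distrib, prod_const, prod_const_one, mul_one]
    congr 1
    by_cases hM : M.biUnion s ⊆ A
    · rw [if_pos hM]
      exact prod_eq_one fun l hl => by rw [if_pos ((subset_biUnion_of_mem s hl).trans hM)]
    · rw [if_neg hM]
      rw [biUnion_subset] at hM
      push Not at hM
      obtain ⟨l, hl, hlA⟩ := hM
      exact prod_eq_zero hl (by rw [if_neg hlA])
  have e2 : ∑ A ∈ E.powerset, wt p E A * Real.exp (t * #{l ∈ Λ | s l ⊆ A}) =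
      (1 + (Real.exp t - 1) * p ^ h) ^ #Λ := by
    simp_rw [e1, mul_sum]
    rw [sum_comm]
    have : (1 + (Real.exp t - 1) * p ^ h) ^ #Λ =
        ∑ M ∈ Λ.powerset, ((Real.exp t - 1) * p ^ h) ^ #M := by
      have := prod_add (fun _ : κ => (Real.exp t - 1) * p ^ h) (fun _ => (1 : ℝ)) Λ
      simp only [prod_const, one_pow, mul_one] at this
      rw [← this, add_comm]
    rw [this]
    refine sum_congr rfl fun M hM => ?_
    rw [mem_powerset] at hM
    have hMc : #(M.biUnion s) = #M * h := by
      rw [card_biUnion (fun a ha b hb hab => hd (hM ha) (hM hb) hab),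
        sum_const_nat (fun l hl => hc l (hM hl))]
    have hME : M.biUnion s ⊆ E := biUnion_subset.2 fun l hl => hs l (hM hl)
    rw [mul_pow, ← pow_mul, mul_comm h, ← hMc, ← sum_wt_subset hME, mul_sum, sum_filter]
    refine sum_congr rfl fun A _ => ?_
    split_ifs <;> ring
  rw [e2]
  have hq0 : 0 ≤ p ^ h := by positivity
  have hq1 : p ^ h ≤ 1 := pow_le_one₀ h0 h1
  have hexp : Real.exp t - 1 ≤ t + t ^ 2 := by
    have := (abs_le.1 (Real.abs_exp_sub_one_sub_id_le ht)).2
    linarith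
  have hb0 : 0 ≤ 1 + (Real.exp t - 1) * p ^ h := by
    nlinarith [Real.exp_pos t]
  calc (1 + (Real.exp t - 1) * p ^ h) ^ #Λ ≤ (Real.exp (p ^ h * (t + t ^ 2))) ^ #Λ := by
        refine pow_le_pow_left₀ hb0 ?_ _
        have := Real.add_one_le_exp (p ^ h * (t + t ^ 2))
        nlinarith
    _ = _ := by rw [← Real.exp_nat_mul]; ring_nf

/-- If the elements of `D` satisfy `e ∈ A ↔ g e ∈ A`, where `g` lowers the rank `r` on `D`, then `A`
is determined by `A \ D`; so at least `R` elements of `D` being in `A` costs a factor `p ^ R`. -/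
lemma sum_wt_determined_le (h0 : 0 ≤ p) (h1 : p ≤ 1) (D : Finset ι)
    (r : ι → ℕ) (g : ι → ι) (hg : ∀ e ∈ D, r (g e) < r e) (R : ℕ) :
    ∑ A ∈ E.powerset with (∀ e ∈ D, e ∈ A ↔ g e ∈ A) ∧ R ≤ #(A ∩ D), wt p E A ≤ p ^ R := by
  set Ev := {A ∈ E.powerset | (∀ e ∈ D, e ∈ A ↔ g e ∈ A) ∧ R ≤ #(A ∩ D)} with hEv
  have hq : 0 ≤ 1 - p := by linarith
  have hle : ∀ A ∈ Ev, wt p E A ≤ p ^ R * wt p (E \ D) (A \ D) := by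
    intro A hA
    simp only [hEv, mem_filter, mem_powerset] at hA
    obtain ⟨hAE, -, hR⟩ := hA
    have c1 : #A = #(A ∩ D) + #(A \ D) := (card_inter_add_card_sdiff A D).symm
    have c2 : #((E \ D) \ (A \ D)) ≤ #(E \ A) := by
      refine card_le_card fun x hx => ?_
      simp only [mem_sdiff, not_and, not_not] at hx ⊢
      exact ⟨hx.1.1, fun h => hx.1.2 (hx.2 h)⟩
    unfold wt
    rw [c1, pow_add, mul_assoc]
    refine mul_le_mul (pow_le_pow_of_le_one h0 h1 hR)
      (mul_le_mul_of_nonneg_left (pow_le_pow_of_le_one hq (by linarith) c2) (by positivity))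
      (by positivity) (by positivity)
  have hinj : Set.InjOn (fun A : Finset ι => A \ D) Ev := by
    intro A hA B hB hAB
    simp only [hEv, coe_filter, mem_powerset, Set.mem_ofPred_eq] at hA hB
    simp only at hAB
    -- following `g` from a point of `D` leaves `D`, by induction on the rank
    have key : ∀ k : ℕ, ∀ e : ι, r e < k → (e ∈ A ↔ e ∈ B) := by
      intro k
      induction k with
      | zero => intro e he; omega
      | succ k ih =>
        intro e he
        by_cases heD : e ∈ D
        · rw [hA.2.1 e heD, hB.2.1 e heD]
          exact ih _ (by have := hg e heD; omega)
        · have : e ∈ A \ D ↔ e ∈ B \ D := by rw [hAB]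
          simpa [heD] using this
    ext e
    exact key (r e + 1) e (Nat.lt_succ_self _)
  calc ∑ A ∈ Ev, wt p E A ≤ ∑ A ∈ Ev, p ^ R * wt p (E \ D) (A \ D) := sum_le_sum hle
    _ = p ^ R * ∑ B ∈ Ev.image (fun A => A \ D), wt p (E \ D) B := by
        rw [sum_image hinj, mul_sum]
    _ ≤ p ^ R * ∑ B ∈ (E \ D).powerset, wt p (E \ D) B := by
        refine mul_le_mul_of_nonneg_left (sum_le_sum_of_subset_of_nonneg ?_ ?_) (by positivity)
        · intro B hB
          obtain ⟨A, hA, rfl⟩ := mem_image.1 hB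
          simp only [hEv, mem_filter, mem_powerset] at hA
          exact mem_powerset.2 (sdiff_subset_sdiff hA.1 le_rfl)
        · intro B _ _; exact wt_nonneg h0 h1 B
    _ = p ^ R := by rw [sum_wt, mul_one]

end weights
/-! ### Probabilities in the binomial random graph -/

section graphs
open MeasureTheory
open scoped Classical

variable {V : Type*} [Fintype V] (p : unitInterval)

/-- The pairs of distinct vertices, that is, the possible edges of a graph on `V`. -/
noncomputable def slots (V : Type*) [Fintype V] : Finset (Sym2 V) := {e | ¬ e.IsDiag}

lemma edgeFinset_mem_slots (G : SimpleGraph V) : G.edgeFinset ∈ (slots V).powerset := by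
  rw [mem_powerset]
  intro e he
  simp only [slots, mem_filter, mem_univ, true_and]
  exact G.not_isDiag_of_mem_edgeSet (by simpa using he)

lemma card_slots : #(slots V) = (Nat.card V).choose 2 := by
  rw [Nat.card_eq_fintype_card, ← Sym2.card_diagSet_compl, Fintype.card_subtype]
  congr 1

lemma real_singleton (G : SimpleGraph V) :
    (SimpleGraph.binomialRandom V p).real {G} = wt (p : ℝ) (slots V) G.edgeFinset := by
  rw [measureReal_def, SimpleGraph.binomialRandom_singleton, wt,
    card_sdiff_of_subset (mem_powerset.1 (edgeFinset_mem_slots G)), card_slots]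
  simp [Set.ncard_eq_toFinset_card', SimpleGraph.edgeFinset]

lemma real_eq_sum (S : Set (SimpleGraph V)) :
    (SimpleGraph.binomialRandom V p).real S =
      ∑ A ∈ (slots V).powerset with
          SimpleGraph.fromEdgeSet ((A : Finset (Sym2 V)) : Set (Sym2 V)) ∈ S,
        wt (p : ℝ) (slots V) A := by
  have : MeasurableSingletonClass (SimpleGraph V) := ⟨fun G => by
    rw [← SimpleGraph.measurableEmbedding_edgeSet.measurableSet_image, Set.image_singleton]
    exact measurableSet_singleton _⟩
  have h1 : (SimpleGraph.binomialRandom V p).real S = ∑ G : SimpleGraph V with G ∈ S,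
      (SimpleGraph.binomialRandom V p).real {G} := by
    rw [sum_measureReal_singleton]
    congr 1
    ext; simp
  rw [h1]
  refine sum_bij (fun G _ => G.edgeFinset) ?_ ?_ ?_ ?_
  · intro G hG
    rw [mem_filter]
    refine ⟨edgeFinset_mem_slots G, ?_⟩
    simpa using hG
  · intro G _ H _ h
    simpa using h
  · intro A hA
    rw [mem_filter] at hA
    refine ⟨SimpleGraph.fromEdgeSet (A : Set (Sym2 V)), by simpa using hA.2, ?_⟩
    ext e
    have := fun he : e ∈ A => mem_powerset.1 hA.1 he
    simp only [slots, mem_filter, mem_univ, true_and] at this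
    simpa using this
  · intro G _
    exact real_singleton p G

/-- Chernoff's bound for the number of `l ∈ Λ` whose set `s l` of possible edges is present, for
pairwise disjoint sets of size `h`. Positive `t` gives the upper tail, negative `t` the lower. -/
lemma real_chernoff {κ : Type*} (Λ : Finset κ) (s : κ → Finset (Sym2 V)) (h : ℕ)
    (hs : ∀ l ∈ Λ, ∀ e ∈ s l, ¬ e.IsDiag) (hc : ∀ l ∈ Λ, #(s l) = h)
    (hd : (Λ : Set κ).PairwiseDisjoint s) {t : ℝ} (ht : |t| ≤ 1) (R : ℝ) :
    (SimpleGraph.binomialRandom V p).real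
        {G | t * R ≤ t * #{l ∈ Λ | ∀ e ∈ s l, e ∈ G.edgeSet}} ≤
      Real.exp (#Λ * (p : ℝ) ^ h * (t + t ^ 2) - t * R) := by
  have hs' : ∀ l ∈ Λ, s l ⊆ slots V := fun l hl e he => by simpa [slots] using hs l hl e he
  have key := sum_wt_exp_le p.2.1 p.2.2 Λ s h hs' hc hd ht
  rw [real_eq_sum, Real.exp_sub, le_div_iff₀ (Real.exp_pos _)]
  refine le_trans ?_ key
  rw [sum_mul, sum_filter]
  refine sum_le_sum fun A _ => ?_
  have hw := wt_nonneg (E := slots V) p.2.1 p.2.2 A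
  split_ifs with hA
  · refine mul_le_mul_of_nonneg_left (Real.exp_le_exp.2 (hA.trans (le_of_eq ?_))) hw
    congr 2
    refine congrArg Finset.card (Finset.ext fun l => ?_)
    simp only [mem_filter, SimpleGraph.edgeSet_fromEdgeSet, Set.mem_sdiff, mem_coe]
    exact and_congr_right fun hl => ⟨fun H e he => (H e he).1,
      fun H e he => ⟨H he, fun hh => hs l hl e he (by simpa using hh)⟩⟩
  · positivity

lemma real_determined_le (D : Finset (Sym2 V)) (r : Sym2 V → ℕ) (g : Sym2 V → Sym2 V)
    (hg : ∀ e ∈ D, r (g e) < r e) (R : ℕ) :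
    (SimpleGraph.binomialRandom V p).real
        {G | (∀ e ∈ D, e ∈ G.edgeSet ↔ g e ∈ G.edgeSet) ∧ R ≤ #{e ∈ D | e ∈ G.edgeSet}} ≤
      (p : ℝ) ^ R := by
  have key := sum_wt_determined_le (E := slots V) p.2.1 p.2.2 D r g hg R
  rw [real_eq_sum]
  refine le_of_eq_of_le (sum_congr (Finset.ext fun A => ?_) fun _ _ => rfl) key
  simp only [mem_filter]
  refine and_congr_right fun hA => ?_
  have hmem : ∀ e, e ∈ (SimpleGraph.fromEdgeSet (A : Set (Sym2 V))).edgeSet ↔ e ∈ A := by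
    intro e
    have := fun he : e ∈ A => mem_powerset.1 hA he
    simp only [slots, mem_filter, mem_univ, true_and] at this
    simpa using this
  simp only [Set.mem_ofPred_eq, hmem, inter_comm A D, filter_mem_eq_inter]

lemma real_union_le {κ : Type*} (T : Finset κ) (S : κ → Set (SimpleGraph V))
    (E : Set (SimpleGraph V))
    (hE : ∀ G ∈ E, ∃ k ∈ T, G ∈ S k) {b : ℝ}
    (hb : ∀ k ∈ T, (SimpleGraph.binomialRandom V p).real (S k) ≤ b) :
    (SimpleGraph.binomialRandom V p).real E ≤ #T * b := by
  calc (SimpleGraph.binomialRandom V p).real E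
      ≤ (SimpleGraph.binomialRandom V p).real (⋃ k ∈ T, S k) := by
        refine measureReal_mono (fun G hG => ?_) (measure_ne_top _ _)
        simpa using hE G hG
    _ ≤ ∑ k ∈ T, (SimpleGraph.binomialRandom V p).real (S k) := measureReal_biUnion_finset_le T S
    _ ≤ ∑ k ∈ T, b := sum_le_sum hb
    _ = #T * b := by simp

end graphs

/-! ### Counting -/

section counting
variable {α β : Type*} [Fintype α] [Fintype β]

open scoped Classical in
/-- The indicator of a proposition, as a real number. -/
noncomputable def ind (P : Prop) : ℝ := if P then 1 else 0

/-- The number of elements satisfying `P`, as a real number. No decidability is required, so that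
predicates can be rewritten freely. -/
noncomputable def cnt (P : α → Prop) : ℝ := ∑ a, ind (P a)

lemma ind_pos {P : Prop} (h : P) : ind P = 1 := if_pos h

lemma ind_neg {P : Prop} (h : ¬ P) : ind P = 0 := if_neg h

lemma ind_nonneg (P : Prop) : 0 ≤ ind P := by
  unfold ind; split_ifs <;> norm_num

lemma cnt_nonneg (P : α → Prop) : 0 ≤ cnt P := sum_nonneg fun _ _ => ind_nonneg _

lemma cnt_eq_card (P : α → Prop) [DecidablePred P] : cnt P = #{a | P a} := by
  rw [card_filter, Nat.cast_sum]
  refine sum_congr rfl fun a _ => ?_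
  by_cases h : P a
  · rw [ind_pos h, if_pos h, Nat.cast_one]
  · rw [ind_neg h, if_neg h, Nat.cast_zero]

lemma sum_cnt_comm (P : α → β → Prop) :
    ∑ a, cnt (fun b => P a b) = ∑ b, cnt (fun a => P a b) := sum_comm

lemma cnt_prod (P : α → β → Prop) :
    cnt (fun x : α × β => P x.1 x.2) = ∑ a, cnt (fun b => P a b) := Fintype.sum_prod_type _

lemma cnt_mono {P Q : α → Prop} (h : ∀ a, P a → Q a) : cnt P ≤ cnt Q := by
  refine sum_le_sum fun a _ => ?_
  by_cases hP : P a
  · rw [ind_pos hP, ind_pos (h a hP)]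
  · rw [ind_neg hP]; exact ind_nonneg _

lemma cnt_congr {P Q : α → Prop} (h : ∀ a, P a ↔ Q a) : cnt P = cnt Q :=
  le_antisymm (cnt_mono fun a => (h a).1) (cnt_mono fun a => (h a).2)

lemma cnt_false {P : α → Prop} (h : ∀ a, ¬ P a) : cnt P = 0 :=
  sum_eq_zero fun a _ => ind_neg (h a)

lemma cnt_or_le (P Q : α → Prop) : cnt (fun a => P a ∨ Q a) ≤ cnt P + cnt Q := by
  unfold cnt
  rw [← sum_add_distrib]
  refine sum_le_sum fun a _ => ?_
  have := ind_nonneg (P a)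
  have := ind_nonneg (Q a)
  by_cases h : P a
  · rw [ind_pos (Or.inl h), ind_pos h]; linarith
  · by_cases h' : Q a
    · rw [ind_pos (Or.inr h'), ind_pos h']; linarith
    · rw [ind_neg (not_or.2 ⟨h, h'⟩)]; linarith

lemma cnt_le_of_injOn {P : α → Prop} {Q : β → Prop} (f : α → β) (h : ∀ a, P a → Q (f a))
    (hf : ∀ a b, P a → P b → f a = f b → a = b) : cnt P ≤ cnt Q := by
  classical
  rw [cnt_eq_card, cnt_eq_card]
  have : #{a | P a} ≤ #{b | Q b} := card_le_card_of_injOn f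
    (fun a ha => by simpa using h a (by simpa using ha))
    (fun a ha b hb => hf a b (by simpa using ha) (by simpa using hb))
  exact_mod_cast this

lemma mul_cnt_le_sum {f : α → ℝ} (hf : ∀ a, 0 ≤ f a) (c : ℝ) :
    c * cnt (fun a => c < f a) ≤ ∑ a, f a := by
  unfold cnt
  rw [mul_sum]
  refine sum_le_sum fun a _ => ?_
  by_cases h : c < f a
  · rw [ind_pos h]; linarith
  · rw [ind_neg h, mul_zero]; exact hf a

lemma cnt_le_add {P Q R : α → Prop} (h : ∀ a, R a → P a ∨ Q a) : cnt R ≤ cnt P + cnt Q :=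
  (cnt_mono h).trans (cnt_or_le P Q)

lemma cnt_add_le {P Q R : α → Prop} (hP : ∀ a, P a → R a) (hQ : ∀ a, Q a → R a)
    (hd : ∀ a, P a → ¬ Q a) : cnt P + cnt Q ≤ cnt R := by
  unfold cnt
  rw [← sum_add_distrib]
  refine sum_le_sum fun a _ => ?_
  have := ind_nonneg (R a)
  by_cases h : P a
  · rw [ind_pos h, ind_neg (hd a h), ind_pos (hP a h)]; norm_num
  · by_cases h' : Q a
    · rw [ind_pos h', ind_neg h, ind_pos (hQ a h')]; norm_num
    · rw [ind_neg h, ind_neg h']; linarith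

lemma mul_cnt_le_cnt_prod {P : α → Prop} {Q : α → β → Prop} {c : ℝ}
    (h : ∀ a, P a → c ≤ cnt (Q a)) : c * cnt P ≤ cnt (fun x : α × β => P x.1 ∧ Q x.1 x.2) := by
  rw [cnt_prod (fun a b => P a ∧ Q a b), cnt, mul_sum]
  refine sum_le_sum fun a _ => ?_
  by_cases hP : P a
  · rw [ind_pos hP, mul_one]
    exact (h a hP).trans (cnt_mono fun b hb => ⟨hP, hb⟩)
  · rw [ind_neg hP, mul_zero]; exact cnt_nonneg _

lemma cnt_prod_le_mul_cnt {P : α → Prop} {Q : α → β → Prop} {c : ℝ}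
    (h : ∀ a, P a → cnt (Q a) ≤ c) : cnt (fun x : α × β => P x.1 ∧ Q x.1 x.2) ≤ c * cnt P := by
  rw [cnt_prod (fun a b => P a ∧ Q a b), cnt, mul_sum]
  refine sum_le_sum fun a _ => ?_
  by_cases hP : P a
  · rw [ind_pos hP, mul_one]
    exact (cnt_mono fun b hb => hb.2).trans (h a hP)
  · rw [ind_neg hP, mul_zero]; exact (cnt_false fun b hb => hP hb.1).le

lemma cnt_mem_and (S : Finset α) (P : α → Prop) [DecidablePred P] :
    cnt (fun a => a ∈ S ∧ P a) = #{a ∈ S | P a} := by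
  classical
  rw [cnt_eq_card]
  congr 2
  ext a
  simp

end counting

/-! ### A dominant label in an expanding set -/

section labels
open scoped Classical

variable {V : Type*} [Fintype V]

/-- If no label is frequent on `R`, then some set of labels has total frequency between `t`
and `2 * t`. -/
lemma exists_label_set {R : Finset V} {u : V → V} {t : ℝ} (ht : 0 < t)
    (hf : ∀ a, (#{w ∈ R | u w = a} : ℝ) < t) (hR : t ≤ #R) :
    ∃ Q : Finset V, t ≤ #{w ∈ R | u w ∈ Q} ∧ (#{w ∈ R | u w ∈ Q} : ℝ) < 2 * t := by
  have hne : ({Q | t ≤ #{w ∈ R | u w ∈ Q}} : Finset (Finset V)).Nonempty :=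
    ⟨univ, by simpa using hR⟩
  obtain ⟨Q, hQ⟩ := Finset.exists_minimal hne
  have hQ1 : t ≤ #{w ∈ R | u w ∈ Q} := by simpa using hQ.prop
  refine ⟨Q, hQ1, ?_⟩
  obtain ⟨a, ha⟩ : Q.Nonempty := by
    by_contra h
    rw [not_nonempty_iff_eq_empty] at h
    subst h
    simp at hQ1
    linarith
  have h1 : (#{w ∈ R | u w ∈ Q.erase a} : ℝ) < t := by
    by_contra h
    push Not at h
    have := hQ.le_of_le (y := Q.erase a) (by simpa using h) (erase_subset _ _)
    exact notMem_erase a Q (this ha)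
  have h2 : #{w ∈ R | u w ∈ Q} ≤ #{w ∈ R | u w ∈ Q.erase a} + #{w ∈ R | u w = a} := by
    rw [← card_union_of_disjoint]
    · refine card_le_card fun w hw => ?_
      simp only [mem_filter, mem_union, mem_erase] at hw ⊢
      tauto
    · rw [disjoint_left]
      intro w hw hw'
      simp only [mem_filter, mem_erase] at hw hw'
      exact hw.2.1 hw'.2
  have := hf a
  have h2' : (#{w ∈ R | u w ∈ Q} : ℝ) ≤ #{w ∈ R | u w ∈ Q.erase a} + #{w ∈ R | u w = a} := by
    exact_mod_cast h2
  linarith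

/-- Each `w ∈ N` has a label `u w`, and each `J ∈ N` an unordered pair `φ J`. If `N` expands and
`φ J = s(u w, ψ w J)` for almost all `H`-adjacent `J, w ∈ N`, then `u` is almost constant on `N`.
Most `J` see good neighbours in each large group of labels. If two labels `a ≠ a'` were frequent,
most `φ J` would be `s(a, a')`, which forces `ψ w J = a'` for `u w = a` and leaves each `w` at most
one good `J`, against expansion. If all labels but one were spread out, three large groups with
disjoint label sets would give some `φ J` three elements. -/
lemma exists_dominant_label {N : Finset V} {H : V → V → Prop} (u : V → V) (φ : V → Sym2 V)
    (ψ : V → V → V) {t q b : ℝ} (ht : 0 < t)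
    (hexp : ∀ A B, A ⊆ N → B ⊆ N → t ≤ #A → t ≤ #B →
      q ≤ cnt (fun x : V × V => x ∈ A ×ˢ B ∧ H x.1 x.2))
    (hψ : ∀ w, Function.Injective (ψ w))
    (hbad : cnt (fun x : V × V => x ∈ N ×ˢ N ∧ H x.1 x.2 ∧ φ x.1 ≠ s(u x.2, ψ x.2 x.1)) ≤ b)
    (hN : 4 * t ≤ #N) (hq : #N + b < q) :
    ∃ a, cnt (fun w => w ∈ N ∧ u w ≠ a) ≤ 6 * t := by
  simp only [cnt_mem_and] at hexp hbad ⊢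
  -- most vertices have a good neighbour in any large set
  have hZ : ∀ U ⊆ N, t ≤ #U →
      (#{J ∈ N | ∀ w ∈ U, H J w → φ J ≠ s(u w, ψ w J)} : ℝ) < t := by
    intro U hU htU
    by_contra hcon
    push Not at hcon
    have h1 := hexp _ U (filter_subset _ _) hU hcon htU
    have h2 : #{x ∈ ({J ∈ N | ∀ w ∈ U, H J w → φ J ≠ s(u w, ψ w J)}) ×ˢ U | H x.1 x.2} ≤
        #{x ∈ N ×ˢ N | H x.1 x.2 ∧ φ x.1 ≠ s(u x.2, ψ x.2 x.1)} := by
      refine card_le_card fun x hx => ?_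
      simp only [mem_filter, mem_product] at hx ⊢
      exact ⟨⟨hx.1.1.1, hU hx.1.2⟩, hx.2, hx.1.1.2 _ hx.1.2 hx.2⟩
    have h2' : (#{x ∈ ({J ∈ N | ∀ w ∈ U, H J w → φ J ≠ s(u w, ψ w J)}) ×ˢ U | H x.1 x.2} : ℝ) ≤
        #{x ∈ N ×ˢ N | H x.1 x.2 ∧ φ x.1 ≠ s(u x.2, ψ x.2 x.1)} := by exact_mod_cast h2
    have : (0 : ℝ) ≤ #N := by positivity
    linarith
  -- two different labels cannot both be frequent
  have two : ∀ a a', a ≠ a' → t ≤ #{w ∈ N | u w = a} → t ≤ #{w ∈ N | u w = a'} → False := by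
    intro a a' haa' ha ha'
    set U := {w ∈ N | u w = a} with hU
    set U' := {w ∈ N | u w = a'} with hU'
    have z := hZ U (filter_subset _ _) ha
    have z' := hZ U' (filter_subset _ _) ha'
    set Z := {J ∈ N | ∀ w ∈ U, H J w → φ J ≠ s(u w, ψ w J)} with hZd
    set Z' := {J ∈ N | ∀ w ∈ U', H J w → φ J ≠ s(u w, ψ w J)} with hZd'
    set J0 := (N \ Z) \ Z' with hJ0
    have hcard : t ≤ #J0 := by
      have h1 := le_card_sdiff Z N
      have h2 := le_card_sdiff Z' (N \ Z)
      have h3 : (#N : ℝ) ≤ #J0 + #Z + #Z' := by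
        have : #N ≤ #J0 + #Z + #Z' := by rw [hJ0]; omega
        exact_mod_cast this
      linarith
    have hφ : ∀ J ∈ J0, φ J = s(a, a') := by
      intro J hJ
      simp only [hJ0, hZd, hZd', mem_sdiff, mem_filter, not_and, not_forall, not_not] at hJ
      obtain ⟨⟨hJN, hJ1⟩, hJ2⟩ := hJ
      obtain ⟨w, hw, _, e1⟩ := hJ1 hJN
      obtain ⟨w', hw', _, e2⟩ := hJ2 hJN
      rw [(mem_filter.1 hw).2] at e1
      rw [(mem_filter.1 hw').2] at e2
      have h3 : s(a, ψ w J) = s(a', ψ w' J) := e1.symm.trans e2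
      rw [Sym2.eq_iff] at h3
      rcases h3 with h3 | h3
      · exact absurd h3.1 haa'
      · rw [e1, h3.2]
    have h1 := hexp J0 U (by intro x hx; simp only [hJ0, mem_sdiff] at hx; exact hx.1.1)
      (filter_subset _ _) hcard ha
    have h2 : #{x ∈ J0 ×ˢ U | H x.1 x.2} ≤
        #{x ∈ N ×ˢ N | H x.1 x.2 ∧ φ x.1 ≠ s(u x.2, ψ x.2 x.1)} + #N := by
      have : #{x ∈ J0 ×ˢ U | φ x.1 = s(u x.2, ψ x.2 x.1)} ≤ #N := by
        refine card_le_card_of_injOn Prod.snd ?_ ?_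
        · intro x hx
          have hx' := mem_filter.1 (mem_coe.1 hx)
          exact mem_coe.2 (mem_filter.1 (mem_product.1 hx'.1).2).1
        · intro x hx y hy hxy
          have hx' := mem_filter.1 (mem_coe.1 hx)
          have hy' := mem_filter.1 (mem_coe.1 hy)
          have hxU := (mem_filter.1 (mem_product.1 hx'.1).2).2
          have hyU := (mem_filter.1 (mem_product.1 hy'.1).2).2
          have ex := hx'.2
          have ey := hy'.2
          rw [hφ _ (mem_product.1 hx'.1).1, hxU] at ex
          rw [hφ _ (mem_product.1 hy'.1).1, hyU] at ey
          have ex' : ψ x.2 x.1 = a' := by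
            have := Sym2.congr_right.1 ex
            exact this.symm
          have ey' : ψ y.2 y.1 = a' := (Sym2.congr_right.1 ey).symm
          refine Prod.ext (hψ x.2 ?_) hxy
          rw [ex', hxy, ey']
      refine le_trans ?_ (Nat.add_le_add_left this _)
      refine le_trans (card_le_card ?_) (card_union_le _ _)
      intro x hx
      simp only [mem_filter, mem_product, mem_union] at hx ⊢
      have hx1 : x.1 ∈ N := by
        have := hx.1.1
        simp only [hJ0, mem_sdiff] at this
        exact this.1.1
      have hx2 : x.2 ∈ N := (mem_filter.1 hx.1.2).1
      tauto
    have h2' : (#{x ∈ J0 ×ˢ U | H x.1 x.2} : ℝ) ≤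
        #{x ∈ N ×ˢ N | H x.1 x.2 ∧ φ x.1 ≠ s(u x.2, ψ x.2 x.1)} + #N := by exact_mod_cast h2
    linarith
  -- three disjoint groups of labels cannot all be frequent
  have three : ∀ U₁ U₂ U₃, U₁ ⊆ N → U₂ ⊆ N → U₃ ⊆ N → t ≤ #U₁ → t ≤ #U₂ → t ≤ #U₃ →
      (∀ x ∈ U₁, ∀ y ∈ U₂, u x ≠ u y) → (∀ x ∈ U₁, ∀ y ∈ U₃, u x ≠ u y) →
      (∀ x ∈ U₂, ∀ y ∈ U₃, u x ≠ u y) → False := by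
    intro U₁ U₂ U₃ s1 s2 s3 t1 t2 t3 d12 d13 d23
    have z1 := hZ U₁ s1 t1
    have z2 := hZ U₂ s2 t2
    have z3 := hZ U₃ s3 t3
    set Z1 := {J ∈ N | ∀ w ∈ U₁, H J w → φ J ≠ s(u w, ψ w J)} with hZ1
    set Z2 := {J ∈ N | ∀ w ∈ U₂, H J w → φ J ≠ s(u w, ψ w J)} with hZ2
    set Z3 := {J ∈ N | ∀ w ∈ U₃, H J w → φ J ≠ s(u w, ψ w J)} with hZ3
    obtain ⟨J, hJN, hJ⟩ : ∃ J ∈ N, J ∉ Z1 ∪ Z2 ∪ Z3 := by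
      by_contra hcon
      push Not at hcon
      have h1 : #N ≤ #Z1 + #Z2 + #Z3 :=
        (card_le_card hcon).trans ((card_union_le _ _).trans
          (Nat.add_le_add_right (card_union_le _ _) _))
      have h1' : (#N : ℝ) ≤ #Z1 + #Z2 + #Z3 := by exact_mod_cast h1
      linarith
    simp only [hZ1, hZ2, hZ3, mem_union, mem_filter, not_or, not_and, not_forall, not_not] at hJ
    obtain ⟨⟨g1, g2⟩, g3⟩ := hJ
    obtain ⟨w1, hw1, _, e1⟩ := g1 hJN
    obtain ⟨w2, hw2, _, e2⟩ := g2 hJN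
    obtain ⟨w3, hw3, _, e3⟩ := g3 hJN
    have m1 : u w1 ∈ φ J := by rw [e1]; exact Sym2.mem_mk_left _ _
    have m2 : u w2 ∈ φ J := by rw [e2]; exact Sym2.mem_mk_left _ _
    have m3 : u w3 ∈ φ J := by rw [e3]; exact Sym2.mem_mk_left _ _
    have n12 := d12 w1 hw1 w2 hw2
    have n13 := d13 w1 hw1 w3 hw3
    have n23 := d23 w2 hw2 w3 hw3
    rw [(Sym2.mem_and_mem_iff n12).1 ⟨m1, m2⟩, Sym2.mem_iff] at m3
    rcases m3 with h | h
    · exact n13 h.symm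
    · exact n23 h.symm
  have hNne : N.Nonempty := by
    rw [nonempty_iff_ne_empty]
    rintro rfl
    simp at hN
    linarith
  obtain ⟨w0, hw0⟩ := hNne
  obtain ⟨a, -, ha⟩ := exists_max_image (univ : Finset V) (fun a => #{w ∈ N | u w = a})
    ⟨w0, mem_univ _⟩
  refine ⟨a, ?_⟩
  by_contra hcon
  push Not at hcon
  set R := {w ∈ N | u w ≠ a} with hR
  have hRN : R ⊆ N := filter_subset _ _
  have small : ∀ b, (#{w ∈ R | u w = b} : ℝ) < t := by
    intro b
    by_cases hba : b = a
    · subst hba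
      have : ({w ∈ R | u w = b} : Finset V) = ∅ := by
        rw [filter_eq_empty_iff]
        intro w hw
        exact (mem_filter.1 hw).2
      rw [this]; simpa using ht
    · by_contra h
      push Not at h
      have h1 : (#{w ∈ R | u w = b} : ℝ) ≤ #{w ∈ N | u w = b} := by
        exact_mod_cast card_le_card (filter_subset_filter _ hRN)
      have h2 : (#{w ∈ N | u w = b} : ℝ) ≤ #{w ∈ N | u w = a} := by
        exact_mod_cast ha b (mem_univ _)
      exact two b a hba (by linarith) (by linarith)
  have smaller : ∀ R' ⊆ R, ∀ b, (#{w ∈ R' | u w = b} : ℝ) < t := fun R' hR' b =>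
    lt_of_le_of_lt (by exact_mod_cast card_le_card (filter_subset_filter _ hR')) (small b)
  obtain ⟨Q1, l1, b1⟩ := exists_label_set ht small (by linarith)
  set R1 := {w ∈ R | u w ∉ Q1} with hR1
  have c1 : (#{w ∈ R | u w ∈ Q1} : ℝ) + #R1 = #R := by
    exact_mod_cast card_filter_add_card_filter_not (s := R) (fun w => u w ∈ Q1)
  obtain ⟨Q2, l2, b2⟩ := exists_label_set ht (smaller R1 (filter_subset _ _)) (by linarith)
  set R2 := {w ∈ R1 | u w ∉ Q2} with hR2
  have c2 : (#{w ∈ R1 | u w ∈ Q2} : ℝ) + #R2 = #R1 := by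
    exact_mod_cast card_filter_add_card_filter_not (s := R1) (fun w => u w ∈ Q2)
  refine three _ _ R2 ?_ ?_ ?_ l1 l2 (by linarith) ?_ ?_ ?_
  · exact (filter_subset _ _).trans hRN
  · exact (filter_subset _ _).trans ((filter_subset _ _).trans hRN)
  · exact (filter_subset _ _).trans ((filter_subset _ _).trans hRN)
  · intro x hx y hy h
    simp only [hR1, mem_filter] at hx hy
    exact hy.1.2 (h ▸ hx.2)
  · intro x hx y hy h
    simp only [hR1, hR2, mem_filter] at hx hy
    exact hy.1.2 (h ▸ hx.2)
  · intro x hx y hy h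
    simp only [hR2, mem_filter] at hx hy
    exact hy.2 (h ▸ hx.2)

end labels

/-! ### Isomorphisms between all neighbourhoods -/

/-- `σ i` restricts, for every vertex `i`, to an isomorphism fixing `i` from the `1`-neighbourhood
of `i` in `X` to the one in `Y`. The partial maps are extended to permutations of all vertices; the
values outside of the neighbourhoods are irrelevant. -/
structure Matches {n : ℕ} (X Y : SimpleGraph (Fin n)) (σ : Fin n → Equiv.Perm (Fin n)) : Prop where
  fix : ∀ i, σ i i = i
  adj : ∀ i j, X.Adj i j ↔ Y.Adj i (σ i j)
  link : ∀ i j k, X.Adj i j → X.Adj i k → (X.Adj j k ↔ Y.Adj (σ i j) (σ i k))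

section det
variable {n : ℕ} {X Y : SimpleGraph (Fin n)} {σ : Fin n → Equiv.Perm (Fin n)}

lemma Matches.adj_symm (h : Matches X Y σ) (i j : Fin n) :
    Y.Adj i j ↔ X.Adj i ((σ i).symm j) := by
  rw [h.adj, Equiv.apply_symm_apply]

lemma Matches.link_symm (h : Matches X Y σ) {i j k : Fin n} (hj : Y.Adj i j) (hk : Y.Adj i k) :
    Y.Adj j k ↔ X.Adj ((σ i).symm j) ((σ i).symm k) := by
  rw [h.link i _ _ ((h.adj_symm i j).1 hj) ((h.adj_symm i k).1 hk)]
  simp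

lemma Matches.deg_eq (h : Matches X Y σ) (i : Fin n) :
    cnt (fun j => Y.Adj i j) = cnt (fun j => X.Adj i j) := by
  refine le_antisymm (cnt_le_of_injOn (σ i).symm (fun j hj => (h.adj_symm i j).1 hj)
    fun _ _ _ _ e => (σ i).symm.injective e) ?_
  exact cnt_le_of_injOn (σ i) (fun j hj => (h.adj i j).1 hj) fun _ _ _ _ e => (σ i).injective e

lemma Matches.codeg_eq (h : Matches X Y σ) {i j : Fin n} (hij : Y.Adj i j) :
    cnt (fun w => Y.Adj i w ∧ Y.Adj j w) =
      cnt (fun w => X.Adj i w ∧ X.Adj ((σ i).symm j) w) := by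
  refine le_antisymm (cnt_le_of_injOn (σ i).symm (fun w hw => ?_)
    fun _ _ _ _ e => (σ i).symm.injective e) (cnt_le_of_injOn (σ i) (fun w hw => ?_)
    fun _ _ _ _ e => (σ i).injective e)
  · exact ⟨(h.adj_symm i w).1 hw.1, (h.link_symm hij hw.1).1 hw.2⟩
  · have h1 := (h.adj i w).1 hw.1
    exact ⟨h1, (h.link_symm hij h1).2 (by simpa using hw.2)⟩

/-- A common neighbour `w` of the ends of the edge `s(v, J)` of `Y` sees it as the image of the edge
`s((σ w).symm v, (σ w).symm J)` of `X`. The edge is contested if, for every pair `e`, at least `m`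
common neighbours see it as the image of something other than `e`. -/
def Contested (Y : SimpleGraph (Fin n)) (σ : Fin n → Equiv.Perm (Fin n)) (m : ℝ)
    (v J : Fin n) : Prop :=
  Y.Adj v J ∧ ∀ e : Sym2 (Fin n),
    m ≤ cnt (fun w => Y.Adj v w ∧ Y.Adj J w ∧ s((σ w).symm v, (σ w).symm J) ≠ e)

/-- Choosing for each edge `s(v, J)` of `Y` the preimage `φ v J` on which its common neighbours
agree best, only contested edges contribute many common neighbours that disagree. -/
lemma sum_flags_le (h : Matches X Y σ) {D d η b : ℝ} (hd : 0 ≤ d) (hη : 0 ≤ η)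
    (hdeg : ∀ i, cnt (fun j => X.Adj i j) ≤ 2 * D)
    (hcod : ∀ i j, i ≠ j → cnt (fun w => X.Adj i w ∧ X.Adj j w) ≤ 2 * d)
    (hbad : cnt (fun x : Fin n × Fin n => Contested Y σ (η * d) x.1 x.2) ≤ b) :
    ∃ φ : Fin n → Fin n → Sym2 (Fin n),
      ∑ v, cnt (fun x : Fin n × Fin n => Y.Adj v x.1 ∧ Y.Adj v x.2 ∧ Y.Adj x.1 x.2 ∧
        φ v x.1 ≠ s((σ x.2).symm v, (σ x.2).symm x.1)) ≤ 2 * d * b + 2 * η * (n * D * d) := by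
  have hex : ∀ v J, ∃ e : Sym2 (Fin n), Y.Adj v J → ¬ Contested Y σ (η * d) v J →
      cnt (fun w => Y.Adj v w ∧ Y.Adj J w ∧ s((σ w).symm v, (σ w).symm J) ≠ e) < η * d := by
    intro v J
    by_cases hc : Y.Adj v J ∧ ¬ Contested Y σ (η * d) v J
    · obtain ⟨h1, h2⟩ := hc
      unfold Contested at h2
      push Not at h2
      obtain ⟨e, he⟩ := h2 h1
      exact ⟨e, fun _ _ => he⟩
    · exact ⟨s(v, v), fun h1 h2 => absurd ⟨h1, h2⟩ hc⟩
  choose φ hφ using hex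
  refine ⟨φ, ?_⟩
  have key : ∀ v J, cnt (fun w => Y.Adj v J ∧ Y.Adj v w ∧ Y.Adj J w ∧
      φ v J ≠ s((σ w).symm v, (σ w).symm J)) ≤
      2 * d * (ind (Contested Y σ (η * d) v J)) +
      η * d * (ind (Y.Adj v J)) := by
    intro v J
    by_cases hvJ : Y.Adj v J
    · by_cases hc : Contested Y σ (η * d) v J
      · rw [ind_pos hc, ind_pos hvJ]
        have h1 : cnt (fun w => Y.Adj v J ∧ Y.Adj v w ∧ Y.Adj J w ∧
            φ v J ≠ s((σ w).symm v, (σ w).symm J)) ≤ cnt (fun w => Y.Adj v w ∧ Y.Adj J w) :=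
          cnt_mono (fun w hw => by tauto)
        rw [h.codeg_eq hvJ] at h1
        have h2 := hcod v ((σ v).symm J) ((h.adj_symm v J).1 hvJ).ne
        have : 0 ≤ η * d := by positivity
        linarith
      · rw [ind_neg hc, ind_pos hvJ]
        have h1 : cnt (fun w => Y.Adj v J ∧ Y.Adj v w ∧ Y.Adj J w ∧
            φ v J ≠ s((σ w).symm v, (σ w).symm J)) ≤
            cnt (fun w => Y.Adj v w ∧ Y.Adj J w ∧ s((σ w).symm v, (σ w).symm J) ≠ φ v J) :=
          cnt_mono (fun w hw => by
            exact ⟨hw.2.1, hw.2.2.1, fun e => hw.2.2.2 e.symm⟩)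
        have := hφ v J hvJ hc
        linarith
    · have : cnt (fun w => Y.Adj v J ∧ Y.Adj v w ∧ Y.Adj J w ∧
          φ v J ≠ s((σ w).symm v, (σ w).symm J)) = 0 := cnt_false fun w hw => hvJ hw.1
      rw [this]
      have := ind_nonneg (Contested Y σ (η * d) v J)
      have := ind_nonneg (Y.Adj v J)
      positivity
  have hdegs : ∑ v, cnt (fun J => Y.Adj v J) ≤ n * (2 * D) := by
    calc ∑ v, cnt (fun J => Y.Adj v J) ≤ ∑ _v : Fin n, 2 * D :=
          sum_le_sum fun v _ => by rw [h.deg_eq]; exact hdeg v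
      _ = n * (2 * D) := by simp
  calc ∑ v, cnt (fun x : Fin n × Fin n => Y.Adj v x.1 ∧ Y.Adj v x.2 ∧ Y.Adj x.1 x.2 ∧
        φ v x.1 ≠ s((σ x.2).symm v, (σ x.2).symm x.1))
      = ∑ v, ∑ J, cnt (fun w => Y.Adj v J ∧ Y.Adj v w ∧ Y.Adj J w ∧
          φ v J ≠ s((σ w).symm v, (σ w).symm J)) :=
        sum_congr rfl fun v _ => cnt_prod (fun J w => Y.Adj v J ∧ Y.Adj v w ∧ Y.Adj J w ∧
          φ v J ≠ s((σ w).symm v, (σ w).symm J))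
    _ ≤ ∑ v, ∑ J, (2 * d * (ind (Contested Y σ (η * d) v J)) +
          η * d * (ind (Y.Adj v J))) :=
        sum_le_sum fun v _ => sum_le_sum fun J _ => key v J
    _ = 2 * d * ∑ v, cnt (fun J => Contested Y σ (η * d) v J) +
          η * d * ∑ v, cnt (fun J => Y.Adj v J) := by
        simp only [cnt, sum_add_distrib, mul_sum]
    _ ≤ 2 * d * b + η * d * (n * (2 * D)) := by
        rw [← cnt_prod (fun v J => Contested Y σ (η * d) v J)]
        gcongr
    _ = _ := by ring

/-! ### Most neighbours agree on the preimage of a vertex -/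

/-- If the common neighbours of almost all edges of `Y` agree on their preimages, then almost all
neighbours `w` of almost all vertices `v` agree on the preimage `τ v` of `v`:
`exists_dominant_label` is applied inside the neighbourhood of `v`, with the label `(σ w).symm v`
of `w`. Vertices `v` with more than `β * (D * d)` disagreements are discarded. -/
lemma exists_dominant_preimage (h : Matches X Y σ) {N D d θ β b : ℝ}
    (hN : N = n) (hD : 0 < D) (hd : 0 < d)
    (hθ : 0 < θ) (hθ' : 24 * θ ≤ 1) (hβ : 0 < β) (hbig : 2 + β * d < θ ^ 2 / 2 * d)
    (hdeg : ∀ i, cnt (fun j => X.Adj i j) ≤ 2 * D)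
    (hdeg' : ∀ i, D / 2 ≤ cnt (fun j => X.Adj i j))
    (hexp : ∀ A B : Finset (Fin n), 3 * θ * D ≤ #A → 3 * θ * D ≤ #B →
      θ ^ 2 / 2 * (D * d) ≤ cnt (fun x : Fin n × Fin n => x ∈ A ×ˢ B ∧ X.Adj x.1 x.2))
    (φ : Fin n → Fin n → Sym2 (Fin n))
    (hφ : ∑ v, cnt (fun x : Fin n × Fin n => Y.Adj v x.1 ∧ Y.Adj v x.2 ∧ Y.Adj x.1 x.2 ∧
        φ v x.1 ≠ s((σ x.2).symm v, (σ x.2).symm x.1)) ≤ b * (N * D * d)) :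
    ∃ τ : Fin n → Fin n,
      ∑ v, cnt (fun w => Y.Adj v w ∧ (σ w).symm v ≠ τ v) ≤ (18 * θ + 2 * (b / β)) * (N * D) := by
  set f : Fin n → ℝ := fun v => cnt (fun x : Fin n × Fin n => Y.Adj v x.1 ∧ Y.Adj v x.2 ∧
    Y.Adj x.1 x.2 ∧ φ v x.1 ≠ s((σ x.2).symm v, (σ x.2).symm x.1)) with hf
  have hmark := mul_cnt_le_sum (f := f) (fun v => cnt_nonneg _) (β * (D * d))
  have hnf : cnt (fun v => β * (D * d) < f v) ≤ b / β * N := by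
    have h1 : β * (D * d) * cnt (fun v => β * (D * d) < f v) ≤ b * (N * D * d) := hmark.trans hφ
    have h2 : 0 < D * d := by positivity
    rw [div_mul_eq_mul_div, le_div_iff₀ hβ]
    refine le_of_mul_le_mul_right ?_ h2
    linarith
  have hfine : ∀ v, ∃ a, f v ≤ β * (D * d) →
      cnt (fun w => Y.Adj v w ∧ (σ w).symm v ≠ a) ≤ 18 * θ * D := by
    intro v
    by_cases hv : f v ≤ β * (D * d)
    swap
    · exact ⟨v, fun hh => absurd hh hv⟩
    classical
    set Nv : Finset (Fin n) := {w | Y.Adj v w} with hNv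
    have hNc : (#Nv : ℝ) = cnt (fun j => X.Adj v j) := by rw [← h.deg_eq v, cnt_eq_card]
    suffices hs : ∃ a, cnt (fun w => w ∈ Nv ∧ (σ w).symm v ≠ a) ≤ 6 * (3 * θ * D) by
      obtain ⟨a, ha⟩ := hs
      refine ⟨a, fun _ => (cnt_mono fun w hw => ?_).trans (ha.trans (by linarith))⟩
      simpa [hNv] using hw
    refine exists_dominant_label (N := Nv) (H := Y.Adj) (fun w => (σ w).symm v) (φ v)
      (fun w J => (σ w).symm J) (t := 3 * θ * D) (q := θ ^ 2 / 2 * (D * d)) (b := β * (D * d))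
      (by positivity) ?_ (fun w => (σ w).symm.injective) ?_ ?_ ?_
    · intro A B hA hB hA' hB'
      have hAB := hexp (A.map (σ v).symm.toEmbedding) (B.map (σ v).symm.toEmbedding)
        (by rwa [card_map]) (by rwa [card_map])
      refine hAB.trans ?_
      refine cnt_le_of_injOn (fun x => (σ v x.1, σ v x.2)) ?_ ?_
      · intro x hx
        obtain ⟨h1, h2⟩ := mem_product.1 hx.1
        obtain ⟨y, hy, hy'⟩ := mem_map.1 h1
        obtain ⟨z, hz, hz'⟩ := mem_map.1 h2
        have e1 : σ v x.1 = y := by rw [← hy']; simp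
        have e2 : σ v x.2 = z := by rw [← hz']; simp
        have hyv : Y.Adj v y := by simpa [hNv] using hA hy
        have hzv : Y.Adj v z := by simpa [hNv] using hB hz
        refine ⟨mem_product.2 ⟨e1 ▸ hy, e2 ▸ hz⟩, ?_⟩
        have h3 := (h.link_symm hyv hzv).2
        rw [← e1, ← e2] at h3
        exact h3 (by simpa using hx.2)
      · intro x y _ _ hxy
        simp only [Prod.mk.injEq, EmbeddingLike.apply_eq_iff_eq] at hxy
        exact Prod.ext hxy.1 hxy.2
    · refine le_trans (cnt_mono fun x hx => ?_) hv
      simp only [hNv, mem_filter, mem_product, mem_univ, true_and] at hx ⊢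
      tauto
    · rw [hNc]
      have := hdeg' v
      nlinarith
    · rw [hNc]
      have := hdeg v
      nlinarith
  choose τ hτ using hfine
  refine ⟨τ, ?_⟩
  have hpt : ∀ v, cnt (fun w => Y.Adj v w ∧ (σ w).symm v ≠ τ v) ≤
      18 * θ * D + 2 * D * (ind (β * (D * d) < f v)) := by
    intro v
    by_cases hv : β * (D * d) < f v
    · have h1 : cnt (fun w => Y.Adj v w ∧ (σ w).symm v ≠ τ v) ≤ cnt (fun w => Y.Adj v w) :=
        cnt_mono fun w hw => hw.1
      rw [ind_pos hv]
      rw [h.deg_eq] at h1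
      have := hdeg v
      have : 0 ≤ 18 * θ * D := by positivity
      linarith
    · have := hτ v (not_lt.1 hv)
      rw [ind_neg hv]
      linarith
  calc ∑ v, cnt (fun w => Y.Adj v w ∧ (σ w).symm v ≠ τ v)
      ≤ ∑ v, (18 * θ * D + 2 * D * (ind (β * (D * d) < f v))) :=
        sum_le_sum fun v _ => hpt v
    _ = N * (18 * θ * D) + 2 * D * cnt (fun v => β * (D * d) < f v) := by
        rw [sum_add_distrib, ← mul_sum (f := fun v => ind (β * (D * d) < f v)), hN, sum_const,
          card_univ, Fintype.card_fin, nsmul_eq_mul]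
        rfl
    _ ≤ N * (18 * θ * D) + 2 * D * (b / β * N) := by gcongr
    _ = _ := by ring

/-- The dominant preimage of almost every `v` is `v` itself. For most neighbours `K` of `v` one has
`(σ v).symm K = τ K`, and some common neighbour `w` of `v` and `K` sees the edge `s(v, K)` as
`s(τ v, τ K)`; so most neighbours of `v` in `X` are adjacent to `τ v`, and the codegree of `v`
and `τ v` is too large unless `τ v = v`. -/
lemma dominant_preimage_eq_self (h : Matches X Y σ) {N D d γ : ℝ} (hD : 0 < D)
    (hd : 0 < d) (hdD : 8 * d < D)
    (hdeg : ∀ i, cnt (fun j => X.Adj i j) ≤ 2 * D)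
    (hdeg' : ∀ i, D / 2 ≤ cnt (fun j => X.Adj i j))
    (hcod : ∀ i j, i ≠ j → cnt (fun w => X.Adj i w ∧ X.Adj j w) ≤ 2 * d)
    (hcod' : ∀ i j, i ≠ j → d / 2 ≤ cnt (fun w => X.Adj i w ∧ X.Adj j w))
    (τ : Fin n → Fin n)
    (hτ : ∑ v, cnt (fun w => Y.Adj v w ∧ (σ w).symm v ≠ τ v) ≤ γ * (N * D)) :
    ∑ v, cnt (fun w => Y.Adj v w ∧ (σ w).symm v ≠ v) ≤ 145 * γ * (N * D) := by
  have hYcod : ∀ i j, Y.Adj i j → cnt (fun w => Y.Adj i w ∧ Y.Adj j w) ≤ 2 * d := by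
    intro i j hij
    rw [h.codeg_eq hij]
    exact hcod _ _ ((h.adj_symm i j).1 hij).ne
  have hYcod' : ∀ i j, Y.Adj i j → d / 2 ≤ cnt (fun w => Y.Adj i w ∧ Y.Adj j w) := by
    intro i j hij
    rw [h.codeg_eq hij]
    exact hcod' _ _ ((h.adj_symm i j).1 hij).ne
  -- vertices `v` whose own isomorphism often disagrees with `τ`
  set f : Fin n → ℝ := fun v => cnt (fun K => Y.Adj v K ∧ (σ v).symm K ≠ τ K) with hf
  have hfs : ∑ v, f v ≤ γ * (N * D) := by
    refine le_trans (le_of_eq ?_) hτ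
    rw [sum_cnt_comm (fun v w => Y.Adj v w ∧ (σ w).symm v ≠ τ v)]
    refine sum_congr rfl fun v _ => ?_
    exact cnt_congr fun w => by rw [Y.adj_comm]
  -- edges none of whose common neighbours respects `τ`
  set g : Fin n → ℝ := fun v => cnt (fun K => Y.Adj v K ∧ ∀ w, Y.Adj v w → Y.Adj K w →
    (σ w).symm v = τ v → (σ w).symm K ≠ τ K) with hg
  have hgs : ∑ v, g v ≤ 8 * γ * (N * D) := by
    have h1 : ∀ v K, d / 2 * (ind (Y.Adj v K ∧ ∀ w, Y.Adj v w → Y.Adj K w →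
        (σ w).symm v = τ v → (σ w).symm K ≠ τ K)) ≤
        cnt (fun w => Y.Adj v K ∧ Y.Adj v w ∧ Y.Adj K w ∧ (σ w).symm v ≠ τ v) +
        cnt (fun w => Y.Adj v K ∧ Y.Adj v w ∧ Y.Adj K w ∧ (σ w).symm K ≠ τ K) := by
      intro v K
      by_cases hc : Y.Adj v K ∧ ∀ w, Y.Adj v w → Y.Adj K w →
        (σ w).symm v = τ v → (σ w).symm K ≠ τ K
      · refine le_trans ?_ (cnt_or_le _ _)
        rw [ind_pos hc, mul_one]
        refine (hYcod' v K hc.1).trans (cnt_mono fun w hw => ?_)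
        have := hc.2 w hw.1 hw.2
        have := hc.1
        tauto
      · rw [ind_neg hc, mul_zero]; exact add_nonneg (cnt_nonneg _) (cnt_nonneg _)
    have h2 : ∑ v, ∑ K, cnt (fun w => Y.Adj v K ∧ Y.Adj v w ∧ Y.Adj K w ∧ (σ w).symm v ≠ τ v) ≤
        2 * d * (γ * (N * D)) := by
      calc ∑ v, ∑ K, cnt (fun w => Y.Adj v K ∧ Y.Adj v w ∧ Y.Adj K w ∧ (σ w).symm v ≠ τ v)
          = ∑ v, ∑ w, cnt (fun K => Y.Adj v K ∧ Y.Adj v w ∧ Y.Adj K w ∧ (σ w).symm v ≠ τ v) :=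
            sum_congr rfl fun v _ => sum_cnt_comm _
        _ ≤ ∑ v, ∑ w, 2 * d * (ind (Y.Adj v w ∧ (σ w).symm v ≠ τ v)) := by
            refine sum_le_sum fun v _ => sum_le_sum fun w _ => ?_
            by_cases hc : Y.Adj v w ∧ (σ w).symm v ≠ τ v
            · rw [ind_pos hc]
              refine (cnt_mono fun K hK => ?_).trans ((hYcod v w hc.1).trans (by linarith))
              exact ⟨hK.1, hK.2.2.1.symm⟩
            · rw [ind_neg hc, mul_zero]
              exact (cnt_false fun K hK => hc ⟨hK.2.1, hK.2.2.2⟩).le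
        _ = 2 * d * ∑ v, cnt (fun w => Y.Adj v w ∧ (σ w).symm v ≠ τ v) := by
            simp only [cnt, mul_sum]
        _ ≤ 2 * d * (γ * (N * D)) := by gcongr
    have h3 : ∑ v, ∑ K, cnt (fun w => Y.Adj v K ∧ Y.Adj v w ∧ Y.Adj K w ∧ (σ w).symm K ≠ τ K) ≤
        2 * d * (γ * (N * D)) := by
      rw [sum_comm]
      refine le_trans (le_of_eq ?_) h2
      refine sum_congr rfl fun v _ => sum_congr rfl fun K _ => cnt_congr fun w => ?_
      rw [Y.adj_comm]
      tauto
    have h4 : d / 2 * ∑ v, g v ≤ 4 * d * (γ * (N * D)) := by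
      calc d / 2 * ∑ v, g v = ∑ v, ∑ K, d / 2 * (ind (Y.Adj v K ∧ ∀ w, Y.Adj v w → Y.Adj K w →
            (σ w).symm v = τ v → (σ w).symm K ≠ τ K)) := by
            simp only [hg, cnt, mul_sum]
        _ ≤ _ := sum_le_sum fun v _ => sum_le_sum fun K _ => h1 v K
        _ ≤ 4 * d * (γ * (N * D)) := by simp only [sum_add_distrib]; linarith
    refine le_of_mul_le_mul_left ?_ (half_pos hd)
    linarith
  have hmf := mul_cnt_le_sum (f := f) (fun v => cnt_nonneg _) (D / 8)
  have hmg := mul_cnt_le_sum (f := g) (fun v => cnt_nonneg _) (D / 8)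
  have hself : ∀ v, f v ≤ D / 8 → g v ≤ D / 8 → τ v = v := by
    intro v hfv hgv
    by_contra hne
    have h1 := hcod v (τ v) (Ne.symm hne)
    have h2 : cnt (fun K => Y.Adj v K) ≤ cnt (fun w => X.Adj v w ∧ X.Adj (τ v) w) + f v + g v := by
      have h3 : cnt (fun K => Y.Adj v K ∧ (σ v).symm K = τ K ∧ ∃ w, Y.Adj v w ∧ Y.Adj K w ∧
          (σ w).symm v = τ v ∧ (σ w).symm K = τ K) ≤ cnt (fun w => X.Adj v w ∧ X.Adj (τ v) w) := by
        refine cnt_le_of_injOn (fun K => (σ v).symm K) ?_ ?_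
        · rintro K ⟨hvK, e, w, hvw, hKw, e1, e2⟩
          refine ⟨(h.adj_symm v K).1 hvK, ?_⟩
          rw [e, ← e1, ← e2]
          exact (h.link_symm hvw.symm hKw.symm).1 hvK
        · intro a b _ _ hab
          exact (σ v).symm.injective hab
      refine le_trans (cnt_mono (Q := fun K => (Y.Adj v K ∧ (σ v).symm K = τ K ∧
          ∃ w, Y.Adj v w ∧ Y.Adj K w ∧ (σ w).symm v = τ v ∧ (σ w).symm K = τ K) ∨
          ((Y.Adj v K ∧ (σ v).symm K ≠ τ K) ∨ (Y.Adj v K ∧ ∀ w, Y.Adj v w → Y.Adj K w →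
          (σ w).symm v = τ v → (σ w).symm K ≠ τ K))) fun K hK => ?_) ?_
      · by_cases e : (σ v).symm K = τ K
        · by_cases e' : ∃ w, Y.Adj v w ∧ Y.Adj K w ∧ (σ w).symm v = τ v ∧ (σ w).symm K = τ K
          · exact Or.inl ⟨hK, e, e'⟩
          · right; right
            exact ⟨hK, fun w h1 h2 h3 h4 => e' ⟨w, h1, h2, h3, h4⟩⟩
        · exact Or.inr (Or.inl ⟨hK, e⟩)
      · refine (cnt_or_le _ _).trans ?_
        have := cnt_or_le (fun K => Y.Adj v K ∧ (σ v).symm K ≠ τ K)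
          (fun K => Y.Adj v K ∧ ∀ w, Y.Adj v w → Y.Adj K w →
            (σ w).symm v = τ v → (σ w).symm K ≠ τ K)
        simp only [hf, hg]
        linarith
    rw [h.deg_eq] at h2
    have := hdeg' v
    linarith
  have hpt : ∀ v, cnt (fun w => Y.Adj v w ∧ (σ w).symm v ≠ v) ≤
      cnt (fun w => Y.Adj v w ∧ (σ w).symm v ≠ τ v) +
      2 * D * (ind (D / 8 < f v)) + 2 * D * (ind (D / 8 < g v)) := by
    intro v
    have hall : cnt (fun w => Y.Adj v w ∧ (σ w).symm v ≠ v) ≤ 2 * D :=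
      (cnt_mono fun w hw => hw.1).trans ((h.deg_eq v).le.trans (hdeg v))
    have h0 : 0 ≤ cnt (fun w => Y.Adj v w ∧ (σ w).symm v ≠ τ v) := cnt_nonneg _
    have hi1 := ind_nonneg (D / 8 < f v)
    have hi2 := ind_nonneg (D / 8 < g v)
    by_cases h1 : D / 8 < f v
    · rw [ind_pos h1]
      have : 0 ≤ 2 * D * ind (D / 8 < g v) := by positivity
      linarith
    · by_cases h2 : D / 8 < g v
      · rw [ind_neg h1, ind_pos h2]
        linarith
      · rw [ind_neg h1, ind_neg h2, hself v (not_lt.1 h1) (not_lt.1 h2)]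
        linarith
  calc ∑ v, cnt (fun w => Y.Adj v w ∧ (σ w).symm v ≠ v)
      ≤ ∑ v, (cnt (fun w => Y.Adj v w ∧ (σ w).symm v ≠ τ v) +
      2 * D * (ind (D / 8 < f v)) + 2 * D * (ind (D / 8 < g v))) :=
        sum_le_sum fun v _ => hpt v
    _ = ∑ v, cnt (fun w => Y.Adj v w ∧ (σ w).symm v ≠ τ v) +
        2 * D * cnt (fun v => D / 8 < f v) + 2 * D * cnt (fun v => D / 8 < g v) := by
        simp only [cnt, sum_add_distrib, mul_sum]
    -- `145 = 1 + 16 + 128`: Markov's inequality at `D / 8` for `f` and `g`, whose sums are at most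
    -- `γ * (N * D)` and `8 * γ * (N * D)`, costs `16` per unit
    _ ≤ 145 * γ * (N * D) := by linarith

end det

/-! ### Isomorphisms that move few neighbours are trivial -/

section near
variable {n : ℕ} {X Y : SimpleGraph (Fin n)} {σ : Fin n → Equiv.Perm (Fin n)}

lemma Matches.eq_of_fixes (h : Matches X Y σ) (hf : ∀ i j, X.Adj i j → σ i j = j) : X = Y := by
  ext i j
  constructor
  · intro hij
    have := (h.adj i j).1 hij
    rwa [hf i j hij] at this
  · intro hij
    have h1 := (h.adj_symm i j).1 hij
    have h2 := hf i _ h1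
    rw [Equiv.apply_symm_apply] at h2
    rwa [← h2] at h1

lemma Matches.card_moved_eq (h : Matches X Y σ) (i : Fin n) :
    cnt (fun v => Y.Adj i v ∧ (σ i).symm v ≠ v) = cnt (fun j => X.Adj i j ∧ σ i j ≠ j) := by
  refine le_antisymm (cnt_le_of_injOn (σ i).symm (fun j hj => ⟨(h.adj_symm i j).1 hj.1, ?_⟩)
    fun _ _ _ _ e => (σ i).symm.injective e)
    (cnt_le_of_injOn (σ i) (fun j hj => ⟨(h.adj i j).1 hj.1, ?_⟩)
    fun _ _ _ _ e => (σ i).injective e)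
  · rw [Equiv.apply_symm_apply]; exact fun e => hj.2 e.symm
  · rw [Equiv.symm_apply_apply]; exact fun e => hj.2 e.symm

lemma Matches.card_new_eq (h : Matches X Y σ) (i : Fin n) :
    cnt (fun j => Y.Adj i j ∧ ¬ X.Adj i j) = cnt (fun j => X.Adj i j ∧ ¬ Y.Adj i j) := by
  have h1 : cnt (fun j => Y.Adj i j) = cnt (fun j => Y.Adj i j ∧ ¬ X.Adj i j) +
      cnt (fun j => Y.Adj i j ∧ X.Adj i j) :=
    le_antisymm (cnt_le_add fun j hj => by tauto)
      (cnt_add_le (fun j hj => hj.1) (fun j hj => hj.1) fun j hj hj' => hj.2 hj'.2)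
  have h2 : cnt (fun j => X.Adj i j) = cnt (fun j => X.Adj i j ∧ ¬ Y.Adj i j) +
      cnt (fun j => Y.Adj i j ∧ X.Adj i j) :=
    le_antisymm (cnt_le_add fun j hj => by tauto)
      (cnt_add_le (fun j hj => hj.1) (fun j hj => hj.2) fun j hj hj' => hj.2 hj'.1)
  have := h.deg_eq i
  linarith

lemma Matches.card_new_le (h : Matches X Y σ) (i : Fin n) :
    cnt (fun j => Y.Adj i j ∧ ¬ X.Adj i j) ≤ cnt (fun j => X.Adj i j ∧ σ i j ≠ j) := by
  rw [← h.card_moved_eq]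
  refine cnt_mono fun j hj => ⟨hj.1, fun e => hj.2 ?_⟩
  have := (h.adj_symm i j).1 hj.1
  rwa [e] at this

/-- An edge of `Y` lies in as many neighbourhoods as it has common neighbours, and this number is a
codegree of `X`. -/
lemma Matches.sum_new_link_le (h : Matches X Y σ) {c : ℝ}
    (hcod : ∀ i j, i ≠ j → cnt (fun w => X.Adj i w ∧ X.Adj j w) ≤ c) :
    ∑ i, cnt (fun x : Fin n × Fin n =>
      Y.Adj i x.1 ∧ Y.Adj i x.2 ∧ Y.Adj x.1 x.2 ∧ ¬ X.Adj x.1 x.2) ≤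
      c * ∑ i, cnt (fun j => Y.Adj i j ∧ ¬ X.Adj i j) := by
  rw [sum_cnt_comm, ← cnt_prod (fun (x : Fin n × Fin n) i => Y.Adj i x.1 ∧ Y.Adj i x.2 ∧
    Y.Adj x.1 x.2 ∧ ¬ X.Adj x.1 x.2), ← cnt_prod (fun i j => Y.Adj i j ∧ ¬ X.Adj i j)]
  refine le_trans (cnt_mono fun x hx => ?_)
    (cnt_prod_le_mul_cnt (P := fun x : Fin n × Fin n => Y.Adj x.1 x.2 ∧ ¬ X.Adj x.1 x.2)
    (Q := fun x i => Y.Adj x.1 i ∧ Y.Adj x.2 i) fun x hx => ?_)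
  · exact ⟨hx.2.2, hx.1.symm, hx.2.1.symm⟩
  · rw [h.codeg_eq hx.1]
    exact hcod _ _ ((h.adj_symm _ _).1 hx.1).ne

/-- If `σ i` moves `m ≤ D / 16` neighbours of `i`, then at least about `2 * m * d` ordered pairs of
neighbours of `i` are adjacent in `Y` but not in `X`: each moved `j` has about `d` neighbours `k` in
the neighbourhood of `i`, most of them are fixed, and `s(σ i j, k)` is rarely an edge of `X`
because that makes `k` a common neighbour of three distinct vertices. -/
lemma Matches.le_new_link_of_few (h : Matches X Y σ) {D d p L : ℝ} (i : Fin n)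
    (hcod : ∀ i j, i ≠ j → (1 - 1 / 10000) * d ≤ cnt (fun w => X.Adj i w ∧ X.Adj j w))
    (hc3 : ∀ i j k, i ≠ j → i ≠ k → j ≠ k →
      cnt (fun w => X.Adj i w ∧ X.Adj j w ∧ X.Adj k w) ≤ 1 / 10000 * d)
    (hedge : ∀ P : Fin n → Prop, cnt (fun x : Fin n × Fin n => P x.1 ∧ P x.2 ∧ X.Adj x.1 x.2) ≤
      2 * cnt P * (cnt P * p + 4 * L))
    (hp : 0 ≤ p) (hd : d = D * p) (hL : 8 * L ≤ 1 / 10000 * d) (hd0 : 0 ≤ d)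
    (hm : cnt (fun j => X.Adj i j ∧ σ i j ≠ j) ≤ D / 16) :
    3 / 2 * d * cnt (fun j => X.Adj i j ∧ σ i j ≠ j) ≤ cnt (fun x : Fin n × Fin n =>
      Y.Adj i x.1 ∧ Y.Adj i x.2 ∧ Y.Adj x.1 x.2 ∧ ¬ X.Adj x.1 x.2) := by
  set m := cnt (fun j => X.Adj i j ∧ σ i j ≠ j) with hmdef
  have hm0 : 0 ≤ m := cnt_nonneg _
  have s1 : (1 - 1 / 10000) * d * m ≤ cnt (fun x : Fin n × Fin n =>
      (X.Adj i x.1 ∧ σ i x.1 ≠ x.1) ∧ X.Adj i x.2 ∧ X.Adj x.1 x.2) :=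
    mul_cnt_le_cnt_prod (P := fun j => X.Adj i j ∧ σ i j ≠ j)
      (Q := fun j k => X.Adj i k ∧ X.Adj j k) fun j hj => hcod i j hj.1.ne
  have s2 := hedge (fun j => X.Adj i j ∧ σ i j ≠ j)
  rw [← hmdef] at s2
  have s3 : cnt (fun x : Fin n × Fin n =>
      (X.Adj i x.1 ∧ σ i x.1 ≠ x.1) ∧ X.Adj i x.2 ∧ X.Adj x.1 x.2) ≤
      cnt (fun x : Fin n × Fin n => (X.Adj i x.1 ∧ σ i x.1 ≠ x.1) ∧ (X.Adj i x.2 ∧ σ i x.2 ≠ x.2) ∧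
        X.Adj x.1 x.2) +
      cnt (fun x : Fin n × Fin n => (X.Adj i x.1 ∧ σ i x.1 ≠ x.1) ∧ X.Adj i x.2 ∧ σ i x.2 = x.2 ∧
        X.Adj x.1 x.2) := cnt_le_add fun x hx => by tauto
  have s4 : cnt (fun x : Fin n × Fin n => (X.Adj i x.1 ∧ σ i x.1 ≠ x.1) ∧ X.Adj i x.2 ∧
        σ i x.2 = x.2 ∧ X.Adj x.1 x.2) ≤
      cnt (fun x : Fin n × Fin n => (X.Adj i x.1 ∧ σ i x.1 ≠ x.1) ∧
        (X.Adj i x.2 ∧ X.Adj x.1 x.2 ∧ X.Adj (σ i x.1) x.2)) +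
      cnt (fun x : Fin n × Fin n => (X.Adj i x.1 ∧ σ i x.1 ≠ x.1) ∧ X.Adj i x.2 ∧ σ i x.2 = x.2 ∧
        X.Adj x.1 x.2 ∧ ¬ X.Adj (σ i x.1) x.2) := cnt_le_add fun x hx => by tauto
  have s5 : cnt (fun x : Fin n × Fin n => (X.Adj i x.1 ∧ σ i x.1 ≠ x.1) ∧
        (X.Adj i x.2 ∧ X.Adj x.1 x.2 ∧ X.Adj (σ i x.1) x.2)) ≤ 1 / 10000 * d * m := by
    refine cnt_prod_le_mul_cnt (P := fun j => X.Adj i j ∧ σ i j ≠ j)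
      (Q := fun j k => X.Adj i k ∧ X.Adj j k ∧ X.Adj (σ i j) k) fun j hj => ?_
    refine hc3 i j (σ i j) hj.1.ne ?_ (Ne.symm hj.2)
    intro e
    have : σ i j = σ i i := by rw [h.fix]; exact e.symm
    exact hj.1.ne ((σ i).injective this).symm
  have s6 : ∀ x : Fin n × Fin n, (X.Adj i x.1 ∧ σ i x.1 ≠ x.1) ∧ X.Adj i x.2 ∧ σ i x.2 = x.2 ∧
        X.Adj x.1 x.2 ∧ ¬ X.Adj (σ i x.1) x.2 → Y.Adj i (σ i x.1) ∧ Y.Adj i x.2 ∧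
        Y.Adj (σ i x.1) x.2 ∧ ¬ X.Adj (σ i x.1) x.2 := by
    rintro x ⟨⟨a1, a2⟩, a3, a4, a5, a6⟩
    refine ⟨(h.adj _ _).1 a1, ?_, ?_, a6⟩
    · have := (h.adj _ _).1 a3; rwa [a4] at this
    · have := (h.link i _ _ a1 a3).1 a5; rwa [a4] at this
  have s7 : cnt (fun x : Fin n × Fin n => (X.Adj i x.1 ∧ σ i x.1 ≠ x.1) ∧ X.Adj i x.2 ∧
        σ i x.2 = x.2 ∧ X.Adj x.1 x.2 ∧ ¬ X.Adj (σ i x.1) x.2) ≤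
      cnt (fun x : Fin n × Fin n => (Y.Adj i x.1 ∧ Y.Adj i x.2 ∧ Y.Adj x.1 x.2 ∧
        ¬ X.Adj x.1 x.2) ∧ σ i x.2 = x.2 ∧ σ i x.1 ≠ x.1) := by
    refine cnt_le_of_injOn (fun x => (σ i x.1, x.2)) (fun x hx => ⟨s6 x hx, hx.2.2.1, ?_⟩) ?_
    · exact fun e => hx.1.2 ((σ i).injective e)
    · intro x y _ _ e
      simp only [Prod.mk.injEq, EmbeddingLike.apply_eq_iff_eq] at e
      exact Prod.ext e.1 e.2
  have s8 : cnt (fun x : Fin n × Fin n => (X.Adj i x.1 ∧ σ i x.1 ≠ x.1) ∧ X.Adj i x.2 ∧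
        σ i x.2 = x.2 ∧ X.Adj x.1 x.2 ∧ ¬ X.Adj (σ i x.1) x.2) ≤
      cnt (fun x : Fin n × Fin n => (Y.Adj i x.1 ∧ Y.Adj i x.2 ∧ Y.Adj x.1 x.2 ∧
        ¬ X.Adj x.1 x.2) ∧ σ i x.1 = x.1) := by
    refine cnt_le_of_injOn (fun x => (x.2, σ i x.1)) (fun x hx => ⟨?_, hx.2.2.1⟩) ?_
    · obtain ⟨a, b, c, e⟩ := s6 x hx
      exact ⟨b, a, c.symm, fun h => e h.symm⟩
    · intro x y _ _ e
      simp only [Prod.mk.injEq, EmbeddingLike.apply_eq_iff_eq] at e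
      exact Prod.ext e.2 e.1
  have s9 : cnt (fun x : Fin n × Fin n => (Y.Adj i x.1 ∧ Y.Adj i x.2 ∧ Y.Adj x.1 x.2 ∧
        ¬ X.Adj x.1 x.2) ∧ σ i x.2 = x.2 ∧ σ i x.1 ≠ x.1) +
      cnt (fun x : Fin n × Fin n => (Y.Adj i x.1 ∧ Y.Adj i x.2 ∧ Y.Adj x.1 x.2 ∧
        ¬ X.Adj x.1 x.2) ∧ σ i x.1 = x.1) ≤ cnt (fun x : Fin n × Fin n =>
      Y.Adj i x.1 ∧ Y.Adj i x.2 ∧ Y.Adj x.1 x.2 ∧ ¬ X.Adj x.1 x.2) :=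
    cnt_add_le (fun x hx => hx.1) (fun x hx => hx.1) fun x hx hx' => hx.2.2 hx'.2
  have s10 : 2 * m * (m * p + 4 * L) ≤ 2 * m * (d / 16 + 1 / 20000 * d) := by
    have : m * p ≤ d / 16 := by
      rw [hd]; nlinarith
    have : m * p + 4 * L ≤ d / 16 + 1 / 20000 * d := by linarith
    nlinarith
  have hmd : 0 ≤ m * d := by positivity
  nlinarith

/-- However many neighbours of `i` are moved, almost every edge of `X` between a moved neighbour of
`i` and another one is sent by `σ i` to an edge of `Y` which is not an edge of `X`, because `σ i`
cannot send many edges of `X` to other edges of `X`. -/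
lemma Matches.le_new_link (h : Matches X Y σ) {D d : ℝ} (i : Fin n)
    (hdeg : ∀ i, cnt (fun j => X.Adj i j) ≤ 2 * D)
    (hcod : ∀ i j, i ≠ j → (1 - 1 / 10000) * d ≤ cnt (fun w => X.Adj i w ∧ X.Adj j w))
    (hrig : ∀ (P : Fin n → Prop) (f : Fin n → Fin n), cnt P ≤ 2 * D → Function.Injective f →
      cnt (fun x : Fin n × Fin n => P x.1 ∧ P x.2 ∧ X.Adj x.1 x.2 ∧ X.Adj (f x.1) (f x.2) ∧
        s(f x.1, f x.2) ≠ s(x.1, x.2)) ≤ 1 / 80000 * (D * d))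
    (hd1 : 10000 ≤ d) :
    (1 - 2 / 10000) * d * cnt (fun j => X.Adj i j ∧ σ i j ≠ j) - 1 / 80000 * (D * d) ≤
      cnt (fun x : Fin n × Fin n =>
        Y.Adj i x.1 ∧ Y.Adj i x.2 ∧ Y.Adj x.1 x.2 ∧ ¬ X.Adj x.1 x.2) := by
  set m := cnt (fun j => X.Adj i j ∧ σ i j ≠ j) with hmdef
  have hm0 : 0 ≤ m := cnt_nonneg _
  have s1 : (1 - 1 / 10000) * d * m ≤ cnt (fun x : Fin n × Fin n =>
      (X.Adj i x.1 ∧ σ i x.1 ≠ x.1) ∧ X.Adj i x.2 ∧ X.Adj x.1 x.2) :=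
    mul_cnt_le_cnt_prod (P := fun j => X.Adj i j ∧ σ i j ≠ j)
      (Q := fun j k => X.Adj i k ∧ X.Adj j k) fun j hj => hcod i j hj.1.ne
  have s2 : cnt (fun x : Fin n × Fin n =>
      (X.Adj i x.1 ∧ σ i x.1 ≠ x.1) ∧ X.Adj i x.2 ∧ X.Adj x.1 x.2) ≤
      cnt (fun x : Fin n × Fin n => (X.Adj i x.1 ∧ σ i x.1 ≠ x.1) ∧ σ i x.1 = x.2) +
      cnt (fun x : Fin n × Fin n => (X.Adj i x.1 ∧ σ i x.1 ≠ x.1 ∧ X.Adj i x.2 ∧ X.Adj x.1 x.2) ∧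
        σ i x.1 ≠ x.2) := cnt_le_add fun x hx => by tauto
  have s3 : cnt (fun x : Fin n × Fin n => (X.Adj i x.1 ∧ σ i x.1 ≠ x.1) ∧ σ i x.1 = x.2) ≤ m := by
    refine cnt_le_of_injOn Prod.fst (fun x hx => hx.1) fun x y hx hy e => Prod.ext e ?_
    rw [← hx.2, ← hy.2, e]
  have s4 : cnt (fun x : Fin n × Fin n => (X.Adj i x.1 ∧ σ i x.1 ≠ x.1 ∧ X.Adj i x.2 ∧
        X.Adj x.1 x.2) ∧ σ i x.1 ≠ x.2) ≤
      cnt (fun x : Fin n × Fin n => X.Adj i x.1 ∧ X.Adj i x.2 ∧ X.Adj x.1 x.2 ∧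
        X.Adj (σ i x.1) (σ i x.2) ∧ s(σ i x.1, σ i x.2) ≠ s(x.1, x.2)) +
      cnt (fun x : Fin n × Fin n => X.Adj i x.1 ∧ X.Adj i x.2 ∧ X.Adj x.1 x.2 ∧
        ¬ X.Adj (σ i x.1) (σ i x.2)) := by
    refine cnt_le_add fun x hx => ?_
    obtain ⟨⟨a1, a2, a3, a4⟩, a5⟩ := hx
    by_cases hX : X.Adj (σ i x.1) (σ i x.2)
    · left
      refine ⟨a1, a3, a4, hX, ?_⟩
      rw [Ne, Sym2.eq_iff]
      tauto
    · exact Or.inr ⟨a1, a3, a4, hX⟩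
  have s5 := hrig (X.Adj i) (σ i) (hdeg i) (σ i).injective
  have s6 : cnt (fun x : Fin n × Fin n => X.Adj i x.1 ∧ X.Adj i x.2 ∧ X.Adj x.1 x.2 ∧
        ¬ X.Adj (σ i x.1) (σ i x.2)) ≤ cnt (fun x : Fin n × Fin n =>
        Y.Adj i x.1 ∧ Y.Adj i x.2 ∧ Y.Adj x.1 x.2 ∧ ¬ X.Adj x.1 x.2) := by
    refine cnt_le_of_injOn (fun x => (σ i x.1, σ i x.2)) ?_ ?_
    · rintro x ⟨a1, a2, a3, a4⟩
      exact ⟨(h.adj _ _).1 a1, (h.adj _ _).1 a2, (h.link i _ _ a1 a2).1 a3, a4⟩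
    · intro x y _ _ e
      simp only [Prod.mk.injEq, EmbeddingLike.apply_eq_iff_eq] at e
      exact Prod.ext e.1 e.2
  have hmd : m ≤ 1 / 10000 * d * m := by nlinarith
  linarith

/-- If few neighbours are moved in total, then none is. Write `m i` for the number of neighbours of
`i` moved by `σ i`, `y i` for the number of neighbours it has in `Y` but not in `X`, and `A` for the
set of vertices with `m i > D / 16`. Counting the edges of `Y` that are not in `X` inside all
neighbourhoods gives `3 / 2 * d * ∑_{Aᶜ} m + (1 - ε) * d * ∑_A m ≤ (1 + ε) * d * ∑ y` up to small
terms. Since `y ≤ m`, this bounds `∑_{Aᶜ} m` by `ε * ∑_A m`. A vertex of `A` loses as many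
neighbours as it gains; the neighbours outside of `A` that are lost number at most `∑_{Aᶜ} m` in
total, and few edges of `X` lie inside `A`. So `∑_A y` is also small compared to `∑_A m`, and
everything vanishes. -/
lemma Matches.eq_of_few_moved (h : Matches X Y σ) {D d p L : ℝ}
    (hdeg : ∀ i, cnt (fun j => X.Adj i j) ≤ 2 * D)
    (hcod : ∀ i j, i ≠ j → (1 - 1 / 10000) * d ≤ cnt (fun w => X.Adj i w ∧ X.Adj j w))
    (hcod' : ∀ i j, i ≠ j → cnt (fun w => X.Adj i w ∧ X.Adj j w) ≤ (1 + 1 / 10000) * d)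
    (hc3 : ∀ i j k, i ≠ j → i ≠ k → j ≠ k →
      cnt (fun w => X.Adj i w ∧ X.Adj j w ∧ X.Adj k w) ≤ 1 / 10000 * d)
    (hedge : ∀ P : Fin n → Prop, cnt (fun x : Fin n × Fin n => P x.1 ∧ P x.2 ∧ X.Adj x.1 x.2) ≤
      2 * cnt P * (cnt P * p + 4 * L))
    (hrig : ∀ (P : Fin n → Prop) (f : Fin n → Fin n), cnt P ≤ 2 * D → Function.Injective f →
      cnt (fun x : Fin n × Fin n => P x.1 ∧ P x.2 ∧ X.Adj x.1 x.2 ∧ X.Adj (f x.1) (f x.2) ∧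
        s(f x.1, f x.2) ≠ s(x.1, x.2)) ≤ 1 / 80000 * (D * d))
    (hp : 0 < p) (hp1 : p ≤ 1) (hD : D = n * p) (hd : d = D * p) (hL : 8 * L ≤ 1 / 10000 * d)
    (hd1 : 10000 ≤ d)
    (hmoved : ∑ v, cnt (fun w => Y.Adj v w ∧ (σ w).symm v ≠ v) ≤ 1 / 16000 * (n * D)) :
    X = Y := by
  have hD0 : 0 < D := by
    by_contra hcon
    push Not at hcon
    nlinarith
  have hdD : d ≤ D := by rw [hd]; nlinarith
  set m : Fin n → ℝ := fun i => cnt (fun j => X.Adj i j ∧ σ i j ≠ j) with hm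
  set y : Fin n → ℝ := fun i => cnt (fun j => Y.Adj i j ∧ ¬ X.Adj i j) with hy
  set u : Fin n → ℝ := fun i => cnt (fun x : Fin n × Fin n =>
    Y.Adj i x.1 ∧ Y.Adj i x.2 ∧ Y.Adj x.1 x.2 ∧ ¬ X.Adj x.1 x.2) with hu
  have hm0 : ∀ i, 0 ≤ m i := fun i => cnt_nonneg _
  have hy0 : ∀ i, 0 ≤ y i := fun i => cnt_nonneg _
  have hym : ∀ i, y i ≤ m i := fun i => h.card_new_le i
  have hm2 : ∀ i, m i ≤ 2 * D := fun i => (cnt_mono fun j hj => hj.1).trans (hdeg i)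
  have hmsum : ∑ i, m i ≤ 1 / 16000 * (n * D) := by
    refine le_trans (le_of_eq ?_) hmoved
    rw [sum_cnt_comm (fun v w => Y.Adj v w ∧ (σ w).symm v ≠ v)]
    refine sum_congr rfl fun i _ => ?_
    rw [hm]
    simp only
    rw [← h.card_moved_eq]
    exact cnt_congr fun v => by rw [Y.adj_comm]
  set α : ℝ := cnt (fun i => D / 16 < m i) with hα
  set a : ℝ := ∑ i, m i * ind (¬ D / 16 < m i) with ha
  set mA : ℝ := ∑ i, m i * ind (D / 16 < m i) with hmA
  set yA : ℝ := ∑ i, y i * ind (D / 16 < m i) with hyA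
  have hα0 : 0 ≤ α := cnt_nonneg _
  have hindsplit : ∀ P : Prop, ind P + ind (¬ P) = 1 := by
    intro P
    by_cases hP : P
    · rw [ind_pos hP, ind_neg (not_not.2 hP), add_zero]
    · rw [ind_neg hP, ind_pos hP, zero_add]
  have ha0 : 0 ≤ a := sum_nonneg fun i _ => mul_nonneg (hm0 i) (ind_nonneg _)
  -- lower bound for the number of new edges inside neighbourhoods
  have low : 3 / 2 * d * a + ((1 - 2 / 10000) * d * mA - 1 / 80000 * (D * d) * α) ≤ ∑ i, u i := by
    rw [ha, hmA, hα, cnt, mul_sum, mul_sum, mul_sum, ← sum_sub_distrib, ← sum_add_distrib]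
    refine sum_le_sum fun i _ => ?_
    by_cases hi : D / 16 < m i
    · rw [ind_pos hi, ind_neg (not_not.2 hi)]
      have := h.le_new_link i hdeg hcod hrig hd1
      simp only [hm, hu]
      linarith
    · rw [ind_neg hi, ind_pos hi]
      have := h.le_new_link_of_few i hcod hc3 hedge hp.le hd hL (by linarith) (not_lt.1 hi)
      simp only [hm, hu]
      linarith
  have up : ∑ i, u i ≤ (1 + 1 / 10000) * d * ∑ i, y i := h.sum_new_link_le hcod'
  have ysplit : ∑ i, y i ≤ a + yA := by
    rw [ha, hyA, ← sum_add_distrib]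
    refine sum_le_sum fun i _ => ?_
    have h1 := hindsplit (D / 16 < m i)
    have h2 := mul_le_mul_of_nonneg_right (hym i) (ind_nonneg (¬ D / 16 < m i))
    have h3 : y i * ind (D / 16 < m i) + y i * ind (¬ D / 16 < m i) = y i := by
      rw [← mul_add, h1, mul_one]
    linarith
  have yAm : yA ≤ mA := sum_le_sum fun i _ => mul_le_mul_of_nonneg_right (hym i) (ind_nonneg _)
  have mAu : mA ≤ 2 * D * α := by
    rw [hmA, hα, cnt, mul_sum]
    exact sum_le_sum fun i _ => mul_le_mul_of_nonneg_right (hm2 i) (ind_nonneg _)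
  have mAl : D / 16 * α ≤ mA := by
    rw [hmA, hα, cnt, mul_sum]
    refine sum_le_sum fun i _ => ?_
    by_cases hi : D / 16 < m i
    · rw [ind_pos hi]; linarith
    · rw [ind_neg hi]; linarith
  have hαn : α * p ≤ D / 1000 := by
    have h1 : mA ≤ ∑ i, m i := sum_le_sum fun i _ => by
      have := hm0 i
      by_cases hi : D / 16 < m i
      · rw [ind_pos hi]; linarith
      · rw [ind_neg hi]; linarith
    have h2 : D / 16 * α ≤ D / 16 * (n / 1000) := by linarith
    have h3 := le_of_mul_le_mul_left h2 (by positivity)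
    rw [hD]; nlinarith
  have hedgeA := hedge (fun i => D / 16 < m i)
  rw [← hα] at hedgeA
  have hedgeA' : 2 * α * (α * p + 4 * L) ≤ 2 * α * (D / 1000 + D / 20000) := by
    have : α * p + 4 * L ≤ D / 1000 + D / 20000 := by linarith
    exact mul_le_mul_of_nonneg_left this (by linarith)
  have yAa : yA ≤ a + cnt (fun x : Fin n × Fin n => D / 16 < m x.1 ∧ D / 16 < m x.2 ∧
      X.Adj x.1 x.2) := by
    have e1 : yA = cnt (fun x : Fin n × Fin n => D / 16 < m x.1 ∧ X.Adj x.1 x.2 ∧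
        ¬ Y.Adj x.1 x.2) := by
      rw [cnt_prod (fun i j => D / 16 < m i ∧ X.Adj i j ∧ ¬ Y.Adj i j), hyA]
      refine sum_congr rfl fun i _ => ?_
      by_cases hi : D / 16 < m i
      · rw [ind_pos hi, mul_one]
        exact (h.card_new_eq i).trans (cnt_congr fun j => by tauto)
      · rw [ind_neg hi, mul_zero]
        exact (cnt_false fun j hj => hi hj.1).symm
    have e2 : cnt (fun x : Fin n × Fin n => ¬ D / 16 < m x.2 ∧ X.Adj x.1 x.2 ∧
        ¬ Y.Adj x.1 x.2) ≤ a := by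
      rw [cnt_prod (fun i j => ¬ D / 16 < m j ∧ X.Adj i j ∧ ¬ Y.Adj i j), sum_cnt_comm, ha]
      refine sum_le_sum fun j _ => ?_
      by_cases hj : D / 16 < m j
      · rw [ind_neg (not_not.2 hj), mul_zero]
        exact (cnt_false fun i hi => hi.1 hj).le
      · rw [ind_pos hj, mul_one]
        refine le_trans (cnt_mono fun i hi => ?_) ((h.card_new_eq j).symm.le.trans (hym j))
        exact ⟨hi.2.1.symm, fun e => hi.2.2 e.symm⟩
    rw [e1]
    refine le_trans (cnt_le_add fun x hx => ?_) (add_le_add_left e2 _)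
    tauto
  have hd0 : 0 < d := by linarith
  -- cancel `d`
  have main1 : 3 / 2 * a + (1 - 2 / 10000) * mA - 1 / 80000 * D * α ≤
      (1 + 1 / 10000) * (a + yA) := by
    refine le_of_mul_le_mul_left ?_ hd0
    have h1 := mul_le_mul_of_nonneg_left ysplit (show 0 ≤ (1 + 1 / 10000) * d by positivity)
    linarith
  have hDα : D * α ≤ 0 := by linarith
  have hα1 : α = 0 := by
    have : 0 ≤ D * α := by positivity
    have h0 : D * α = 0 := le_antisymm hDα this
    rcases mul_eq_zero.1 h0 with h1 | h1
    · exact absurd h1 hD0.ne'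
    · exact h1
  rw [hα1] at mAu mAl main1
  have ha1 : ∑ i, m i = 0 := by
    have : ∑ i, m i = a + mA := by
      rw [ha, hmA, ← sum_add_distrib]
      refine sum_congr rfl fun i _ => ?_
      have := hindsplit (D / 16 < m i)
      rw [← mul_add, add_comm, this, mul_one]
    have h2 : 0 ≤ ∑ i, m i := sum_nonneg fun i _ => hm0 i
    linarith
  refine h.eq_of_fixes fun i j hij => ?_
  by_contra hne
  have h1 : m i = 0 := (sum_eq_zero_iff_of_nonneg fun i _ => hm0 i).1 ha1 i (mem_univ _)
  have h2 : ind (X.Adj i j ∧ σ i j ≠ j) = 0 :=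
    (sum_eq_zero_iff_of_nonneg fun k _ => ind_nonneg _).1 h1 j (mem_univ _)
  rw [ind_pos ⟨hij, hne⟩] at h2
  norm_num at h2

end near

/-! ### Few isomorphisms reveal many coincidences among the edges -/

/-- A uniformly random sequence of `s` vertices hits every one of the given large sets. -/
lemma exists_hitting {n : ℕ} {κ : Type*} [Fintype κ] (T : κ → Fin n → Prop) {t : ℝ} (s : ℕ)
    (hn : 0 < n) (hs : Fintype.card κ * Real.exp (-(s * t / n)) < 1) :
    ∃ h : Fin s → Fin n, ∀ k, t ≤ cnt (T k) → ∃ a, T k (h a) := by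
  classical
  by_contra hcon
  push Not at hcon
  have hn' : (0 : ℝ) < n := by exact_mod_cast hn
  have hcover : (univ : Finset (Fin s → Fin n)) ⊆
      ({k | t ≤ cnt (T k)} : Finset κ).biUnion
        fun k => Fintype.piFinset fun _ : Fin s => ({v | ¬ T k v} : Finset (Fin n)) := by
    intro h _
    obtain ⟨k, hk, hk'⟩ := hcon h
    rw [mem_biUnion]
    exact ⟨k, by simpa using hk, by simpa using hk'⟩
  have h1 : ((n : ℝ) ^ s) ≤ ∑ k with t ≤ cnt (T k), (#{v | ¬ T k v} : ℝ) ^ s := by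
    have := (card_le_card hcover).trans card_biUnion_le
    simp only [card_univ, Fintype.card_fun, Fintype.card_fin, Fintype.card_piFinset, prod_const]
      at this
    exact_mod_cast this
  have h2 : ∀ k ∈ ({k | t ≤ cnt (T k)} : Finset κ),
      (#{v | ¬ T k v} : ℝ) ^ s ≤ n ^ s * Real.exp (-(s * t / n)) := by
    intro k hk
    have hk' : t ≤ cnt (T k) := by simpa using hk
    rw [cnt_eq_card] at hk'
    have e1 : (#{v | T k v} : ℝ) + #{v | ¬ T k v} = n := by
      have := card_filter_add_card_filter_not (s := (univ : Finset (Fin n))) (T k)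
      rw [card_univ, Fintype.card_fin] at this
      exact_mod_cast this
    have e2 : (#{v | ¬ T k v} : ℝ) ≤ n * Real.exp (-(t / n)) := by
      have := Real.add_one_le_exp (-(t / n))
      have e3 : (n : ℝ) * (-(t / n) + 1) = n - t := by field_simp; ring
      nlinarith
    calc (#{v | ¬ T k v} : ℝ) ^ s ≤ (n * Real.exp (-(t / n))) ^ s :=
          pow_le_pow_left₀ (Nat.cast_nonneg _) e2 _
      _ = n ^ s * Real.exp (-(s * t / n)) := by
          rw [mul_pow, ← Real.exp_nat_mul]
          congr 2; ring
  have h3 : ((n : ℝ) ^ s) ≤ Fintype.card κ * (n ^ s * Real.exp (-(s * t / n))) := by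
    refine h1.trans ((sum_le_sum h2).trans ?_)
    rw [sum_const, nsmul_eq_mul]
    refine mul_le_mul_of_nonneg_right ?_ (by positivity)
    exact_mod_cast card_le_univ _
  have h4 : (0 : ℝ) < n ^ s := by positivity
  nlinarith

lemma card_finsets_le {α : Type*} [Fintype α] (K : ℕ) :
    #{T : Finset α | #T ≤ K} ≤ (Fintype.card α + 1) ^ K := by
  classical
  have : (Fintype.card α + 1) ^ K = #(univ : Finset (Fin K → Option α)) := by
    simp
  rw [this]
  refine card_le_card_of_surjOn (fun t => univ.filter fun x => ∃ a, t a = some x) ?_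
  intro T hT
  have hT' : #T ≤ K := by simpa using hT
  refine ⟨fun a => if h : (a : ℕ) < #T then some (T.equivFin.symm ⟨a, h⟩ : α) else none,
    by simp, ?_⟩
  ext x
  simp only [mem_filter, mem_univ, true_and]
  constructor
  · rintro ⟨a, ha⟩
    split_ifs at ha with h
    have := Option.some.inj ha
    rw [← this]
    exact (T.equivFin.symm ⟨a, h⟩).2
  · intro hx
    refine ⟨⟨T.equivFin ⟨x, hx⟩, lt_of_lt_of_le (T.equivFin ⟨x, hx⟩).2 hT'⟩, ?_⟩
    simp

section twins
variable {n : ℕ} {X Y : SimpleGraph (Fin n)} {σ : Fin n → Equiv.Perm (Fin n)}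

/-- For a set `T` of triples `(i, j, J)`, read as `σ i j = J`, the pairs `e` and `e'` are twins if
two of the maps `σ i` recorded in `T` send them to the same pair `s(J, K)`. -/
def Twin (T : Finset (Fin n × Fin n × Fin n)) (e e' : Sym2 (Fin n)) : Prop :=
  ∃ i i' j k j' k' J K, (i, j, J) ∈ T ∧ (i, k, K) ∈ T ∧ (i', j', J) ∈ T ∧ (i', k', K) ∈ T ∧
    e = s(j, k) ∧ e' = s(j', k')

lemma Matches.twin_iff (h : Matches X Y σ) {T : Finset (Fin n × Fin n × Fin n)}
    (hT : ∀ x ∈ T, X.Adj x.1 x.2.1 ∧ σ x.1 x.2.1 = x.2.2) {e e' : Sym2 (Fin n)}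
    (he : Twin T e e') : e ∈ X.edgeSet ↔ e' ∈ X.edgeSet := by
  obtain ⟨i, i', j, k, j', k', J, K, h1, h2, h3, h4, rfl, rfl⟩ := he
  obtain ⟨a1, b1⟩ := hT _ h1
  obtain ⟨a2, b2⟩ := hT _ h2
  obtain ⟨a3, b3⟩ := hT _ h3
  obtain ⟨a4, b4⟩ := hT _ h4
  simp only at a1 a2 a3 a4 b1 b2 b3 b4
  rw [SimpleGraph.mem_edgeSet, SimpleGraph.mem_edgeSet, h.link i j k a1 a2,
    h.link i' j' k' a3 a4, b1, b2, b3, b4]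

open scoped Classical in
/-- The pairs that have a twin other than themselves. -/
noncomputable def twinned (T : Finset (Fin n × Fin n × Fin n)) : Finset (Sym2 (Fin n)) :=
  {e | ∃ e', e' ≠ e ∧ Twin T e e'}

open scoped Classical in
/-- A twin of `e` other than `e`, if there is one, and `e` otherwise. -/
noncomputable def twin (T : Finset (Fin n × Fin n × Fin n)) (e : Sym2 (Fin n)) : Sym2 (Fin n) :=
  if h : ∃ e', e' ≠ e ∧ Twin T e e' then h.choose else e

lemma twin_spec {T : Finset (Fin n × Fin n × Fin n)} {e : Sym2 (Fin n)} (he : e ∈ twinned T) :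
    twin T e ≠ e ∧ Twin T e (twin T e) := by
  have h : ∃ e', e' ≠ e ∧ Twin T e e' := by simpa [twinned] using he
  rw [twin, dif_pos h]
  exact h.choose_spec

/-- If many edges of `Y` are contested, then many edges of `X` are popular: at least `η * d` of the
maps `σ w` send them to contested edges. This is a double count of the pairs of a contested edge and
one of its common neighbours. -/
lemma Matches.card_popular (h : Matches X Y σ) {D d η : ℝ} (hd : 0 < d) (hη : 0 ≤ η)
    (hdeg : ∀ i, cnt (fun j => X.Adj i j) ≤ 2 * D)
    (hcod : ∀ i j, i ≠ j → cnt (fun w => X.Adj i w ∧ X.Adj j w) ≤ 2 * d)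
    (hcod' : ∀ i j, i ≠ j → d / 2 ≤ cnt (fun w => X.Adj i w ∧ X.Adj j w)) :
    cnt (fun x : Fin n × Fin n => Contested Y σ (η * d) x.1 x.2) / 4 - η * (n * D) ≤
      cnt (fun x : Fin n × Fin n => X.Adj x.1 x.2 ∧ η * d ≤
        cnt (fun w => X.Adj w x.1 ∧ X.Adj w x.2 ∧
          Contested Y σ (η * d) (σ w x.1) (σ w x.2))) := by
  set C := Contested Y σ (η * d) with hC
  have s1 : d / 2 * cnt (fun x : Fin n × Fin n => C x.1 x.2) ≤
      cnt (fun z : (Fin n × Fin n) × Fin n => C z.1.1 z.1.2 ∧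
        Y.Adj z.1.1 z.2 ∧ Y.Adj z.1.2 z.2) :=
    mul_cnt_le_cnt_prod (P := fun x : Fin n × Fin n => C x.1 x.2)
      (Q := fun x w => Y.Adj x.1 w ∧ Y.Adj x.2 w) fun x hx => by
        rw [h.codeg_eq hx.1]
        exact hcod' _ _ ((h.adj_symm _ _).1 hx.1).ne
  have s2 : cnt (fun z : (Fin n × Fin n) × Fin n => C z.1.1 z.1.2 ∧
        Y.Adj z.1.1 z.2 ∧ Y.Adj z.1.2 z.2) ≤
      cnt (fun z : (Fin n × Fin n) × Fin n => X.Adj z.1.1 z.1.2 ∧ X.Adj z.2 z.1.1 ∧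
        X.Adj z.2 z.1.2 ∧ C (σ z.2 z.1.1) (σ z.2 z.1.2)) := by
    refine cnt_le_of_injOn
      (fun z => (((σ z.2).symm z.1.1, (σ z.2).symm z.1.2), z.2)) ?_ ?_
    · rintro z ⟨hz, h1, h2⟩
      refine ⟨(h.link_symm h1.symm h2.symm).1 hz.1, (h.adj_symm _ _).1 h1.symm,
        (h.adj_symm _ _).1 h2.symm, ?_⟩
      simpa using hz
    · rintro ⟨⟨a, b⟩, c⟩ ⟨⟨a', b'⟩, c'⟩ _ _ e
      simp only [Prod.mk.injEq] at e
      obtain ⟨⟨e1, e2⟩, e3⟩ := e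
      subst e3
      rw [(σ c).symm.injective e1, (σ c).symm.injective e2]
  have s3 : cnt (fun z : (Fin n × Fin n) × Fin n => X.Adj z.1.1 z.1.2 ∧ X.Adj z.2 z.1.1 ∧
        X.Adj z.2 z.1.2 ∧ C (σ z.2 z.1.1) (σ z.2 z.1.2)) ≤
      ∑ x : Fin n × Fin n, (2 * d * ind (X.Adj x.1 x.2 ∧ η * d ≤
        cnt (fun w => X.Adj w x.1 ∧ X.Adj w x.2 ∧ C (σ w x.1) (σ w x.2))) +
        η * d * ind (X.Adj x.1 x.2)) := by
    rw [cnt_prod (fun (x : Fin n × Fin n) w => X.Adj x.1 x.2 ∧ X.Adj w x.1 ∧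
        X.Adj w x.2 ∧ C (σ w x.1) (σ w x.2))]
    refine sum_le_sum fun x _ => ?_
    have hηd : 0 ≤ η * d := by positivity
    by_cases hx : X.Adj x.1 x.2
    · have e1 : cnt (fun w => X.Adj x.1 x.2 ∧ X.Adj w x.1 ∧ X.Adj w x.2 ∧
          C (σ w x.1) (σ w x.2)) =
          cnt (fun w => X.Adj w x.1 ∧ X.Adj w x.2 ∧ C (σ w x.1) (σ w x.2)) :=
        cnt_congr fun w => by tauto
      rw [e1, ind_pos hx]
      by_cases hc : η * d ≤ cnt (fun w => X.Adj w x.1 ∧ X.Adj w x.2 ∧ C (σ w x.1) (σ w x.2))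
      · rw [ind_pos ⟨hx, hc⟩]
        have : cnt (fun w => X.Adj w x.1 ∧ X.Adj w x.2 ∧ C (σ w x.1) (σ w x.2)) ≤ 2 * d :=
          (cnt_mono fun w hw => ⟨hw.1.symm, hw.2.1.symm⟩).trans (hcod x.1 x.2 hx.ne)
        linarith
      · rw [ind_neg fun hh => hc hh.2]
        push Not at hc
        linarith
    · rw [ind_neg hx, ind_neg fun hh => hx hh.1]
      refine le_of_eq ?_
      rw [cnt_false fun w hw => hx hw.1]
      ring
  have s4 : cnt (fun x : Fin n × Fin n => X.Adj x.1 x.2) ≤ n * (2 * D) := by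
    rw [cnt_prod (fun i j => X.Adj i j)]
    calc ∑ i, cnt (fun j => X.Adj i j) ≤ ∑ _i : Fin n, 2 * D := sum_le_sum fun i _ => hdeg i
      _ = n * (2 * D) := by simp
  rw [sum_add_distrib, ← mul_sum, ← mul_sum] at s3
  change _ ≤ 2 * d * cnt (fun x : Fin n × Fin n => X.Adj x.1 x.2 ∧ η * d ≤
        cnt (fun w => X.Adj w x.1 ∧ X.Adj w x.2 ∧ C (σ w x.1) (σ w x.2))) +
        η * d * cnt (fun x : Fin n × Fin n => X.Adj x.1 x.2) at s3
  have s5 : η * d * cnt (fun x : Fin n × Fin n => X.Adj x.1 x.2) ≤ η * d * (n * (2 * D)) :=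
    mul_le_mul_of_nonneg_left s4 (by positivity)
  refine le_of_mul_le_mul_left (a := 2 * d) ?_ (by positivity)
  linarith

open scoped Classical in
/-- If many edges of `Y` are contested, then the values of `σ i` on the neighbours of `i`, for only
`s` vertices `i`, already exhibit many edges of `X` with twins. A sequence of vertices that hits the
relevant sets of size at least `η * d` contains, for every popular edge of `X`, some `i` such that
`σ i` sends it to a contested edge, and then some `i'` which sees that edge as the image of a
different pair. -/
lemma Matches.exists_twins (h : Matches X Y σ) {D d η : ℝ} (hn : 0 < n) (hd : 0 < d) (hη : 0 ≤ η)
    (hdeg : ∀ i, cnt (fun j => X.Adj i j) ≤ 2 * D)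
    (hcod : ∀ i j, i ≠ j → cnt (fun w => X.Adj i w ∧ X.Adj j w) ≤ 2 * d)
    (hcod' : ∀ i j, i ≠ j → d / 2 ≤ cnt (fun w => X.Adj i w ∧ X.Adj j w))
    (s : ℕ) (hs : ((n : ℝ) ^ 3 + n ^ 2) * Real.exp (-(s * (η * d) / n)) < 1) :
    ∃ T : Finset (Fin n × Fin n × Fin n), (#T : ℝ) ≤ s * (2 * D) ∧
      (∀ e ∈ twinned T, e ∈ X.edgeSet ↔ twin T e ∈ X.edgeSet) ∧
      cnt (fun x : Fin n × Fin n => Contested Y σ (η * d) x.1 x.2) / 4 - η * (n * D) ≤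
        2 * #{e ∈ twinned T | e ∈ X.edgeSet} := by
  set C := Contested Y σ (η * d) with hC
  obtain ⟨hit, hhit⟩ := exists_hitting (n := n) (κ := (Fin n × Fin n × Fin n) ⊕ (Fin n × Fin n))
    (Sum.elim
      (fun x w' => Y.Adj x.1 w' ∧ Y.Adj x.2.1 w' ∧ s((σ w').symm x.1, (σ w').symm x.2.1) ≠
        s((σ x.2.2).symm x.1, (σ x.2.2).symm x.2.1))
      (fun x w => X.Adj w x.1 ∧ X.Adj w x.2 ∧ C (σ w x.1) (σ w x.2)))
    (t := η * d) s hn (by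
      simp only [Fintype.card_sum, Fintype.card_prod, Fintype.card_fin]
      push_cast
      convert hs using 2
      ring)
  set T : Finset (Fin n × Fin n × Fin n) :=
    {x | (∃ a, hit a = x.1) ∧ X.Adj x.1 x.2.1 ∧ σ x.1 x.2.1 = x.2.2} with hT
  have hTX : ∀ x ∈ T, X.Adj x.1 x.2.1 ∧ σ x.1 x.2.1 = x.2.2 := by
    intro x hx
    simp only [hT, mem_filter, mem_univ, true_and] at hx
    exact hx.2
  refine ⟨T, ?_, fun e he => h.twin_iff hTX (twin_spec he).2, ?_⟩
  · have h1 : T ⊆ (univ : Finset (Fin s)).biUnion fun a =>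
        ({j | X.Adj (hit a) j} : Finset (Fin n)).image fun j => (hit a, j, σ (hit a) j) := by
      rintro ⟨i, j, J⟩ hx
      simp only [hT, mem_filter, mem_univ, true_and] at hx
      obtain ⟨⟨a, rfl⟩, h1, rfl⟩ := hx
      simp only [mem_biUnion, mem_univ, true_and, mem_image, mem_filter]
      exact ⟨a, j, h1, rfl⟩
    have h2 : (#T : ℝ) ≤ ∑ a : Fin s, (#{j | X.Adj (hit a) j} : ℝ) := by
      have := (card_le_card h1).trans (card_biUnion_le.trans (sum_le_sum fun a _ => card_image_le))
      exact_mod_cast this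
    refine h2.trans ?_
    calc ∑ a : Fin s, (#{j | X.Adj (hit a) j} : ℝ) ≤ ∑ _a : Fin s, 2 * D := by
          refine sum_le_sum fun a _ => ?_
          rw [← cnt_eq_card]; exact hdeg _
      _ = s * (2 * D) := by simp
  · refine (h.card_popular hd hη hdeg hcod hcod').trans ?_
    have hmem : ∀ x : Fin n × Fin n, X.Adj x.1 x.2 ∧ η * d ≤
        cnt (fun w => X.Adj w x.1 ∧ X.Adj w x.2 ∧ C (σ w x.1) (σ w x.2)) →
        s(x.1, x.2) ∈ twinned T ∧ s(x.1, x.2) ∈ X.edgeSet := by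
      rintro ⟨j, k⟩ ⟨hjk, hpop⟩
      refine ⟨?_, hjk⟩
      obtain ⟨a, ha⟩ := hhit (Sum.inr (j, k)) hpop
      simp only [Sum.elim_inr] at ha
      obtain ⟨a1, a2, a3⟩ := ha
      obtain ⟨b, hb⟩ := hhit (Sum.inl (σ (hit a) j, σ (hit a) k, hit a)) (a3.2 _)
      simp only [Sum.elim_inl, Equiv.symm_apply_apply] at hb
      obtain ⟨b1, b2, b3⟩ := hb
      simp only [twinned, mem_filter, mem_univ, true_and]
      refine ⟨_, b3, hit a, hit b, j, k, _, _, σ (hit a) j, σ (hit a) k, ?_, ?_, ?_, ?_, rfl, rfl⟩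
      · simp [hT, a1]
      · simp [hT, a2]
      · simp [hT, ← h.adj_symm, b1.symm]
      · simp [hT, ← h.adj_symm, b2.symm]
    have hlt : ∀ x : Fin n × Fin n, X.Adj x.1 x.2 → x.1 < x.2 ∨ x.2 < x.1 :=
      fun x hx => lt_or_gt_of_ne hx.ne
    refine (cnt_le_add (P := fun x : Fin n × Fin n => x.1 < x.2 ∧
        (s(x.1, x.2) ∈ twinned T ∧ s(x.1, x.2) ∈ X.edgeSet)) (Q := fun x => x.2 < x.1 ∧
        (s(x.1, x.2) ∈ twinned T ∧ s(x.1, x.2) ∈ X.edgeSet)) fun x hx => ?_).trans ?_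
    · rcases hlt x hx.1 with hh | hh
      · exact Or.inl ⟨hh, hmem x hx⟩
      · exact Or.inr ⟨hh, hmem x hx⟩
    · rw [← cnt_mem_and, two_mul]
      refine add_le_add (cnt_le_of_injOn (fun x => s(x.1, x.2)) (fun x hx => hx.2) ?_)
        (cnt_le_of_injOn (fun x => s(x.1, x.2)) (fun x hx => hx.2) ?_)
      · intro x y hx hy e
        rw [Sym2.eq_iff] at e
        rcases e with e | e
        · exact Prod.ext e.1 e.2
        · have h1 := hx.1; have h2 := hy.1
          rw [e.1, e.2] at h1
          exact absurd h1 (lt_asymm h2)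
      · intro x y hx hy e
        rw [Sym2.eq_iff] at e
        rcases e with e | e
        · exact Prod.ext e.1 e.2
        · have h1 := hx.1; have h2 := hy.1
          rw [e.1, e.2] at h1
          exact absurd h1 (lt_asymm h2)

end twins

section prob
open scoped Classical
variable {V : Type*} [Fintype V] (p : unitInterval)

/-- The maps `g` need not lower any rank here: the pairs for which `g` lowers an arbitrary numbering
and those for which it raises it are treated separately, and one class contains at least
half of the edges. -/
lemma real_twins_le (D : Finset (Sym2 V)) (g : Sym2 V → Sym2 V) (hg : ∀ e ∈ D, g e ≠ e) (R : ℕ) :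
    (SimpleGraph.binomialRandom V p).real
      {G | (∀ e ∈ D, e ∈ G.edgeSet ↔ g e ∈ G.edgeSet) ∧ 2 * R ≤ #{e ∈ D | e ∈ G.edgeSet}} ≤
      2 * (p : ℝ) ^ R := by
  set r : Sym2 V → ℕ := fun e => Fintype.equivFin (Sym2 V) e with hr
  have hrinj : ∀ e e', r e = r e' → e = e' := fun e e' h =>
    (Fintype.equivFin (Sym2 V)).injective (Fin.ext h)
  set N := Fintype.card (Sym2 V)
  have hrN : ∀ e, r e < N := fun e => (Fintype.equivFin (Sym2 V) e).2
  have h1 := real_determined_le p ({e ∈ D | r (g e) < r e}) r g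
    (fun e he => (mem_filter.1 he).2) R
  have h2 := real_determined_le p ({e ∈ D | ¬ r (g e) < r e}) (fun e => N - r e) g
    (fun e he => by
      have := (mem_filter.1 he).2
      have h3 := hg e (mem_filter.1 he).1
      have h4 : r (g e) ≠ r e := fun hh => h3 (hrinj _ _ hh)
      have := hrN e
      have := hrN (g e)
      omega) R
  rw [two_mul ((p : ℝ) ^ R)]
  refine le_trans (MeasureTheory.measureReal_mono ?_ (MeasureTheory.measure_ne_top _ _))
    ((MeasureTheory.measureReal_union_le _ _).trans (add_le_add h1 h2))
  intro G hG
  obtain ⟨hG1, hG2⟩ := hG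
  have e1 : #{e ∈ D | e ∈ G.edgeSet} ≤ #{e ∈ {e ∈ D | r (g e) < r e} | e ∈ G.edgeSet} +
      #{e ∈ {e ∈ D | ¬ r (g e) < r e} | e ∈ G.edgeSet} := by
    refine le_trans (card_le_card fun e he => ?_) (card_union_le _ _)
    simp only [mem_union, mem_filter] at he ⊢
    tauto
  by_cases hc : R ≤ #{e ∈ {e ∈ D | r (g e) < r e} | e ∈ G.edgeSet}
  · exact Or.inl ⟨fun e he => hG1 e (mem_filter.1 he).1, hc⟩
  · exact Or.inr ⟨fun e he => hG1 e (mem_filter.1 he).1, by omega⟩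

end prob

/-! ### Typical properties of the random graph: degrees and codegrees -/

section tails
variable {V : Type*} [Fintype V] (p : unitInterval)

open MeasureTheory

lemma real_mono {S T : Set (SimpleGraph V)} (h : ∀ G, G ∈ S → G ∈ T) :
    (SimpleGraph.binomialRandom V p).real S ≤ (SimpleGraph.binomialRandom V p).real T :=
  measureReal_mono h (measure_ne_top _ _)

lemma real_exists_le {κ : Type*} [Fintype κ] (S : κ → Set (SimpleGraph V)) {b : ℝ}
    (hb : ∀ k, (SimpleGraph.binomialRandom V p).real (S k) ≤ b) :
    (SimpleGraph.binomialRandom V p).real {G | ∃ k, G ∈ S k} ≤ Fintype.card κ * b := by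
  have := real_union_le p (univ : Finset κ) S {G | ∃ k, G ∈ S k}
    (fun G hG => by simpa using hG) (fun k _ => hb k)
  rwa [card_univ] at this

variable {κ : Type*} [Fintype κ] (Λ : Finset κ) (s : κ → Finset (Sym2 V)) (h : ℕ)

lemma real_le_count_le
    (hs : ∀ l ∈ Λ, ∀ e ∈ s l, ¬ e.IsDiag) (hc : ∀ l ∈ Λ, #(s l) = h)
    (hd : ∀ l ∈ Λ, ∀ l' ∈ Λ, l ≠ l' → Disjoint (s l) (s l')) {t : ℝ} (ht0 : 0 < t) (ht : t ≤ 1)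
    (R : ℝ) :
    (SimpleGraph.binomialRandom V p).real
        {G | R ≤ cnt (fun l => l ∈ Λ ∧ ∀ e ∈ s l, e ∈ G.edgeSet)} ≤
      Real.exp (#Λ * (p : ℝ) ^ h * (t + t ^ 2) - t * R) := by
  classical
  refine le_trans (real_mono p fun G hG => ?_)
    (real_chernoff p Λ s h hs hc hd (t := t) (by rw [abs_of_pos ht0]; exact ht) R)
  have hG' : R ≤ cnt (fun l => l ∈ Λ ∧ ∀ e ∈ s l, e ∈ G.edgeSet) := hG
  rw [cnt_mem_and] at hG'
  have := mul_le_mul_of_nonneg_left hG' ht0.le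
  simp only [Set.mem_ofPred_eq]
  convert this using 4

lemma real_count_le_le
    (hs : ∀ l ∈ Λ, ∀ e ∈ s l, ¬ e.IsDiag) (hc : ∀ l ∈ Λ, #(s l) = h)
    (hd : ∀ l ∈ Λ, ∀ l' ∈ Λ, l ≠ l' → Disjoint (s l) (s l')) {t : ℝ} (ht0 : 0 < t) (ht : t ≤ 1)
    (R : ℝ) :
    (SimpleGraph.binomialRandom V p).real
        {G | cnt (fun l => l ∈ Λ ∧ ∀ e ∈ s l, e ∈ G.edgeSet) ≤ R} ≤
      Real.exp (#Λ * (p : ℝ) ^ h * (-t + t ^ 2) + t * R) := by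
  classical
  have key := real_chernoff p Λ s h hs hc hd (t := -t) (by rw [abs_neg, abs_of_pos ht0]; exact ht) R
  rw [neg_mul, sub_neg_eq_add, neg_sq] at key
  refine le_trans (real_mono p fun G hG => ?_) key
  have hG' : cnt (fun l => l ∈ Λ ∧ ∀ e ∈ s l, e ∈ G.edgeSet) ≤ R := hG
  rw [cnt_mem_and] at hG'
  have := mul_le_mul_of_nonneg_left hG' ht0.le
  simp only [Set.mem_ofPred_eq, neg_mul]
  refine neg_le_neg (le_trans (le_of_eq ?_) this)
  congr 3

end tails

/-- The range of parameters: `L = log n`, and the typical codegree `n * p ^ 2` is at least `L ^ 4`.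
The bound on `L` is far from optimal. -/
structure Dense (n : ℕ) (p L : ℝ) : Prop where
  exp_eq : Real.exp L = n
  large : 10 ^ 30 ≤ L
  pos : 0 < p
  le : p ≤ 1 / 10 ^ 8
  dense : L ^ 4 ≤ n * p ^ 2

section regime
variable {n : ℕ} {p L : ℝ}

lemma Dense.codeg_le_deg (h : Dense n p L) : (n : ℝ) * p ^ 2 ≤ n * p := by
  have := h.pos; have := h.le
  have : p ^ 2 ≤ p := by nlinarith
  gcongr

lemma Dense.sq_le (h : Dense n p L) : 10 ^ 60 * L ^ 2 ≤ n * p ^ 2 := by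
  have h1 := h.dense
  have h2 := h.large
  have : (10 ^ 30 : ℝ) ^ 2 ≤ L ^ 2 := pow_le_pow_left₀ (by norm_num) h2 2
  nlinarith [sq_nonneg L]

lemma Dense.sq_large (h : Dense n p L) : 10 ^ 30 * L ≤ L ^ 2 := by
  have := h.large
  nlinarith

lemma Dense.codeg_large (h : Dense n p L) : 10 ^ 100 ≤ (n : ℝ) * p ^ 2 := by
  have h1 := h.sq_le
  have h2 := h.large
  have : (10 ^ 30 : ℝ) ^ 2 ≤ L ^ 2 := pow_le_pow_left₀ (by norm_num) h2 2
  linarith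

lemma Dense.card_large (h : Dense n p L) : 10 ^ 100 ≤ (n : ℝ) := by
  have h1 := h.codeg_large
  have h2 := h.pos
  have h3 := h.le
  have : p ^ 2 ≤ 1 := pow_le_one₀ h2.le (by linarith)
  have hn : (0 : ℝ) ≤ n := Nat.cast_nonneg _
  nlinarith

/-- Failure probabilities `exp (-(c * (n * p ^ 2)))` survive a union bound over triples of
vertices. -/
lemma Dense.exp_small (h : Dense n p L) {c : ℝ} (hc : 1 / 10 ^ 20 ≤ c) :
    (n : ℝ) ^ 3 * Real.exp (-(c * (n * p ^ 2))) ≤ Real.exp (-(2 * L ^ 2)) := by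
  rw [← h.exp_eq, ← Real.exp_nat_mul, ← Real.exp_add, h.exp_eq]
  apply Real.exp_le_exp.2
  have h1 := h.sq_le
  have h2 := h.sq_large
  have h3 := h.large
  have h4 : 0 ≤ (n : ℝ) * p ^ 2 := by positivity
  have h5 : 1 / 10 ^ 20 * (n * p ^ 2) ≤ c * (n * p ^ 2) := mul_le_mul_of_nonneg_right hc h4
  push_cast
  linarith

end regime

section typical
variable {n : ℕ} {p : unitInterval} {L : ℝ}

lemma prob_deg_le (h : Dense n p L) : (SimpleGraph.binomialRandom (Fin n) p).real
    {X | ∃ i, 2 * ((n : ℝ) * p) ≤ cnt (fun j => X.Adj i j)} ≤ Real.exp (-(2 * L ^ 2)) := by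
  classical
  have hD := h.codeg_le_deg
  have hp := h.pos
  refine (real_exists_le p (fun i => {X | 2 * ((n : ℝ) * p) ≤ cnt (fun j => X.Adj i j)})
    (b := Real.exp (-(1 / 4 * (n * (p : ℝ) ^ 2)))) fun i => ?_).trans ?_
  · refine le_trans (real_mono p fun X hX => ?_) ((real_le_count_le p (univ.erase i)
      (fun j => {s(i, j)}) 1 ?_ ?_ ?_ (t := 1 / 2) (by norm_num) (by norm_num)
        (2 * ((n : ℝ) * p))).trans ?_)
    · refine le_trans (show _ ≤ _ from hX) (cnt_mono fun j hj => ?_)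
      simpa using ⟨hj.ne', hj⟩
    · intro j hj e he
      rw [mem_singleton] at he
      subst he
      simpa using (ne_of_mem_erase hj).symm
    · simp
    · intro j _ k _ hjk
      simp only [disjoint_singleton, ne_eq, Sym2.congr_right]
      exact hjk
    · apply Real.exp_le_exp.2
      have : (#(univ.erase i) : ℝ) ≤ n := by
        have := card_le_univ (univ.erase i)
        rw [Fintype.card_fin] at this
        exact_mod_cast this
      have h2 := mul_le_mul_of_nonneg_right this hp.le
      rw [pow_one]
      linarith
  · have h1 := h.exp_small (c := 1 / 4) (by norm_num)
    have hn : (1 : ℝ) ≤ n := by have := h.card_large; linarith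
    rw [Fintype.card_fin]
    refine le_trans (mul_le_mul_of_nonneg_right ?_ (Real.exp_pos _).le) h1
    exact le_self_pow₀ hn (by norm_num)

lemma prob_le_deg (h : Dense n p L) : (SimpleGraph.binomialRandom (Fin n) p).real
    {X | ∃ i, cnt (fun j => X.Adj i j) ≤ (n : ℝ) * p / 2} ≤ Real.exp (-(2 * L ^ 2)) := by
  classical
  have hD := h.codeg_le_deg
  have hp := h.pos
  refine (real_exists_le p (fun i => {X | cnt (fun j => X.Adj i j) ≤ (n : ℝ) * p / 2})
    (b := Real.exp (-(1 / 32 * (n * (p : ℝ) ^ 2)))) fun i => ?_).trans ?_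
  · refine le_trans (real_mono p fun X hX => ?_) ((real_count_le_le p (univ.erase i)
      (fun j => {s(i, j)}) 1 ?_ ?_ ?_ (t := 1 / 4) (by norm_num) (by norm_num)
        ((n : ℝ) * p / 2)).trans ?_)
    · refine le_trans (cnt_mono fun j hj => ?_) (show _ ≤ _ from hX)
      simpa using hj.2
    · intro j hj e he
      rw [mem_singleton] at he
      subst he
      simpa using (ne_of_mem_erase hj).symm
    · simp
    · intro j _ k _ hjk
      simp only [disjoint_singleton, ne_eq, Sym2.congr_right]
      exact hjk
    · apply Real.exp_le_exp.2
      have h1 : (#(univ.erase i) : ℝ) = n - 1 := by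
        rw [card_erase_of_mem (mem_univ _), card_univ, Fintype.card_fin,
          Nat.cast_sub (Fin.pos i), Nat.cast_one]
      have hn := h.card_large
      have h2 : 9 / 10 * (n * (p : ℝ)) ≤ (n - 1) * p := by nlinarith
      rw [h1, pow_one]
      linarith
  · have h1 := h.exp_small (c := 1 / 32) (by norm_num)
    have hn : (1 : ℝ) ≤ n := by have := h.card_large; linarith
    rw [Fintype.card_fin]
    refine le_trans (mul_le_mul_of_nonneg_right ?_ (Real.exp_pos _).le) h1
    exact le_self_pow₀ hn (by norm_num)

lemma pair_slots_disjoint {i j w w' : Fin n} (hw : w ≠ w') (hwi' : w' ≠ i) (hwj' : w' ≠ j) :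
    Disjoint ({s(i, w), s(j, w)} : Finset (Sym2 (Fin n))) {s(i, w'), s(j, w')} := by
  rw [Finset.disjoint_left]
  intro e he he'
  have h1 : w' ∈ e := by
    simp only [mem_insert, mem_singleton] at he'
    rcases he' with rfl | rfl <;> simp
  simp only [mem_insert, mem_singleton] at he
  rcases he with rfl | rfl <;> simp only [Sym2.mem_iff] at h1 <;>
    rcases h1 with h1 | h1
  · exact hwi' h1
  · exact hw h1.symm
  · exact hwj' h1
  · exact hw h1.symm

lemma prob_codeg_le (h : Dense n p L) : (SimpleGraph.binomialRandom (Fin n) p).real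
    {X | ∃ x : Fin n × Fin n, x.1 ≠ x.2 ∧ (1 + 1 / 10000) * ((n : ℝ) * p ^ 2) ≤
      cnt (fun w => X.Adj x.1 w ∧ X.Adj x.2 w)} ≤ Real.exp (-(2 * L ^ 2)) := by
  classical
  have hp := h.pos
  refine (real_exists_le p (fun x : Fin n × Fin n => {X | x.1 ≠ x.2 ∧
    (1 + 1 / 10000) * ((n : ℝ) * p ^ 2) ≤ cnt (fun w => X.Adj x.1 w ∧ X.Adj x.2 w)})
    (b := Real.exp (-(1 / 10 ^ 10 * (n * (p : ℝ) ^ 2)))) fun x => ?_).trans ?_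
  · by_cases hx : x.1 = x.2
    · refine le_trans (le_of_eq ?_) (Real.exp_pos _).le
      simp [hx]
    refine le_trans (real_mono p fun X hX => ?_) ((real_le_count_le p ((univ.erase x.1).erase x.2)
      (fun w => {s(x.1, w), s(x.2, w)}) 2 ?_ ?_ ?_ (t := 1 / 20000) (by norm_num) (by norm_num)
        ((1 + 1 / 10000) * ((n : ℝ) * p ^ 2))).trans ?_)
    · refine le_trans (show _ ≤ _ from hX.2) (cnt_mono fun w hw => ?_)
      simpa using ⟨⟨hw.2.ne', hw.1.ne'⟩, hw⟩
    · intro w hw e he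
      simp only [mem_erase, mem_univ, and_true] at hw
      simp only [mem_insert, mem_singleton] at he
      rcases he with rfl | rfl
      · simpa using Ne.symm hw.2
      · simpa using Ne.symm hw.1
    · intro w hw
      rw [card_pair]
      rw [Ne, Sym2.congr_left]
      exact hx
    · intro w _ w' hw' hne
      simp only [mem_erase, mem_univ, and_true] at hw'
      exact pair_slots_disjoint hne hw'.2 hw'.1
    · apply Real.exp_le_exp.2
      have : (#((univ.erase x.1).erase x.2) : ℝ) ≤ n := by
        have := card_le_univ ((univ.erase x.1).erase x.2)
        rw [Fintype.card_fin] at this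
        exact_mod_cast this
      have hp2 : 0 ≤ (p : ℝ) ^ 2 := by positivity
      have h2 := mul_le_mul_of_nonneg_right this hp2
      have h3 : 0 ≤ (n : ℝ) * (p : ℝ) ^ 2 := by positivity
      linarith
  · have h1 := h.exp_small (c := 1 / 10 ^ 10) (by norm_num)
    have hn : (1 : ℝ) ≤ n := by have := h.card_large; linarith
    rw [Fintype.card_prod, Fintype.card_fin]
    refine le_trans (mul_le_mul_of_nonneg_right ?_ (Real.exp_pos _).le) h1
    push_cast
    nlinarith [pow_pos (by linarith : (0 : ℝ) < n) 2]

lemma prob_le_codeg (h : Dense n p L) : (SimpleGraph.binomialRandom (Fin n) p).real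
    {X | ∃ x : Fin n × Fin n, x.1 ≠ x.2 ∧ cnt (fun w => X.Adj x.1 w ∧ X.Adj x.2 w) ≤
      (1 - 1 / 10000) * ((n : ℝ) * p ^ 2)} ≤ Real.exp (-(2 * L ^ 2)) := by
  classical
  have hp := h.pos
  refine (real_exists_le p (fun x : Fin n × Fin n => {X | x.1 ≠ x.2 ∧
    cnt (fun w => X.Adj x.1 w ∧ X.Adj x.2 w) ≤ (1 - 1 / 10000) * ((n : ℝ) * p ^ 2)})
    (b := Real.exp (-(1 / 10 ^ 10 * (n * (p : ℝ) ^ 2)))) fun x => ?_).trans ?_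
  · by_cases hx : x.1 = x.2
    · refine le_trans (le_of_eq ?_) (Real.exp_pos _).le
      simp [hx]
    refine le_trans (real_mono p fun X hX => ?_) ((real_count_le_le p ((univ.erase x.1).erase x.2)
      (fun w => {s(x.1, w), s(x.2, w)}) 2 ?_ ?_ ?_ (t := 1 / 40000) (by norm_num) (by norm_num)
        ((1 - 1 / 10000) * ((n : ℝ) * p ^ 2))).trans ?_)
    · refine le_trans (cnt_mono fun w hw => ?_) (show _ ≤ _ from hX.2)
      have := hw.2
      simpa using this
    · intro w hw e he
      simp only [mem_erase, mem_univ, and_true] at hw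
      simp only [mem_insert, mem_singleton] at he
      rcases he with rfl | rfl
      · simpa using Ne.symm hw.2
      · simpa using Ne.symm hw.1
    · intro w hw
      rw [card_pair]
      rw [Ne, Sym2.congr_left]
      exact hx
    · intro w _ w' hw' hne
      simp only [mem_erase, mem_univ, and_true] at hw'
      exact pair_slots_disjoint hne hw'.2 hw'.1
    · apply Real.exp_le_exp.2
      have h1 : (n : ℝ) - 2 ≤ #((univ.erase x.1).erase x.2) := by
        have e1 := pred_card_le_card_erase (s := univ.erase x.1) (a := x.2)
        have e2 := pred_card_le_card_erase (s := (univ : Finset (Fin n))) (a := x.1)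
        rw [card_univ, Fintype.card_fin] at e2
        have : n ≤ #((univ.erase x.1).erase x.2) + 2 := by omega
        have : (n : ℝ) ≤ #((univ.erase x.1).erase x.2) + 2 := by exact_mod_cast this
        linarith
      have hn := h.card_large
      have hp2 : 0 ≤ (p : ℝ) ^ 2 := by positivity
      have h2 := mul_le_mul_of_nonneg_right h1 hp2
      have h4 : (1 - 1 / 40000) * (n * (p : ℝ) ^ 2) ≤ (n - 2) * (p : ℝ) ^ 2 := by
        nlinarith
      have h3 : 0 ≤ (n : ℝ) * (p : ℝ) ^ 2 := by positivity
      linarith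
  · have h1 := h.exp_small (c := 1 / 10 ^ 10) (by norm_num)
    have hn : (1 : ℝ) ≤ n := by have := h.card_large; linarith
    rw [Fintype.card_prod, Fintype.card_fin]
    refine le_trans (mul_le_mul_of_nonneg_right ?_ (Real.exp_pos _).le) h1
    push_cast
    nlinarith [pow_pos (by linarith : (0 : ℝ) < n) 2]

lemma prob_codeg3_le (h : Dense n p L) : (SimpleGraph.binomialRandom (Fin n) p).real
    {X | ∃ x : Fin n × Fin n × Fin n, (x.1 ≠ x.2.1 ∧ x.1 ≠ x.2.2 ∧ x.2.1 ≠ x.2.2) ∧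
      1 / 10000 * ((n : ℝ) * p ^ 2) ≤
      cnt (fun w => X.Adj x.1 w ∧ X.Adj x.2.1 w ∧ X.Adj x.2.2 w)} ≤ Real.exp (-(2 * L ^ 2)) := by
  classical
  have hp := h.pos
  refine (real_exists_le p (fun x : Fin n × Fin n × Fin n =>
    {X | (x.1 ≠ x.2.1 ∧ x.1 ≠ x.2.2 ∧ x.2.1 ≠ x.2.2) ∧
      1 / 10000 * ((n : ℝ) * p ^ 2) ≤
      cnt (fun w => X.Adj x.1 w ∧ X.Adj x.2.1 w ∧ X.Adj x.2.2 w)})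
    (b := Real.exp (-(1 / 20000 * (n * (p : ℝ) ^ 2)))) fun x => ?_).trans ?_
  · obtain ⟨i, j, k⟩ := x
    by_cases hx : i ≠ j ∧ i ≠ k ∧ j ≠ k
    swap
    · refine le_trans (le_of_eq ?_) (Real.exp_pos _).le
      simp [hx]
    obtain ⟨hij, hik, hjk⟩ := hx
    refine le_trans (real_mono p fun X hX => ?_)
      ((real_le_count_le p (((univ.erase i).erase j).erase k)
      (fun w => {s(i, w), s(j, w), s(k, w)}) 3 ?_ ?_ ?_ (t := 1) (by norm_num) (by norm_num)
        (1 / 10000 * ((n : ℝ) * p ^ 2))).trans ?_)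
    · refine le_trans (show _ ≤ _ from hX.2) (cnt_mono fun w hw => ?_)
      simpa using ⟨⟨hw.2.2.ne', hw.2.1.ne', hw.1.ne'⟩, hw⟩
    · intro w hw e he
      simp only [mem_erase, mem_univ, and_true] at hw
      simp only [mem_insert, mem_singleton] at he
      rcases he with rfl | rfl | rfl
      · simpa using Ne.symm hw.2.2
      · simpa using Ne.symm hw.2.1
      · simpa using Ne.symm hw.1
    · intro w hw
      rw [card_eq_three]
      refine ⟨_, _, _, ?_, ?_, ?_, rfl⟩ <;> rw [Ne, Sym2.congr_left] <;> assumption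
    · intro w _ w' hw' hne
      simp only [mem_erase, mem_univ, and_true] at hw'
      rw [Finset.disjoint_left]
      intro e he he'
      have h1 : w' ∈ e := by
        simp only [mem_insert, mem_singleton] at he'
        rcases he' with rfl | rfl | rfl <;> simp
      simp only [mem_insert, mem_singleton] at he
      rcases he with rfl | rfl | rfl <;> simp only [Sym2.mem_iff] at h1 <;>
        rcases h1 with h1 | h1
      · exact hw'.2.2 h1
      · exact hne h1.symm
      · exact hw'.2.1 h1
      · exact hne h1.symm
      · exact hw'.1 h1
      · exact hne h1.symm
    · apply Real.exp_le_exp.2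
      have : (#(((univ.erase i).erase j).erase k) : ℝ) ≤ n := by
        have := card_le_univ (((univ.erase i).erase j).erase k)
        rw [Fintype.card_fin] at this
        exact_mod_cast this
      have h2 := mul_le_mul_of_nonneg_right this (show 0 ≤ (p : ℝ) ^ 3 by positivity)
      have h3 : (n : ℝ) * (p : ℝ) ^ 3 ≤ 1 / 10 ^ 8 * (n * (p : ℝ) ^ 2) := by
        have := mul_le_mul_of_nonneg_right h.le (show 0 ≤ (n : ℝ) * (p : ℝ) ^ 2 by positivity)
        calc (n : ℝ) * (p : ℝ) ^ 3 = p * (n * (p : ℝ) ^ 2) := by ring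
          _ ≤ _ := this
      have h4 : 0 ≤ (n : ℝ) * (p : ℝ) ^ 2 := by positivity
      linarith
  · have h1 := h.exp_small (c := 1 / 20000) (by norm_num)
    rw [Fintype.card_prod, Fintype.card_prod, Fintype.card_fin]
    refine le_trans (mul_le_mul_of_nonneg_right ?_ (Real.exp_pos _).le) h1
    push_cast
    exact le_of_eq (by ring)

end typical

/-! ### Typical properties: edges inside and between sets -/

section ordered
variable {α : Type*} [Fintype α] [LinearOrder α] {W : α × α → Prop}

lemma cnt_lt_eq_cnt_gt (hW : ∀ x, W x → W x.swap) :
    cnt (fun x => W x ∧ x.1 < x.2) = cnt (fun x => W x ∧ x.2 < x.1) :=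
  le_antisymm
    (cnt_le_of_injOn Prod.swap (fun x hx => ⟨hW x hx.1, hx.2⟩)
      fun _ _ _ _ h => Prod.swap_injective h)
    (cnt_le_of_injOn Prod.swap (fun x hx => ⟨hW x hx.1, hx.2⟩)
      fun _ _ _ _ h => Prod.swap_injective h)

lemma two_mul_cnt_lt_le (hW : ∀ x, W x → W x.swap) :
    2 * cnt (fun x => W x ∧ x.1 < x.2) ≤ cnt W := by
  have := cnt_add_le (P := fun x => W x ∧ x.1 < x.2) (Q := fun x => W x ∧ x.2 < x.1) (R := W)
    (fun a h => h.1) (fun a h => h.1) (fun a h h' => lt_asymm h.2 h'.2)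
  rw [← cnt_lt_eq_cnt_gt hW] at this
  linarith

lemma cnt_le_two_mul_cnt_lt (hW : ∀ x, W x → W x.swap) (hne : ∀ x, W x → x.1 ≠ x.2) :
    cnt W ≤ 2 * cnt (fun x => W x ∧ x.1 < x.2) := by
  have := cnt_le_add (P := fun x => W x ∧ x.1 < x.2) (Q := fun x => W x ∧ x.2 < x.1) (R := W)
    (fun a h => (lt_or_gt_of_ne (hne a h)).imp (fun h' => ⟨h, h'⟩) (fun h' => ⟨h, h'⟩))
  rw [← cnt_lt_eq_cnt_gt hW] at this
  linarith

end ordered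

section typical
variable {n : ℕ} {p : unitInterval} {L : ℝ}

open scoped Classical in
/-- The number of edges inside a set of `m` vertices is at most about `m * (m * p + 4 * L ^ 2)`; the
second term pays for the choice of the set. Pairs are counted as ordered. -/
lemma prob_edges_le (h : Dense n p L) : (SimpleGraph.binomialRandom (Fin n) p).real
    {X | ∃ P : Fin n → Prop, 2 * cnt P * (cnt P * p + 4 * L ^ 2) <
      cnt (fun x : Fin n × Fin n => P x.1 ∧ P x.2 ∧ X.Adj x.1 x.2)} ≤
      Real.exp (-(2 * L ^ 2)) := by
  have hp := h.pos
  have hL := h.large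
  have hL2 := h.sq_large
  set S : Finset (Fin n) → Set (SimpleGraph (Fin n)) := fun M =>
    {X | (#M : ℝ) * (#M * p + 4 * L ^ 2) ≤
      cnt (fun x : Fin n × Fin n => x ∈ ({x ∈ M ×ˢ M | x.1 < x.2} : Finset (Fin n × Fin n)) ∧
        ∀ e ∈ ({s(x.1, x.2)} : Finset (Sym2 (Fin n))), e ∈ X.edgeSet)} with hS
  have hSM : ∀ M : Finset (Fin n), (SimpleGraph.binomialRandom (Fin n) p).real (S M) ≤
      Real.exp (-(4 * L ^ 2)) ^ #M := by
    intro M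
    refine (real_le_count_le p _ (fun x : Fin n × Fin n => {s(x.1, x.2)}) 1 ?_ ?_ ?_ (t := 1)
      (by norm_num) le_rfl _).trans ?_
    · intro x hx e he
      rw [mem_singleton] at he
      subst he
      simpa using (mem_filter.1 hx).2.ne
    · simp
    · intro x hx y hy hxy
      rw [disjoint_singleton, Ne, Sym2.eq_iff]
      rintro (⟨h1, h2⟩ | ⟨h1, h2⟩)
      · exact hxy (Prod.ext h1 h2)
      · have h3 := (mem_filter.1 hx).2
        have h4 := (mem_filter.1 hy).2
        rw [h1, h2] at h3
        exact lt_asymm h3 h4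
    · rw [← Real.exp_nat_mul]
      apply Real.exp_le_exp.2
      have h1 : 2 * (#({x ∈ M ×ˢ M | x.1 < x.2} : Finset (Fin n × Fin n)) : ℝ) ≤ #M * #M := by
        have h2 := two_mul_cnt_lt_le (W := fun x : Fin n × Fin n => x ∈ M ×ˢ M)
          (fun x hx => by simpa [and_comm] using hx)
        rw [cnt_mem_and, cnt_eq_card, filter_mem_eq_inter, univ_inter, card_product] at h2
        push_cast at h2
        exact h2
      have h2 := mul_le_mul_of_nonneg_right h1 hp.le
      rw [pow_one]
      linarith
  refine le_trans (real_mono p (T := {X | ∃ m : Fin (n + 1), X ∈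
    {X | ∃ M ∈ powersetCard m univ, m ≠ 0 ∧ X ∈ S M}}) fun X hX => ?_)
    ((real_exists_le p _ (b := Real.exp (-(3 * L ^ 2))) fun m => ?_).trans ?_)
  · obtain ⟨P, hP⟩ := hX
    set M : Finset (Fin n) := {a | P a} with hM
    have hPM : cnt P = #M := cnt_eq_card P
    refine ⟨⟨#M, Nat.lt_succ_of_le ((card_le_univ M).trans (by simp))⟩, M,
      mem_powersetCard.2 ⟨subset_univ _, rfl⟩, ?_, ?_⟩
    · intro h0
      have h0' : #M = 0 := by simpa using congrArg Fin.val h0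
      rw [hPM, h0', Nat.cast_zero, mul_zero, zero_mul] at hP
      refine absurd (cnt_false fun x hx => ?_) hP.ne'
      have : x.1 ∈ M := by simpa [hM] using hx.1
      rw [card_eq_zero.1 h0'] at this
      simp at this
    · have h1 := cnt_le_two_mul_cnt_lt
        (W := fun x : Fin n × Fin n => P x.1 ∧ P x.2 ∧ X.Adj x.1 x.2)
        (fun x hx => ⟨hx.2.1, hx.1, hx.2.2.symm⟩) (fun x hx => hx.2.2.ne)
      have h2 := cnt_mono (P := fun x : Fin n × Fin n => (P x.1 ∧ P x.2 ∧ X.Adj x.1 x.2) ∧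
        x.1 < x.2) (Q := fun x : Fin n × Fin n =>
          x ∈ ({x ∈ M ×ˢ M | x.1 < x.2} : Finset (Fin n × Fin n)) ∧
        ∀ e ∈ ({s(x.1, x.2)} : Finset (Sym2 (Fin n))), e ∈ X.edgeSet)
        (fun x hx => by simpa [hM] using ⟨⟨⟨hx.1.1, hx.1.2.1⟩, hx.2⟩, hx.1.2.2⟩)
      rw [hPM] at hP
      simp only [hS, Set.mem_ofPred_eq]
      linarith
  · rcases eq_or_ne m 0 with rfl | hm
    · refine le_trans (le_of_eq ?_) (Real.exp_pos _).le
      simp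
    refine (real_union_le p (powersetCard m univ) S
      {X | ∃ M ∈ powersetCard m univ, m ≠ 0 ∧ X ∈ S M} (fun X hX => ?_)
      (b := Real.exp (-(4 * L ^ 2)) ^ (m : ℕ)) fun M hM => ?_).trans ?_
    · obtain ⟨M, hM, -, hX⟩ := hX
      exact ⟨M, hM, hX⟩
    · rw [← (mem_powersetCard.1 hM).2]
      exact hSM M
    · have h1 : (#(powersetCard (m : ℕ) (univ : Finset (Fin n))) : ℝ) ≤ Real.exp L ^ (m : ℕ) := by
        rw [h.exp_eq, card_powersetCard, card_univ, Fintype.card_fin]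
        exact_mod_cast Nat.choose_le_pow _ _
      refine (mul_le_mul_of_nonneg_right h1 (by positivity)).trans ?_
      rw [← mul_pow, ← Real.exp_add, ← Real.exp_nat_mul]
      apply Real.exp_le_exp.2
      have hm1 : (1 : ℝ) ≤ (m : ℕ) := by
        have : (m : ℕ) ≠ 0 := fun h0 => hm (Fin.ext h0)
        exact_mod_cast Nat.one_le_iff_ne_zero.2 this
      nlinarith [mul_nonneg (sub_nonneg.2 hm1) (show 0 ≤ 4 * L ^ 2 - L by nlinarith)]
  · rw [Fintype.card_fin]
    have hn : ((n + 1 : ℕ) : ℝ) ≤ Real.exp L ^ 2 := by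
      have := h.card_large
      rw [h.exp_eq]
      push_cast
      nlinarith
    refine (mul_le_mul_of_nonneg_right hn (Real.exp_pos _).le).trans ?_
    rw [← Real.exp_nat_mul, ← Real.exp_add]
    apply Real.exp_le_exp.2
    push_cast
    linarith

/-- Any two sets of `3 * θ * D` vertices have many edges between them, where `D = n * p`. They need
not be disjoint, so disjoint subsets of size `⌈θ * D⌉` are chosen first. -/
lemma prob_expansion_le (h : Dense n p L) {θ : ℝ} (hθ : θ = 1 / 10 ^ 8) :
    (SimpleGraph.binomialRandom (Fin n) p).real
    {X | ∃ A B : Finset (Fin n), 3 * θ * (n * p) ≤ #A ∧ 3 * θ * (n * p) ≤ #B ∧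
      cnt (fun x : Fin n × Fin n => x ∈ A ×ˢ B ∧ X.Adj x.1 x.2) <
        θ ^ 2 / 2 * ((n * p) * (n * p ^ 2))} ≤ Real.exp (-(2 * L ^ 2)) := by
  classical
  have hp := h.pos
  have hd := h.codeg_large
  have hdD := h.codeg_le_deg
  set D : ℝ := n * p with hD
  set d : ℝ := n * (p : ℝ) ^ 2 with hd'
  have hdDp : d = D * p := by rw [hd', hD]; ring
  have hθ0 : 0 < θ := by rw [hθ]; norm_num
  set m : ℕ := ⌈θ * D⌉₊ with hm
  have hm1 : θ * D ≤ m := Nat.le_ceil _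
  have hm2 : (m : ℝ) < θ * D + 1 := Nat.ceil_lt_add_one (by positivity)
  have hθD : 10 ≤ θ * D := by rw [hθ]; linarith
  have hmd : θ * d ≤ m * p := by
    rw [hdDp, ← mul_assoc]
    exact mul_le_mul_of_nonneg_right hm1 hp.le
  set S : Finset (Fin n) × Finset (Fin n) → Set (SimpleGraph (Fin n)) := fun M =>
    {X | cnt (fun x : Fin n × Fin n => x ∈ M.1 ×ˢ M.2 ∧
        ∀ e ∈ ({s(x.1, x.2)} : Finset (Sym2 (Fin n))), e ∈ X.edgeSet) ≤
          θ ^ 2 / 2 * (D * d)} with hS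
  set T : Finset (Finset (Fin n) × Finset (Fin n)) :=
    {M ∈ powersetCard m univ ×ˢ powersetCard m univ | Disjoint M.1 M.2} with hT
  refine (real_union_le p T S _ (fun X hX => ?_)
    (b := Real.exp (-(1 / 16 * (m * m * p)))) fun M hM => ?_).trans ?_
  · obtain ⟨A, B, hA, hB, hX⟩ := hX
    obtain ⟨A', hA', hcA⟩ := exists_subset_card_eq (s := A) (n := m) (by
      have : (m : ℝ) ≤ #A := by linarith
      exact_mod_cast this)
    obtain ⟨B', hB', hcB⟩ := exists_subset_card_eq (s := B \ A') (n := m) (by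
      have h1 : #B ≤ #(B \ A') + #A' := card_le_card_sdiff_add_card
      rw [hcA] at h1
      have h1 : (#B : ℝ) ≤ #(B \ A') + m := by exact_mod_cast h1
      have : (m : ℝ) ≤ #(B \ A') := by linarith
      exact_mod_cast this)
    refine ⟨(A', B'), ?_, ?_⟩
    · simp only [hT, mem_filter, mem_product, mem_powersetCard]
      refine ⟨⟨⟨subset_univ _, hcA⟩, subset_univ _, hcB⟩, ?_⟩
      exact disjoint_of_subset_right hB' disjoint_sdiff
    · refine le_trans (cnt_mono fun x hx => ?_) hX.le
      have h1 := mem_product.1 hx.1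
      exact ⟨mem_product.2 ⟨hA' h1.1, (mem_sdiff.1 (hB' h1.2)).1⟩, by simpa using hx.2⟩
  · simp only [hT, mem_filter, mem_product, mem_powersetCard] at hM
    obtain ⟨⟨⟨-, hcA⟩, -, hcB⟩, hdis⟩ := hM
    rw [Finset.disjoint_left] at hdis
    refine (real_count_le_le p _ (fun x : Fin n × Fin n => {s(x.1, x.2)}) 1 ?_ ?_ ?_ (t := 1 / 4)
      (by norm_num) (by norm_num) _).trans ?_
    · intro x hx e he
      rw [mem_singleton] at he
      subst he
      have h1 := mem_product.1 hx
      rw [Sym2.mk_isDiag_iff]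
      intro h2
      exact hdis h1.1 (h2 ▸ h1.2)
    · simp
    · intro x hx y hy hxy
      rw [disjoint_singleton, Ne, Sym2.eq_iff]
      have h1 := mem_product.1 hx
      have h2 := mem_product.1 hy
      rintro (⟨h3, h4⟩ | ⟨h3, h4⟩)
      · exact hxy (Prod.ext h3 h4)
      · exact hdis h1.1 (h3 ▸ h2.2)
    · apply Real.exp_le_exp.2
      rw [card_product, hcA, hcB, pow_one]
      have h1 : θ ^ 2 * (D * d) ≤ m * m * p := by
        rw [hdDp]
        have := mul_le_mul hm1 hm1 (by positivity) (Nat.cast_nonneg m)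
        nlinarith
      push_cast
      linarith
  · have hT2 : (#T : ℝ) ≤ Real.exp L ^ (m + m) := by
      have h1 : #T ≤ n ^ (m + m) := by
        refine (card_filter_le _ _).trans ?_
        rw [card_product, card_powersetCard, card_univ, Fintype.card_fin, pow_add]
        exact Nat.mul_le_mul (Nat.choose_le_pow _ _) (Nat.choose_le_pow _ _)
      rw [h.exp_eq]
      exact_mod_cast h1
    refine (mul_le_mul_of_nonneg_right hT2 (Real.exp_pos _).le).trans ?_
    rw [← Real.exp_nat_mul, ← Real.exp_add]
    apply Real.exp_le_exp.2
    have h2 := h.sq_le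
    have h3 := h.sq_large
    have h4 := h.large
    have hm0 : (1 : ℝ) ≤ m := by linarith
    rw [hθ] at hmd
    have h5 : (m : ℝ) * (2 * L - 1 / 16 * (m * p)) ≤ 1 * (2 * L - 1 / 16 * (m * p)) :=
      mul_le_mul_of_nonpos_right hm0 (by linarith)
    push_cast
    nlinarith

end typical

/-! ### Typical properties: rigidity of small sets -/

/-- The functional graph of a map is `3`-colourable: every finite set of vertices contains one with
at most two neighbours in the set. -/
lemma exists_three_coloring {κ : Type*} [Fintype κ] (F : κ → κ) :
    ∃ c : κ → Fin 3, ∀ y, F y ≠ y → c y ≠ c (F y) := by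
  classical
  suffices H : ∀ S : Finset κ, ∃ c : κ → Fin 3, ∀ y ∈ S, F y ∈ S → F y ≠ y → c y ≠ c (F y) by
    obtain ⟨c, hc⟩ := H univ
    exact ⟨c, fun y => hc y (mem_univ _) (mem_univ _)⟩
  intro S
  induction S using Finset.strongInduction with
  | H S ih =>
    rcases S.eq_empty_or_nonempty with rfl | hS
    · exact ⟨fun _ => 0, by simp⟩
    -- some vertex of `S` has at most one preimage in `S`
    obtain ⟨y, hy, hfib⟩ := exists_card_fiber_le_of_card_le_mul (f := F) (s := S) (t := S) (n := 1)
      hS (by simp)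
    obtain ⟨c, hc⟩ := ih (S.erase y) (erase_ssubset hy)
    obtain ⟨k, hk⟩ : ∃ k : Fin 3, k ∉ insert (c (F y)) (image c {x ∈ S | F x = y}) := by
      by_contra! hall
      have h1 : #(univ : Finset (Fin 3)) ≤ #(insert (c (F y)) (image c {x ∈ S | F x = y})) :=
        card_le_card fun k _ => hall k
      have h2 := card_insert_le (c (F y)) (image c {x ∈ S | F x = y})
      have h3 := card_image_le (s := {x ∈ S | F x = y}) (f := c)
      simp at h1
      omega
    simp only [mem_insert, mem_image, mem_filter, not_or, not_exists, not_and] at hk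
    refine ⟨Function.update c y k, fun x hx hFx hne => ?_⟩
    rcases eq_or_ne x y with rfl | hxy
    · rw [Function.update_self, Function.update_of_ne hne]
      exact hk.1
    rw [Function.update_of_ne hxy]
    rcases eq_or_ne (F x) y with hFy | hFy
    · rw [hFy, Function.update_self]
      exact hk.2 x ⟨hx, hFy⟩
    · rw [Function.update_of_ne hFy]
      exact hc x (mem_erase.2 ⟨hxy, hx⟩) (mem_erase.2 ⟨hFy, hFx⟩) hne

section typical
variable {n : ℕ} {p : unitInterval} {L : ℝ}

/-- For two fixed lists `a` and `b` of vertices, few pairs of positions carry edges in both lists.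
The pairs of possible edges in question are not disjoint, but each shares its second member with the
first member of at most one other; a `3`-colouring splits them into disjoint families. -/
lemma prob_list_rigid_le {m : ℕ} {a b : Fin m → Fin n} (ha : Function.Injective a)
    (hb : Function.Injective b) (R : ℝ) :
    (SimpleGraph.binomialRandom (Fin n) p).real
      {X | 3 * R < cnt (fun y : Fin m × Fin m => (X.Adj (a y.1) (a y.2) ∧ X.Adj (b y.1) (b y.2) ∧
        s(b y.1, b y.2) ≠ s(a y.1, a y.2)) ∧ y.1 < y.2)} ≤
      3 * Real.exp (2 * ((m : ℝ) * p) ^ 2 - R) := by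
  classical
  set Λ : Finset (Fin m × Fin m) := {y | y.1 < y.2 ∧ s(b y.1, b y.2) ≠ s(a y.1, a y.2)} with hΛ
  have hinj : ∀ u : Fin m → Fin n, Function.Injective u → ∀ y ∈ Λ, ∀ y' ∈ Λ,
      s(u y.1, u y.2) = s(u y'.1, u y'.2) → y = y' := by
    intro u hu y hy y' hy' he
    simp only [hΛ, mem_filter, mem_univ, true_and] at hy hy'
    rw [Sym2.eq_iff] at he
    rcases he with ⟨h1, h2⟩ | ⟨h1, h2⟩
    · exact Prod.ext (hu h1) (hu h2)
    · have h1 := hu h1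
      have h2 := hu h2
      have h3 := hy.1
      rw [h1, h2] at h3
      exact absurd h3 (lt_asymm hy'.1)
  -- `F y` is the position whose pair in the list `a` is the pair of `y` in the list `b`
  set F : Fin m × Fin m → Fin m × Fin m := fun y =>
    if h : ∃ y' ∈ Λ, s(a y'.1, a y'.2) = s(b y.1, b y.2) then h.choose else y with hF
  have hFspec : ∀ y, ∀ y' ∈ Λ, s(a y'.1, a y'.2) = s(b y.1, b y.2) → F y = y' := by
    intro y y' hy' he
    have h : ∃ y' ∈ Λ, s(a y'.1, a y'.2) = s(b y.1, b y.2) := ⟨y', hy', he⟩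
    simp only [hF, dif_pos h]
    exact hinj a ha _ h.choose_spec.1 _ hy' (h.choose_spec.2.trans he.symm)
  obtain ⟨c, hc⟩ := exists_three_coloring F
  set S : Fin 3 → Set (SimpleGraph (Fin n)) := fun k =>
    {X | R ≤ cnt (fun y : Fin m × Fin m => y ∈ ({y ∈ Λ | c y = k} : Finset (Fin m × Fin m)) ∧
      ∀ e ∈ ({s(a y.1, a y.2), s(b y.1, b y.2)} : Finset (Sym2 (Fin n))), e ∈ X.edgeSet)} with hS
  refine le_trans (real_mono p (T := {X | ∃ k, X ∈ S k}) fun X hX => ?_)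
    ((real_exists_le p S (b := Real.exp (2 * ((m : ℝ) * p) ^ 2 - R)) fun k => ?_).trans ?_)
  · by_contra hcon
    simp only [Set.mem_ofPred_eq, not_exists, hS, not_le] at hcon
    rw [Set.mem_ofPred_eq] at hX
    have h0 := hcon 0
    have h1 := hcon 1
    have h2 := hcon 2
    have h3 := cnt_le_add (R := fun y : Fin m × Fin m => y ∈ Λ ∧
        ∀ e ∈ ({s(a y.1, a y.2), s(b y.1, b y.2)} : Finset (Sym2 (Fin n))), e ∈ X.edgeSet)
      (P := fun y : Fin m × Fin m => y ∈ ({y ∈ Λ | c y = 0} : Finset (Fin m × Fin m)) ∧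
        ∀ e ∈ ({s(a y.1, a y.2), s(b y.1, b y.2)} : Finset (Sym2 (Fin n))), e ∈ X.edgeSet)
      (Q := fun y => (y ∈ ({y ∈ Λ | c y = 1} : Finset (Fin m × Fin m)) ∧
        ∀ e ∈ ({s(a y.1, a y.2), s(b y.1, b y.2)} : Finset (Sym2 (Fin n))), e ∈ X.edgeSet) ∨
        (y ∈ ({y ∈ Λ | c y = 2} : Finset (Fin m × Fin m)) ∧
        ∀ e ∈ ({s(a y.1, a y.2), s(b y.1, b y.2)} : Finset (Sym2 (Fin n))), e ∈ X.edgeSet))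
      (fun y hy => by
        have : ∀ k : Fin 3, k = 0 ∨ k = 1 ∨ k = 2 := by decide
        rcases this (c y) with hk | hk | hk
        · exact Or.inl ⟨mem_filter.2 ⟨hy.1, hk⟩, hy.2⟩
        · exact Or.inr (Or.inl ⟨mem_filter.2 ⟨hy.1, hk⟩, hy.2⟩)
        · exact Or.inr (Or.inr ⟨mem_filter.2 ⟨hy.1, hk⟩, hy.2⟩))
    have h4 := cnt_or_le (fun y : Fin m × Fin m =>
        y ∈ ({y ∈ Λ | c y = 1} : Finset (Fin m × Fin m)) ∧
        ∀ e ∈ ({s(a y.1, a y.2), s(b y.1, b y.2)} : Finset (Sym2 (Fin n))), e ∈ X.edgeSet)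
      (fun y : Fin m × Fin m => y ∈ ({y ∈ Λ | c y = 2} : Finset (Fin m × Fin m)) ∧
        ∀ e ∈ ({s(a y.1, a y.2), s(b y.1, b y.2)} : Finset (Sym2 (Fin n))), e ∈ X.edgeSet)
    have h5 := cnt_mono (P := fun y : Fin m × Fin m => (X.Adj (a y.1) (a y.2) ∧
        X.Adj (b y.1) (b y.2) ∧ s(b y.1, b y.2) ≠ s(a y.1, a y.2)) ∧ y.1 < y.2)
      (Q := fun y : Fin m × Fin m => y ∈ Λ ∧
        ∀ e ∈ ({s(a y.1, a y.2), s(b y.1, b y.2)} : Finset (Sym2 (Fin n))), e ∈ X.edgeSet)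
      (fun y hy => ⟨mem_filter.2 ⟨mem_univ _, hy.2, hy.1.2.2⟩, by
        intro e he
        simp only [mem_insert, mem_singleton] at he
        rcases he with rfl | rfl
        · exact hy.1.1
        · exact hy.1.2.1⟩)
    linarith
  · refine (real_le_count_le p _ (fun y : Fin m × Fin m => {s(a y.1, a y.2), s(b y.1, b y.2)}) 2
      ?_ ?_ ?_ (t := 1) (by norm_num) le_rfl _).trans ?_
    · intro y hy e he
      have h1 := (mem_filter.1 (mem_filter.1 hy).1).2.1
      simp only [mem_insert, mem_singleton] at he
      rcases he with rfl | rfl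
      · simpa using fun h => h1.ne (ha h)
      · simpa using fun h => h1.ne (hb h)
    · intro y hy
      exact card_pair (mem_filter.1 (mem_filter.1 hy).1).2.2.symm
    · intro y hy y' hy' hne
      obtain ⟨hy, hk⟩ := mem_filter.1 hy
      obtain ⟨hy', hk'⟩ := mem_filter.1 hy'
      have hno : ∀ z ∈ Λ, ∀ z' ∈ Λ, c z = k → c z' = k → z ≠ z' →
          s(a z'.1, a z'.2) ≠ s(b z.1, b z.2) := by
        intro z hz z' hz' hk hk' hne he
        have h1 := hFspec z z' hz' he
        refine hc z (fun h => hne (h.symm.trans h1)) ?_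
        rw [h1, hk, hk']
      rw [Finset.disjoint_left]
      intro e he he'
      simp only [mem_insert, mem_singleton] at he he'
      rcases he with rfl | rfl <;> rcases he' with he' | he'
      · exact hne (hinj a ha _ hy _ hy' he')
      · exact hno y' hy' y hy hk' hk hne.symm he'
      · exact hno y hy y' hy' hk hk' hne he'.symm
      · exact hne (hinj b hb _ hy _ hy' he')
    · apply Real.exp_le_exp.2
      have h1 : (#({y ∈ Λ | c y = k} : Finset (Fin m × Fin m)) : ℝ) ≤ (m : ℝ) ^ 2 := by
        have := card_le_univ ({y ∈ Λ | c y = k} : Finset (Fin m × Fin m))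
        rw [Fintype.card_prod, Fintype.card_fin, ← sq] at this
        exact_mod_cast this
      have h2 := mul_le_mul_of_nonneg_right h1 (sq_nonneg (p : ℝ))
      rw [mul_pow]
      linarith
  · simp

/-- No injection `f` maps many edges inside a set of at most `2 * D` vertices to other edges. Only
the values of `f` on that set matter, hence a union bound over two lists of `m ≤ 2 * D` vertices. -/
lemma prob_rigid_le (h : Dense n p L) : (SimpleGraph.binomialRandom (Fin n) p).real
    {X | ∃ (P : Fin n → Prop) (f : Fin n → Fin n), cnt P ≤ 2 * ((n : ℝ) * p) ∧
      Function.Injective f ∧ 1 / 80000 * (((n : ℝ) * p) * ((n : ℝ) * p ^ 2)) <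
      cnt (fun x : Fin n × Fin n => P x.1 ∧ P x.2 ∧ X.Adj x.1 x.2 ∧ X.Adj (f x.1) (f x.2) ∧
        s(f x.1, f x.2) ≠ s(x.1, x.2))} ≤ Real.exp (-(2 * L ^ 2)) := by
  classical
  have hp := h.pos
  have hple := h.le
  have hL := h.large
  have hd := h.codeg_large
  have hdD := h.codeg_le_deg
  have hsq := h.sq_le
  have hsq2 := h.sq_large
  have hsmall := h.exp_small (c := 1 / 10 ^ 6) (by norm_num)
  have hn := h.card_large
  set D : ℝ := n * p with hD
  set d : ℝ := n * (p : ℝ) ^ 2 with hd'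
  have hdDp : d = D * p := by rw [hd', hD]; ring
  have hD0 : 0 < D := by linarith
  set R : ℝ := 1 / 480000 * (D * d) with hR
  set S : (m : ℕ) → (Fin m → Fin n) × (Fin m → Fin n) → Set (SimpleGraph (Fin n)) := fun m x =>
    {X | (m : ℝ) ≤ 2 * D ∧ Function.Injective x.1 ∧ Function.Injective x.2 ∧
      3 * R < cnt (fun y : Fin m × Fin m => (X.Adj (x.1 y.1) (x.1 y.2) ∧
        X.Adj (x.2 y.1) (x.2 y.2) ∧ s(x.2 y.1, x.2 y.2) ≠ s(x.1 y.1, x.1 y.2)) ∧ y.1 < y.2)}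
    with hS
  refine le_trans (real_mono p (T := {X | ∃ m : Fin (n + 1), X ∈ {X | ∃ x, X ∈ S m x}})
    fun X hX => ?_) ((real_exists_le p _ (b := 3 * Real.exp (-(1 / 10 ^ 6 * d))) fun m => ?_).trans
      ?_)
  · obtain ⟨P, f, hP, hf, hX⟩ := hX
    set M : Finset (Fin n) := {i | P i} with hM
    have hPM : cnt P = #M := cnt_eq_card P
    have hcard : #M ≤ n := (card_le_univ M).trans (by simp)
    set a : Fin #M → Fin n := fun y => M.orderEmbOfFin rfl y with ha
    have hainj : Function.Injective a := (M.orderEmbOfFin rfl).injective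
    have hsurj : ∀ i, P i → ∃ y, a y = i := fun i hi => by
      have h1 : i ∈ Set.range a := by
        have h2 := range_orderEmbOfFin M rfl
        have h3 : i ∈ (M : Set (Fin n)) := by simpa [hM] using hi
        rw [← h2] at h3
        exact h3
      exact h1
    have : Nonempty (Fin #M) := by
      by_contra hne
      have h0 := cnt_false (P := fun x : Fin n × Fin n => P x.1 ∧ P x.2 ∧ X.Adj x.1 x.2 ∧
        X.Adj (f x.1) (f x.2) ∧ s(f x.1, f x.2) ≠ s(x.1, x.2))
        fun x hx => hne ⟨(hsurj _ hx.1).choose⟩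
      rw [h0] at hX
      exact absurd hX (not_lt.2 (by positivity))
    choose! g hg using hsurj
    refine ⟨⟨#M, Nat.lt_succ_of_le hcard⟩, (a, f ∘ a), ?_, hainj, hf.comp hainj, ?_⟩
    · rw [← hPM]; exact hP
    · have h1 := cnt_le_two_mul_cnt_lt (W := fun y : Fin #M × Fin #M => X.Adj (a y.1) (a y.2) ∧
        X.Adj (f (a y.1)) (f (a y.2)) ∧ s(f (a y.1), f (a y.2)) ≠ s(a y.1, a y.2))
        (fun y hy => ⟨hy.1.symm, hy.2.1.symm, by
          have := hy.2.2
          rwa [Sym2.eq_swap, Sym2.eq_swap (a := a y.1)] at this⟩)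
        (fun y hy hh => hy.1.ne (congrArg a hh))
      have h2 := cnt_le_of_injOn (P := fun x : Fin n × Fin n => P x.1 ∧ P x.2 ∧ X.Adj x.1 x.2 ∧
        X.Adj (f x.1) (f x.2) ∧ s(f x.1, f x.2) ≠ s(x.1, x.2))
        (Q := fun y : Fin #M × Fin #M => X.Adj (a y.1) (a y.2) ∧
        X.Adj (f (a y.1)) (f (a y.2)) ∧ s(f (a y.1), f (a y.2)) ≠ s(a y.1, a y.2))
        (fun x => (g x.1, g x.2)) (fun x hx => by
          rw [hg _ hx.1, hg _ hx.2.1]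
          exact hx.2.2) (fun x y hx hy hxy => by
          rw [Prod.mk.injEq] at hxy
          refine Prod.ext ?_ ?_
          · rw [← hg _ hx.1, ← hg _ hy.1, hxy.1]
          · rw [← hg _ hx.2.1, ← hg _ hy.2.1, hxy.2])
      simp only [Function.comp_apply]
      linarith
  · obtain ⟨m, hmlt⟩ := m
    by_cases hm : (m : ℝ) ≤ 2 * D
    swap
    · refine le_trans (le_of_eq ?_) (mul_nonneg (by norm_num) (Real.exp_pos _).le)
      simp [hS, hm]
    refine (real_exists_le p (S m) (b := 3 * Real.exp (2 * ((m : ℝ) * p) ^ 2 - R))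
      fun x => ?_).trans ?_
    · by_cases hx : Function.Injective x.1 ∧ Function.Injective x.2
      · exact (real_mono p fun X hX => hX.2.2.2).trans (prob_list_rigid_le hx.1 hx.2 R)
      · refine le_trans (le_of_eq ?_) (mul_nonneg (by norm_num) (Real.exp_pos _).le)
        have : S m x = ∅ := by
          ext X
          simp only [hS, Set.mem_ofPred_eq, Set.mem_empty_iff_false, iff_false]
          exact fun hh => hx ⟨hh.2.1, hh.2.2.1⟩
        rw [this]
        simp
    · have h1 : (Fintype.card ((Fin m → Fin n) × (Fin m → Fin n)) : ℝ) =
          Real.exp ((2 * m) * L) := by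
        rw [Fintype.card_prod, Fintype.card_fun, Fintype.card_fin, Fintype.card_fin, two_mul,
          add_mul, Real.exp_add, Real.exp_nat_mul, h.exp_eq]
        push_cast
        rfl
      rw [h1, mul_left_comm, ← Real.exp_add]
      refine mul_le_mul_of_nonneg_left (Real.exp_le_exp.2 ?_) (by norm_num)
      have h2 : (m : ℝ) * L ≤ 2 * D * (1 / 10 ^ 60 * d) :=
        mul_le_mul hm (by linarith) (by linarith) (by linarith)
      have h3 : ((m : ℝ) * p) ^ 2 ≤ 4 / 10 ^ 8 * (D * d) := by
        have h4 : (m : ℝ) * p ≤ 2 * d := by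
          rw [hdDp, ← mul_assoc]
          exact mul_le_mul_of_nonneg_right hm hp.le
        have h5 : ((m : ℝ) * p) ^ 2 ≤ (2 * d) ^ 2 := pow_le_pow_left₀ (by positivity) h4 2
        have h6 : d * d ≤ D * d * (1 / 10 ^ 8) := by
          have : d * d = D * d * p := by rw [hdDp]; ring
          rw [this]
          exact mul_le_mul_of_nonneg_left hple (by positivity)
        nlinarith
      have h7 : d ≤ D * d := by nlinarith
      rw [hR]
      nlinarith
  · rw [Fintype.card_fin, ← mul_assoc]
    refine (mul_le_mul_of_nonneg_right ?_ (Real.exp_pos _).le).trans hsmall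
    push_cast
    nlinarith [mul_pos (by linarith : (0:ℝ) < n) (by linarith : (0:ℝ) < n)]

end typical

/-! ### Typical properties: few contested edges -/

/-- The comparison of the cost `K * (4 * L)` of recording `K` values of the maps `σ i` with the gain
`R` from the coincidences which they reveal. -/
lemma contested_exponent_le {n D d L η s K R : ℝ} (hL : 10 ^ 30 ≤ L) (hn : 10 ^ 100 ≤ n)
    (hd : 10 ^ 100 ≤ d) (hdn : d ≤ n) (hsq : 10 ^ 60 * L ^ 2 ≤ d) (hdD : d ≤ D)
    (hη : η = 5 / 10 ^ 26) (hK1 : K ≤ s * (2 * D)) (hs2 : s ≤ 5 * n * L / (η * d) + 1)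
    (hR2 : 1 / 10 ^ 26 * (n * D) < R + 1) :
    K * (4 * L) + 1 - R ≤ -(2 * L ^ 2) := by
  have hη0 : 0 < η := by rw [hη]; norm_num
  have hn0 : 0 < n := by linarith
  have hd0 : 0 < d := by linarith
  have hD0 : 0 < D := by linarith
  -- `n L / (η d) ≥ 1` absorbs the rounding of `s`
  have h1 : (s : ℝ) * (η * d) ≤ 6 * (n * L) := by
    have h2 : (s : ℝ) * (η * d) ≤ (5 * n * L / (η * d) + 1) * (η * d) :=
      mul_le_mul_of_nonneg_right hs2 (by positivity)
    rw [add_mul, div_mul_cancel₀ _ (by positivity)] at h2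
    have h3 : η * d ≤ 1 * n := mul_le_mul (by rw [hη]; norm_num) hdn hd0.le zero_le_one
    nlinarith
  have h4 : (s : ℝ) * L * d ≤ 12 / 10 ^ 35 * n * d := by
    have h5 : (s : ℝ) * (η * d) * L ≤ 6 * (n * L) * L :=
      mul_le_mul_of_nonneg_right h1 (by linarith)
    have h6 : 6 * (n * L) * L ≤ 6 * n * (1 / 10 ^ 60 * d) := by
      have : (n : ℝ) * (10 ^ 60 * L ^ 2) ≤ n * d := mul_le_mul_of_nonneg_left hsq hn0.le
      nlinarith
    rw [hη] at h5
    nlinarith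
  have h7 : (s : ℝ) * L ≤ 12 / 10 ^ 35 * n := le_of_mul_le_mul_right h4 hd0
  have h8 : (K : ℝ) * (4 * L) ≤ 96 / 10 ^ 35 * (n * D) := by
    have h9 : (K : ℝ) * (4 * L) ≤ s * (2 * D) * (4 * L) :=
      mul_le_mul_of_nonneg_right hK1 (by linarith)
    have h10 : (s : ℝ) * L * D ≤ 12 / 10 ^ 35 * n * D :=
      mul_le_mul_of_nonneg_right h7 hD0.le
    nlinarith
  have h11 : 10 ^ 100 * D ≤ n * D := mul_le_mul_of_nonneg_right hn hD0.le
  linarith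

section typical
variable {n : ℕ} {p : unitInterval} {L : ℝ}

/-- It is unlikely that some `Y` and `σ` have many contested edges. By `Matches.exists_twins` a set
`T` of at most `K` triples then reveals many edges with twins; for fixed `T` this has probability at
most `2 * p ^ R`, and there are few sets `T`. -/
lemma prob_contested_le (h : Dense n p L) {η δ : ℝ} (hη : η = 5 / 10 ^ 26)
    (hδ : δ = 4 / 10 ^ 25) : (SimpleGraph.binomialRandom (Fin n) p).real
    {X | (∀ i, cnt (fun j => X.Adj i j) ≤ 2 * ((n : ℝ) * p)) ∧
      (∀ i j, i ≠ j → cnt (fun w => X.Adj i w ∧ X.Adj j w) ≤ 2 * ((n : ℝ) * p ^ 2)) ∧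
      (∀ i j, i ≠ j → ((n : ℝ) * p ^ 2) / 2 ≤ cnt (fun w => X.Adj i w ∧ X.Adj j w)) ∧
      ∃ Y σ, Matches X Y σ ∧ δ * (n * ((n : ℝ) * p)) <
        cnt (fun x : Fin n × Fin n => Contested Y σ (η * ((n : ℝ) * p ^ 2)) x.1 x.2)} ≤
      Real.exp (-(2 * L ^ 2)) := by
  classical
  have hp := h.pos
  have hple := h.le
  have hL := h.large
  have hd := h.codeg_large
  have hdD := h.codeg_le_deg
  have hsq := h.sq_le
  have hsq2 := h.sq_large
  have hn := h.card_large
  have hdn : (n : ℝ) * (p : ℝ) ^ 2 ≤ n := by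
    have : (p : ℝ) ^ 2 ≤ 1 := pow_le_one₀ hp.le (by linarith)
    nlinarith
  set D : ℝ := n * p with hD
  set d : ℝ := n * (p : ℝ) ^ 2 with hd'
  have hD0 : 0 < D := by linarith
  have hn0 : (0 : ℝ) < n := by linarith
  have hη0 : 0 < η := by rw [hη]; norm_num
  have hd0 : 0 < d := by linarith
  set s : ℕ := ⌈5 * n * L / (η * d)⌉₊ with hs
  have hs1 : 5 * n * L / (η * d) ≤ s := Nat.le_ceil _
  have hs2 : (s : ℝ) < 5 * n * L / (η * d) + 1 := Nat.ceil_lt_add_one (by positivity)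
  set K : ℕ := ⌊(s : ℝ) * (2 * D)⌋₊ with hK
  set R : ℕ := ⌊1 / 10 ^ 26 * ((n : ℝ) * D)⌋₊ with hR
  have hR1 : (R : ℝ) ≤ 1 / 10 ^ 26 * ((n : ℝ) * D) := Nat.floor_le (by positivity)
  have hR2 : 1 / 10 ^ 26 * ((n : ℝ) * D) < R + 1 := Nat.lt_floor_add_one _
  have hnD : 0 < (n : ℝ) * D := by positivity
  refine (real_union_le p ({T | #T ≤ K} : Finset (Finset (Fin n × Fin n × Fin n)))
    (fun T => {G | (∀ e ∈ twinned T, e ∈ G.edgeSet ↔ twin T e ∈ G.edgeSet) ∧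
      2 * R ≤ #{e ∈ twinned T | e ∈ G.edgeSet}}) _ (fun X hX => ?_)
    (b := 2 * (p : ℝ) ^ R) fun T _ => real_twins_le p _ _ (fun e he => (twin_spec he).1) R).trans ?_
  · obtain ⟨hdeg, hcod, hcod', Y, σ, hM, hcon⟩ := hX
    obtain ⟨T, hT, htw, hcnt⟩ := hM.exists_twins (Nat.cast_pos.1 hn0) hd0 hη0.le hdeg hcod hcod' s
      (by
        have h1 : 5 * L ≤ s * (η * d) / n := by
          rw [le_div_iff₀ hn0]
          rw [div_le_iff₀ (by positivity)] at hs1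
          linarith
        have h2 : Real.exp (-(s * (η * d) / n)) ≤ Real.exp (-(5 * L)) :=
          Real.exp_le_exp.2 (by linarith)
        have h3 : Real.exp (-(5 * L)) = ((n : ℝ) ^ 5)⁻¹ := by
          rw [Real.exp_neg, ← h.exp_eq, ← Real.exp_nat_mul]
          norm_num
        calc ((n : ℝ) ^ 3 + n ^ 2) * Real.exp (-(s * (η * d) / n))
            ≤ ((n : ℝ) ^ 3 + n ^ 2) * ((n : ℝ) ^ 5)⁻¹ := by
              rw [← h3]; exact mul_le_mul_of_nonneg_left h2 (by positivity)
          _ < 1 := by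
              rw [← div_eq_mul_inv, div_lt_one (by positivity)]
              have h4 : (n : ℝ) ^ 5 = n ^ 3 * (n * n) := by ring
              have h5 : (n : ℝ) ^ 2 ≤ n ^ 3 := pow_le_pow_right₀ (by linarith) (by norm_num)
              have h6 : (3 : ℝ) ≤ n * n := by nlinarith
              have h7 : 0 < (n : ℝ) ^ 3 := by positivity
              rw [h4]
              nlinarith)
    refine ⟨T, ?_, htw, ?_⟩
    · simpa using Nat.le_floor hT
    · have h1 : 2 * (R : ℝ) ≤ #{e ∈ twinned T | e ∈ X.edgeSet} := by
        have : cnt (fun x : Fin n × Fin n => Contested Y σ (η * d) x.1 x.2) / 4 - η * (n * D) ≤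
          2 * (#{e ∈ twinned T | e ∈ X.edgeSet} : ℝ) := hcnt
        rw [hδ] at hcon
        rw [hη] at this
        rw [hη] at hcon
        linarith
      exact_mod_cast h1
  · have hT1 : (#({T | #T ≤ K} : Finset (Finset (Fin n × Fin n × Fin n))) : ℝ) ≤
        Real.exp (K * (4 * L)) := by
      have h1 := card_finsets_le (α := Fin n × Fin n × Fin n) K
      simp only [Fintype.card_prod, Fintype.card_fin] at h1
      have h2 : ((n * (n * n) + 1 : ℕ) : ℝ) ≤ Real.exp (4 * L) := by
        have h3 : Real.exp (4 * L) = (n : ℝ) ^ 4 := by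
          rw [← h.exp_eq, ← Real.exp_nat_mul]; norm_num
        rw [h3]
        push_cast
        have : (1 : ℝ) ≤ n * (n * n) := by nlinarith
        have e4 : (n : ℝ) ^ 4 = n * (n * (n * n)) := by ring
        rw [e4]
        nlinarith
      rw [Real.exp_nat_mul]
      refine le_trans ?_ (pow_le_pow_left₀ (Nat.cast_nonneg _) h2 K)
      exact_mod_cast h1
    have hpR : (p : ℝ) ^ R ≤ Real.exp (-(R : ℝ)) := by
      have h1 : (p : ℝ) ≤ Real.exp (-1) := by
        have h2 := Real.exp_one_lt_d9
        rw [Real.exp_neg, ← one_div, le_div_iff₀ (Real.exp_pos _)]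
        nlinarith
      have h3 := pow_le_pow_left₀ hp.le h1 R
      rwa [← Real.exp_nat_mul, mul_neg_one] at h3
    have h2e : (2 : ℝ) ≤ Real.exp 1 := by have := Real.add_one_le_exp 1; linarith
    calc (#({T | #T ≤ K} : Finset (Finset (Fin n × Fin n × Fin n))) : ℝ) * (2 * (p : ℝ) ^ R)
        ≤ Real.exp (K * (4 * L)) * (Real.exp 1 * Real.exp (-(R : ℝ))) := by gcongr
      _ = Real.exp (K * (4 * L) + 1 - R) := by
          rw [← Real.exp_add, ← Real.exp_add]; congr 1; ring
      _ ≤ Real.exp (-(2 * L ^ 2)) := by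
          apply Real.exp_le_exp.2
          have hK1 : (K : ℝ) ≤ s * (2 * D) := Nat.floor_le (by positivity)
          exact contested_exponent_le hL hn hd hdn hsq hdD hη hK1 hs2.le hR2

end typical

/-! ### Typical graphs are determined by their neighbourhoods -/

section main
variable {n : ℕ}

lemma mem_nbhdVerts_one (G : SimpleGraph (Fin n)) (i w : Fin n) :
    w ∈ nbhdVerts G 1 i ↔ i = w ∨ G.Adj i w := by
  rw [nbhdVerts, Set.mem_ofPred_eq, Nat.cast_one, SimpleGraph.edist_le_one_iff_adj_or_eq, or_comm]

open scoped Classical in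
lemma exists_matches {X Y : SimpleGraph (Fin n)}
    (h : ∀ i, IsoWithFixedPoint (nbhd X 1 i) (nbhd Y 1 i) i) : ∃ σ, Matches X Y σ := by
  choose hS hT f hf using h
  have hval : ∀ i w (hw : w ∈ nbhdVerts X 1 i),
      (f i).toEquiv.extendSubtype w = (f i ⟨w, hw⟩ : Fin n) := fun i w hw =>
    Equiv.extendSubtype_apply_of_mem _ w hw
  have hfix : ∀ i, (f i).toEquiv.extendSubtype i = i := fun i => by
    rw [hval i i (hS i), hf i]
  refine ⟨fun i => (f i).toEquiv.extendSubtype, hfix, fun i j => ?_, fun i j k hj hk => ?_⟩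
  · constructor
    · intro hij
      have hj : j ∈ nbhdVerts X 1 i := (mem_nbhdVerts_one X i j).2 (Or.inr hij)
      have h1 : (nbhd X 1 i).Adj ⟨i, hS i⟩ ⟨j, hj⟩ := hij
      rw [← (f i).map_adj_iff, hf i] at h1
      rw [hval i j hj]
      exact h1
    · intro hij
      have hj' : (f i).toEquiv.extendSubtype j ∈ nbhdVerts Y 1 i :=
        (mem_nbhdVerts_one Y i _).2 (Or.inr hij)
      have hj : j ∈ nbhdVerts X 1 i := by
        by_contra hj
        exact (f i).toEquiv.extendSubtype_not_mem j hj hj'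
      have h1 : (nbhd Y 1 i).Adj (f i ⟨i, hS i⟩) (f i ⟨j, hj⟩) := by
        rw [hf i]
        rw [hval i j hj] at hij
        exact hij
      rw [(f i).map_adj_iff] at h1
      exact h1
  · have hj' : j ∈ nbhdVerts X 1 i := (mem_nbhdVerts_one X i j).2 (Or.inr hj)
    have hk' : k ∈ nbhdVerts X 1 i := (mem_nbhdVerts_one X i k).2 (Or.inr hk)
    rw [hval i j hj', hval i k hk']
    exact ((f i).map_adj_iff (v := ⟨j, hj'⟩) (w := ⟨k, hk'⟩)).symm

/-- The properties of the random graph that force it to be determined by its neighbourhoods. Here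
`L` is the logarithm of the number of vertices. All of them concern `X` alone, except that the last
one quantifies over the graphs `Y` with matching neighbourhoods. -/
structure Typical (X : SimpleGraph (Fin n)) (p L : ℝ) : Prop where
  deg_le : ∀ i, cnt (fun j => X.Adj i j) ≤ 2 * (n * p)
  le_deg : ∀ i, n * p / 2 ≤ cnt (fun j => X.Adj i j)
  codeg_le : ∀ i j, i ≠ j → cnt (fun w => X.Adj i w ∧ X.Adj j w) ≤ (1 + 1 / 10000) * (n * p ^ 2)
  le_codeg : ∀ i j, i ≠ j → (1 - 1 / 10000) * (n * p ^ 2) ≤ cnt (fun w => X.Adj i w ∧ X.Adj j w)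
  codeg3_le : ∀ i j k, i ≠ j → i ≠ k → j ≠ k →
    cnt (fun w => X.Adj i w ∧ X.Adj j w ∧ X.Adj k w) ≤ 1 / 10000 * (n * p ^ 2)
  edges_le : ∀ P : Fin n → Prop, cnt (fun x : Fin n × Fin n => P x.1 ∧ P x.2 ∧ X.Adj x.1 x.2) ≤
    2 * cnt P * (cnt P * p + 4 * L ^ 2)
  expansion : ∀ A B : Finset (Fin n), 3 * (1 / 10 ^ 8) * (n * p) ≤ #A →
    3 * (1 / 10 ^ 8) * (n * p) ≤ #B → (1 / 10 ^ 8) ^ 2 / 2 * ((n * p) * (n * p ^ 2)) ≤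
      cnt (fun x : Fin n × Fin n => x ∈ A ×ˢ B ∧ X.Adj x.1 x.2)
  rigid : ∀ (P : Fin n → Prop) (f : Fin n → Fin n), cnt P ≤ 2 * (n * p) → Function.Injective f →
    cnt (fun x : Fin n × Fin n => P x.1 ∧ P x.2 ∧ X.Adj x.1 x.2 ∧ X.Adj (f x.1) (f x.2) ∧
      s(f x.1, f x.2) ≠ s(x.1, x.2)) ≤ 1 / 80000 * ((n * p) * (n * p ^ 2))
  contested_le : ∀ Y σ, Matches X Y σ →
    cnt (fun x : Fin n × Fin n => Contested Y σ (5 / 10 ^ 26 * (n * p ^ 2)) x.1 x.2) ≤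
      4 / 10 ^ 25 * (n * (n * p))

lemma Typical.determinedByNbhds {X : SimpleGraph (Fin n)} {p L : ℝ} (hX : Typical X p L)
    (h : Dense n p L) : DeterminedByNbhds X := by
  intro Y hY
  obtain ⟨σ, hM⟩ := exists_matches hY
  have hp := h.pos
  have hple := h.le
  have hd := h.codeg_large
  have hdD := h.codeg_le_deg
  have hsq := h.sq_le
  have hcod2 : ∀ i j, i ≠ j → cnt (fun w => X.Adj i w ∧ X.Adj j w) ≤ 2 * (n * p ^ 2) :=
    fun i j hij => (hX.codeg_le i j hij).trans (by linarith)
  have hcod1 : ∀ i j, i ≠ j → n * p ^ 2 / 2 ≤ cnt (fun w => X.Adj i w ∧ X.Adj j w) :=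
    fun i j hij => le_trans (by linarith) (hX.le_codeg i j hij)
  have hnD : 0 ≤ (n : ℝ) * (n * p) := by positivity
  obtain ⟨φ, hφ⟩ := sum_flags_le hM (D := n * p) (d := n * p ^ 2) (η := 5 / 10 ^ 26) (by positivity)
    (by norm_num) hX.deg_le hcod2 (hX.contested_le Y σ hM)
  -- `b = 2 * (4 / 10 ^ 25) + 2 * (5 / 10 ^ 26)` is supplied by `hφ`; with `β = 10⁻¹⁷` the fraction
  -- of disagreeing neighbours is `18 * 10⁻⁸ + 18 * 10⁻⁸`, and `145` times this is below `1 / 16000`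
  obtain ⟨τ, hτ⟩ := exists_dominant_preimage hM (N := n) (D := n * p) (d := n * p ^ 2)
    (θ := 1 / 10 ^ 8) (β := 1 / 10 ^ 17) (b := 9 / 10 ^ 25) rfl (by linarith) (by linarith)
    (by norm_num) (by norm_num) (by norm_num) (by linarith) hX.deg_le hX.le_deg hX.expansion φ
    (hφ.trans (le_of_eq (by ring)))
  have hmoved := dominant_preimage_eq_self hM (N := n) (D := n * p) (d := n * p ^ 2)
    (by linarith) (by linarith) (by nlinarith) hX.deg_le hX.le_deg hcod2 hcod1 τ hτ
  exact hM.eq_of_few_moved (D := n * p) (d := n * p ^ 2) (p := p) (L := L ^ 2) hX.deg_le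
    hX.le_codeg hX.codeg_le hX.codeg3_le hX.edges_le hX.rigid hp (by linarith) rfl (by ring)
    (by linarith) (by linarith) (hmoved.trans (mul_le_mul_of_nonneg_right (by norm_num) hnD))

open MeasureTheory

/-- An exceptional event of probability at most `b` may be discarded at the cost of `b`. -/
lemma real_sub_le {V : Type*} [Fintype V] (p : unitInterval) {E : Set (SimpleGraph V)}
    {P : SimpleGraph V → Prop} {a b : ℝ} (hE : (SimpleGraph.binomialRandom V p).real E ≤ b)
    (h : a ≤ (SimpleGraph.binomialRandom V p).real {X | X ∉ E → P X}) :
    a - b ≤ (SimpleGraph.binomialRandom V p).real {X | P X} := by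
  have h1 : (SimpleGraph.binomialRandom V p).real {X | X ∉ E → P X} ≤
      (SimpleGraph.binomialRandom V p).real ({X | P X} ∪ E) :=
    real_mono p fun X hX => by
      by_cases hXE : X ∈ E
      · exact Or.inr hXE
      · exact Or.inl (hX hXE)
  have h2 := measureReal_union_le (μ := SimpleGraph.binomialRandom V p) {X | P X} E
  linarith

lemma prob_determined_ge {p : unitInterval} {L : ℝ} (h : Dense n p L) :
    1 - 9 * Real.exp (-(2 * L ^ 2)) ≤ (SimpleGraph.binomialRandom (Fin n) p).real
      {X | DeterminedByNbhds X} := by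
  classical
  have hd := h.codeg_large
  set b := Real.exp (-(2 * L ^ 2)) with hb
  have key : 1 - b - b - b - b - b - b - b - b - b ≤
      (SimpleGraph.binomialRandom (Fin n) p).real {X | DeterminedByNbhds X} := by
    refine real_sub_le p (prob_deg_le h) (real_sub_le p (prob_le_deg h)
      (real_sub_le p (prob_codeg_le h) (real_sub_le p (prob_le_codeg h)
      (real_sub_le p (prob_codeg3_le h) (real_sub_le p (prob_edges_le h)
      (real_sub_le p (prob_expansion_le h rfl) (real_sub_le p (prob_rigid_le h)
      (real_sub_le p (prob_contested_le h rfl rfl) ?_))))))))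
    refine le_of_eq_of_le probReal_univ.symm (real_mono p fun X _ => ?_)
    intro h9 h8 h7 h6 h5 h4 h3 h2 h1
    simp only [Set.mem_ofPred_eq, not_exists, not_and, not_le, Prod.forall] at h1 h2 h3 h4
    simp only [Set.mem_ofPred_eq, not_exists, not_and, not_le, not_lt, Prod.forall] at h5 h6 h7 h8
    simp only [Set.mem_ofPred_eq, not_exists, not_and, not_lt] at h9
    have hdeg : ∀ i, cnt (fun j => X.Adj i j) ≤ 2 * ((n : ℝ) * p) := fun i => (h1 i).le
    refine Typical.determinedByNbhds (p := p) (L := L) ⟨hdeg, fun i => (h2 i).le,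
      fun i j hij => (h3 i j hij).le, fun i j hij => (h4 i j hij).le,
      fun i j k hij hik hjk => (h5 i j k ⟨hij, hik, hjk⟩).le, h6, h7, h8,
      h9 hdeg (fun i j hij => (h3 i j hij).le.trans (by linarith))
        (fun i j hij => le_trans (by linarith) (h4 i j hij).le)⟩ h
  linarith

lemma Dense.of_rpow_le {n : ℕ} {p : ℝ} (hn : 1 ≤ n) (hp : 0 < p)
    (hlog : 10 ^ 30 ≤ Real.log n) (hle : p ≤ 1 / 10 ^ 8)
    (hdense : (n : ℝ) ^ (-(1 / 2) : ℝ) * Real.log n ^ (2 : ℝ) ≤ p) : Dense n p (Real.log n) := by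
  have hn0 : (0 : ℝ) < n := by exact_mod_cast hn
  refine ⟨Real.exp_log hn0, hlog, hp, hle, ?_⟩
  have h1 : ((n : ℝ) ^ (-(1 / 2) : ℝ)) ^ 2 = (n : ℝ)⁻¹ := by
    rw [← Real.rpow_natCast, ← Real.rpow_mul hn0.le, ← Real.rpow_neg_one]
    norm_num
  have h2 : Real.log n ^ (2 : ℝ) = Real.log n ^ 2 := by
    rw [← Real.rpow_natCast]; norm_num
  have h3 : ((n : ℝ) ^ (-(1 / 2) : ℝ) * Real.log n ^ (2 : ℝ)) ^ 2 ≤ p ^ 2 :=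
    pow_le_pow_left₀ (by rw [h2]; positivity) hdense 2
  rw [mul_pow, h1, h2, ← pow_mul, inv_mul_le_iff₀ hn0] at h3
  exact h3

end main
end ShotgunAssembly

theorem theorem3 :
    ∃ C c : ℝ, 0 < C ∧ 0 < c ∧
      ∀ p : ℕ → unitInterval,
        (∀ n : ℕ, 1 ≤ n → 0 < (p n : ℝ)) →
        (∀ᶠ n : ℕ in Filter.atTop,
          (n : ℝ) ^ (-(1 / 2) : ℝ) * Real.log (n : ℝ) ^ C ≤ (p n : ℝ) ∧ (p n : ℝ) ≤ c) →
        ∃ ω : ℕ → ℝ, (∀ n : ℕ, 0 ≤ ω n) ∧ Filter.Tendsto ω Filter.atTop Filter.atTop ∧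
          ∀ n : ℕ, 1 ≤ n →
            1 - (n : ℝ) ^ (-(ω n)) ≤
              (SimpleGraph.binomialRandom (Fin n) (p n)).real
                {Γ : SimpleGraph (Fin n) | ShotgunAssembly.DeterminedByNbhds Γ} := by
  classical
  refine ⟨2, 1 / 10 ^ 8, by norm_num, by norm_num, fun p hpos hp => ?_⟩
  have hlog : Filter.Tendsto (fun n : ℕ => Real.log n) Filter.atTop Filter.atTop :=
    Real.tendsto_log_atTop.comp tendsto_natCast_atTop_atTop
  -- `ω n = log n` in the range where the estimates apply; the bound is trivial for `ω n = 0`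
  refine ⟨fun n => if ShotgunAssembly.Dense n (p n) (Real.log n) then Real.log n else 0,
    fun n => ?_, ?_, fun n hn => ?_⟩
  · dsimp only
    split_ifs
    · exact Real.log_natCast_nonneg n
    · exact le_rfl
  · refine hlog.congr' ?_
    filter_upwards [hp, hlog.eventually_ge_atTop (10 ^ 30), Filter.eventually_ge_atTop 1]
      with n hpn hln hn
    rw [if_pos (ShotgunAssembly.Dense.of_rpow_le hn (hpos n hn) hln hpn.2 hpn.1)]
  · dsimp only
    split_ifs with h
    · refine le_trans ?_ (ShotgunAssembly.prob_determined_ge h)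
      have hn0 : (0 : ℝ) < n := by exact_mod_cast hn
      have h1 := h.large
      rw [Real.rpow_def_of_pos hn0]
      set L := Real.log n
      have h2 : Real.exp (L * -L) = Real.exp (L ^ 2) * Real.exp (-(2 * L ^ 2)) := by
        rw [← Real.exp_add]; congr 1; ring
      have h3 : 9 ≤ Real.exp (L ^ 2) := by
        have := Real.add_one_le_exp (L ^ 2)
        nlinarith
      rw [h2]
      have := mul_le_mul_of_nonneg_right h3 (Real.exp_pos (-(2 * L ^ 2))).le
      linarith
    · simp
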